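/- Let $\mathbb T=\mathbb R/2\pi\mathbb Z$ and $\mathcal H=L^2([0,\pi]\times\mathbb T)$ (real-valued functions of $(s,t)$, norm $\|\cdot\|$), and let $\phi_{(m,n)}=\frac{\sqrt2}{\pi}\sin(ms)\cos(nt)$, $\psi_{(m,n)}=\frac{\sqrt2}{\pi}\sin(ms)\sin(nt)$ for integers $m\ge 1$, $n\ge 0$. Let $\mathcal R$ (respectively $\mathcal N$) be the closed linear span in $\mathcal H$ of the $\phi_{(m,n)},\psi_{(m,n)}$ with $m\ne n$ (respectively $m=n$), and let $\mathcal H^1$ be the space of all $x\in\mathcal R\cap H^1([0,\pi]\times\mathbb T)$ with zero trace on $s=0$ and $s=\pi$, with the $H^1$ topology. For $(a,b)\in\mathbb R^2$, a weak solution of $$u_{tt}-u_{ss}=au^+-bu^-\ \text{ in } ]0,\pi[\times\mathbb T,\qquad u(0,t)=u(\pi,t)=0, \tag{P}$$ where $u^+=\max\{u,0\}$ and $u^-=u^+-u$, is a function $u=x+y$ such that $(x,y)\in\mathcal H^1\times\mathcal N$ is a critical point of $$\mathcal I(x,y)=\tfrac12\left(\|x_s\|^2-\|x_t\|^2-a\|(x+y)^+\|^2-b\|(x+y)^-\|^2\right)$$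 on $\mathcal H^1\times\mathcal N$; it is nontrivial if $u\neq0$. Let $\dots<\lambda_{-2}<\lambda_{-1}<\lambda_0=0<\lambda_1<\lambda_2<\dots$ be the numbers $m^2-n^2$ ($m\ge1$, $n\ge0$ integers) in increasing order. **Theorem.** Let $k\in\mathbb Z$ with $\lambda_k\ne0$. Put $\tilde R_k=\,]-\infty,\lambda_{k+1}[^2$ if $\lambda_k<0$ and $\tilde R_k=\,]0,\lambda_{k+1}[^2$ if $\lambda_k>0$. There is a continuous curve $\mathcal D_k\subset\tilde R_k$ (the image of a nonempty open interval under a continuous injective map) such that 1. $(\lambda_k,\lambda_k)\in\mathcal D_k$; 2. $\mathcal D_k$ is symmetric with respect to the line $b=a$ and, if $k\neq1$, it is the graph of a strictly decreasing function $b=b(a)$; 3. for every $(a,b)\in\mathcal D_k$, problem (P) has a nontrivial weak solution; 4. $\tilde R_k\setminus\mathcal D_k$ has exactly two connected components, one of which contains $]\lambda_k,\lambda_{k+1}[^2$; the points of that component are said to lie above $\mathcal D_k$; 5. for every $(a,b)\in\tilde R_k$ above $\mathcal D_k$, problem (P) has no nontrivial weak solution. -/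

import Mathlib

open scoped ContDiff

noncomputable section

namespace WaveFucik

open MeasureTheory Set

/-- The cylinder `[0,π] × 𝕋`, `𝕋 = ℝ / 2πℤ`, is represented by the fundamental domain
`(0,π) × (0,2π)` with Lebesgue measure; points are `(s, t)`. Periodicity in `t` is expressed
through `2π`-periodic test functions. -/
def cylinderMeasure : Measure (ℝ × ℝ) :=
  (volume : Measure (ℝ × ℝ)).restrict (Ioo 0 Real.pi ×ˢ Ioo 0 (2 * Real.pi))

instance : IsFiniteMeasure cylinderMeasure :=
  ⟨by
    rw [cylinderMeasure, Measure.restrict_apply_univ, Measure.volume_eq_prod, Measure.prod_prod,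
      Real.volume_Ioo, Real.volume_Ioo]
    exact ENNReal.mul_lt_top ENNReal.ofReal_lt_top ENNReal.ofReal_lt_top⟩

/-- The real Hilbert space `𝓗 = L²([0,π] × 𝕋)`. -/
abbrev L2 : Type := Lp ℝ 2 cylinderMeasure

/-- `φ_{(m,n)}(s,t) = (√2/π) sin(ms) cos(nt)`. -/
def phiFun (m n : ℕ) (p : ℝ × ℝ) : ℝ :=
  Real.sqrt 2 / Real.pi * Real.sin (m * p.1) * Real.cos (n * p.2)

/-- `ψ_{(m,n)}(s,t) = (√2/π) sin(ms) sin(nt)`. -/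
def psiFun (m n : ℕ) (p : ℝ × ℝ) : ℝ :=
  Real.sqrt 2 / Real.pi * Real.sin (m * p.1) * Real.sin (n * p.2)

theorem abs_const_mul_le (x y : ℝ) (hx : |x| ≤ 1) (hy : |y| ≤ 1) :
    ‖Real.sqrt 2 / Real.pi * x * y‖ ≤ Real.sqrt 2 / Real.pi := by
  have hc : 0 ≤ Real.sqrt 2 / Real.pi := div_nonneg (Real.sqrt_nonneg _) Real.pi_pos.le
  rw [Real.norm_eq_abs, abs_mul, abs_mul, abs_of_nonneg hc, mul_assoc]
  exact mul_le_of_le_one_right hc (mul_le_one₀ hx (abs_nonneg _) hy)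

theorem memLp_phiFun (m n : ℕ) : MemLp (phiFun m n) 2 cylinderMeasure := by
  have hcont : Continuous (phiFun m n) := by unfold phiFun; fun_prop
  exact MemLp.of_bound hcont.aestronglyMeasurable _ (Filter.Eventually.of_forall fun p =>
    abs_const_mul_le _ _ (Real.abs_sin_le_one _) (Real.abs_cos_le_one _))

theorem memLp_psiFun (m n : ℕ) : MemLp (psiFun m n) 2 cylinderMeasure := by
  have hcont : Continuous (psiFun m n) := by unfold psiFun; fun_prop
  exact MemLp.of_bound hcont.aestronglyMeasurable _ (Filter.Eventually.of_forall fun p =>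
    abs_const_mul_le _ _ (Real.abs_sin_le_one _) (Real.abs_sin_le_one _))

/-- `φ_{(m,n)}` as an element of `𝓗`. -/
def phi (m n : ℕ) : L2 := (memLp_phiFun m n).toLp (phiFun m n)

/-- `ψ_{(m,n)}` as an element of `𝓗`. -/
def psi (m n : ℕ) : L2 := (memLp_psiFun m n).toLp (psiFun m n)

/-- `𝓡`, the closed span of the `φ_{(m,n)}`, `ψ_{(m,n)}` with `m ≥ 1`, `n ≥ 0`, `m ≠ n`. -/
def rangeSpace : Submodule ℝ L2 :=
  (Submodule.span ℝ {v : L2 | ∃ m n : ℕ, 1 ≤ m ∧ m ≠ n ∧ (v = phi m n ∨ v = psi m n)}).topologicalClosure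

/-- `𝓝`, the closed span of the `φ_{(l,l)}`, `ψ_{(l,l)}` with `l ≥ 1`
(the kernel of the wave operator). -/
def kernelSpace : Submodule ℝ L2 :=
  (Submodule.span ℝ {v : L2 | ∃ l : ℕ, 1 ≤ l ∧ (v = phi l l ∨ v = psi l l)}).topologicalClosure

/-- Smooth functions on the closed cylinder: smooth functions of `(s,t)`, `2π`-periodic in `t`.
They need not vanish at `s = 0` and `s = π`. -/
def IsTestFunction (η : ℝ × ℝ → ℝ) : Prop :=
  ContDiff ℝ ∞ η ∧ ∀ s t : ℝ, η (s, t + 2 * Real.pi) = η (s, t)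

/-- `g = (∂_e x)` in the weak sense, tested against smooth functions up to the boundary.
With `e = (1,0)` this says both that `g` is the weak `s`-derivative of `x` and that the trace of
`x` on `s = 0` and `s = π` is zero, since no boundary term appears in the integration by parts. -/
def IsWeakDeriv (e : ℝ × ℝ) (x g : L2) : Prop :=
  ∀ η : ℝ × ℝ → ℝ, IsTestFunction η →
    ∫ p, x p * fderiv ℝ η p e ∂cylinderMeasure = -∫ p, g p * η p ∂cylinderMeasure

theorem integrable_mul_of_continuous (x : L2) {h : ℝ × ℝ → ℝ} (hh : Continuous h) :
    Integrable (fun p => x p * h p) cylinderMeasure := by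
  have hK : IsCompact (Icc (0 : ℝ) Real.pi ×ˢ Icc (0 : ℝ) (2 * Real.pi)) :=
    isCompact_Icc.prod isCompact_Icc
  obtain ⟨C, hC⟩ := hK.exists_bound_of_continuousOn hh.continuousOn
  have hx : Integrable (fun p => x p) cylinderMeasure := (Lp.memLp x).integrable (by norm_num)
  refine hx.mul_bdd (c := C) hh.aestronglyMeasurable ?_
  rw [cylinderMeasure]
  refine (ae_restrict_mem (measurableSet_Ioo.prod measurableSet_Ioo)).mono fun p hp => ?_
  exact hC p ⟨Ioo_subset_Icc_self hp.1, Ioo_subset_Icc_self hp.2⟩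

theorem IsTestFunction.continuous_fderiv_apply {η : ℝ × ℝ → ℝ} (hη : IsTestFunction η)
    (e : ℝ × ℝ) : Continuous fun p => fderiv ℝ η p e :=
  (hη.1.continuous_fderiv (by simp)).clm_apply continuous_const

theorem integral_add_mul (x y : L2) {h : ℝ × ℝ → ℝ} (hh : Continuous h) :
    ∫ p, (x + y : L2) p * h p ∂cylinderMeasure =
      ∫ p, x p * h p ∂cylinderMeasure + ∫ p, y p * h p ∂cylinderMeasure := by
  rw [← integral_add (integrable_mul_of_continuous x hh) (integrable_mul_of_continuous y hh)]
  refine integral_congr_ae ((Lp.coeFn_add x y).mono fun p hp => ?_)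
  simp only [hp, Pi.add_apply, add_mul]

theorem integral_smul_mul (c : ℝ) (x : L2) (h : ℝ × ℝ → ℝ) :
    ∫ p, (c • x : L2) p * h p ∂cylinderMeasure = c * ∫ p, x p * h p ∂cylinderMeasure := by
  rw [← integral_const_mul]
  refine integral_congr_ae ((Lp.coeFn_smul c x).mono fun p hp => ?_)
  simp only [hp, Pi.smul_apply, smul_eq_mul, mul_assoc]

theorem IsWeakDeriv.zero (e : ℝ × ℝ) : IsWeakDeriv e 0 0 := by
  intro η _
  have h0 : ∀ h : ℝ × ℝ → ℝ, ∫ p, (0 : L2) p * h p ∂cylinderMeasure = 0 := fun h => by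
    simpa using integral_smul_mul 0 0 h
  rw [h0, h0, neg_zero]

theorem IsWeakDeriv.add {e : ℝ × ℝ} {x g y h : L2} (hx : IsWeakDeriv e x g)
    (hy : IsWeakDeriv e y h) : IsWeakDeriv e (x + y) (g + h) := by
  intro η hη
  rw [integral_add_mul _ _ (hη.continuous_fderiv_apply e), integral_add_mul _ _ hη.1.continuous,
    hx η hη, hy η hη]
  ring

theorem IsWeakDeriv.smul {e : ℝ × ℝ} {x g : L2} (c : ℝ) (hx : IsWeakDeriv e x g) :
    IsWeakDeriv e (c • x) (c • g) := by
  intro η hη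
  rw [integral_smul_mul, integral_smul_mul, hx η hη]
  ring

/-- The space `𝓗¹` of the `x ∈ 𝓡 ∩ H¹([0,π] × 𝕋)` with zero trace on `s = 0` and `s = π`,
realised, with its `H¹` topology, as the space of the triples `(x, x_s, x_t)` in `𝓗 × 𝓗 × 𝓗`. -/
def H1 : Submodule ℝ (L2 × L2 × L2) where
  carrier := {q | q.1 ∈ rangeSpace ∧ IsWeakDeriv (1, 0) q.1 q.2.1 ∧ IsWeakDeriv (0, 1) q.1 q.2.2}
  zero_mem' := ⟨rangeSpace.zero_mem, IsWeakDeriv.zero _, IsWeakDeriv.zero _⟩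
  add_mem' := fun hp hq =>
    ⟨rangeSpace.add_mem hp.1 hq.1, hp.2.1.add hq.2.1, hp.2.2.add hq.2.2⟩
  smul_mem' := fun c _ hq =>
    ⟨rangeSpace.smul_mem c hq.1, hq.2.1.smul c, hq.2.2.smul c⟩

/-- The function `u = x + y` identified with a pair `(x, y) ∈ 𝓗¹ × 𝓝`. -/
def toFunction (z : H1 × kernelSpace) : L2 := (z.1 : L2 × L2 × L2).1 + (z.2 : L2)

/-- The energy functional on `𝓗¹ × 𝓝`,
`½ (‖x_s‖² - ‖x_t‖² - a ‖(x+y)⁺‖² - b ‖(x+y)⁻‖²)`, with `w⁻ = max (-w) 0`. -/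
def energy (a b : ℝ) (z : H1 × kernelSpace) : ℝ :=
  1 / 2 * (‖(z.1 : L2 × L2 × L2).2.1‖ ^ 2 - ‖(z.1 : L2 × L2 × L2).2.2‖ ^ 2
    - a * ‖Lp.posPart (toFunction z)‖ ^ 2 - b * ‖Lp.negPart (toFunction z)‖ ^ 2)

/-- A weak solution of `u_tt - u_ss = a u⁺ - b u⁻`, `u(0,t) = u(π,t) = 0`, `u` being `2π`-periodic
in `t`: a critical point of the energy functional. -/
def IsWeakSolution (a b : ℝ) (z : H1 × kernelSpace) : Prop :=
  HasFDerivAt (energy a b) (0 : H1 × kernelSpace →L[ℝ] ℝ) z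

def HasNontrivialWeakSolution (a b : ℝ) : Prop :=
  ∃ z : H1 × kernelSpace, IsWeakSolution a b z ∧ toFunction z ≠ 0

/-- The eigenvalues `m² - n²`, `m ≥ 1`, `n ≥ 0`, of the wave operator. -/
def IsEigenvalue (j : ℤ) : Prop :=
  ∃ m n : ℕ, 1 ≤ m ∧ j = (m : ℤ) ^ 2 - (n : ℤ) ^ 2

/-- The eigenvalues in increasing order, `… < λ₋₂ < λ₋₁ < λ₀ = 0 < λ₁ < λ₂ < …`:
`λ_k` is the `k`-th nonnegative eigenvalue (counting from `0`) for `k ≥ 0`, and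
`-λ_{-(k+1)}` is the `k`-th positive `j` such that `-j` is an eigenvalue. -/
def eigenvalueInt : ℤ → ℤ
  | Int.ofNat k => (Nat.nth (fun j => IsEigenvalue (j : ℤ)) k : ℤ)
  | Int.negSucc k => -(Nat.nth (fun j => 0 < j ∧ IsEigenvalue (-(j : ℤ))) k : ℤ)

/-- `λ_k` as a real number. -/
def eigenvalue (k : ℤ) : ℝ := (eigenvalueInt k : ℝ)

/-- `R̃_k`: `]-∞, λ_{k+1}[²` if `λ_k < 0`, and `]0, λ_{k+1}[²` if `λ_k > 0`. -/
def region (k : ℤ) : Set (ℝ × ℝ) :=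
  if eigenvalue k < 0 then Iio (eigenvalue (k + 1)) ×ˢ Iio (eigenvalue (k + 1))
  else Ioo 0 (eigenvalue (k + 1)) ×ˢ Ioo 0 (eigenvalue (k + 1))

/-- A continuous (simple) curve without endpoints: the image of a nonempty open interval under a
continuous injective map. -/
def IsContinuousCurve (D : Set (ℝ × ℝ)) : Prop :=
  ∃ (J : Set ℝ) (γ : ℝ → ℝ × ℝ), IsOpen J ∧ J.OrdConnected ∧ J.Nonempty ∧
    ContinuousOn γ J ∧ InjOn γ J ∧ γ '' J = D

/-- `D` is the graph `{(a, f a) : a ∈ J}` of a strictly decreasing function `f : J → ℝ`. -/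
def IsStrictlyDecreasingGraph (D : Set (ℝ × ℝ)) : Prop :=
  ∃ (J : Set ℝ) (f : ℝ → ℝ), StrictAntiOn f J ∧ D = (fun a => (a, f a)) '' J

/-- `D` divides `R` into exactly two connected components, and `U` is the one that contains `Q`:
`R \ D` is the disjoint union of the nonempty connected open sets `U` and `V`, and `Q ⊆ U`. -/
def DividesWithSide (R D Q U : Set (ℝ × ℝ)) : Prop :=
  ∃ V : Set (ℝ × ℝ), IsOpen U ∧ IsOpen V ∧ IsConnected U ∧ IsConnected V ∧ Disjoint U V ∧
    R \ D = U ∪ V ∧ Q ⊆ U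

end WaveFucik

end

/-!
The problem is solved by a dual variational principle. If `u` is a weak solution and
`h = a u⁺ - b u⁻`, then `h ∈ 𝓡`, the component of `u` in `𝓡` is `T h`, with `T` the inverse
of the wave operator on `𝓡` (`invWave`), and `u = α h⁺ - β h⁻` with `(α, β) = (1/a, 1/b)` (both
coefficients have the same sign in the regions considered; when it is negative, `α` and `β` are
exchanged, which is undone by passing to `-h`). Hence nontrivial weak solutions correspond to
nonzero critical points
on `𝓡` of `f h = ½ (α ‖h⁺‖² + β ‖h⁻‖² - ⟨T h, h⟩)`: this is `hasNontrivialWeakSolution_iff`. It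
rests on the diagonalisation of the wave operator, that is, on the completeness of the
trigonometric system, which follows from the Stone–Weierstrass theorem, and on the fact that `T`
maps `𝓡` into `𝓗¹`.

Let `l = λ_k` and split `𝓡 = X ⊕ Y`, where `X` is spanned by the modes with inverse eigenvalue at
least `1/l`, and `Y` by the others. For `a, b` in the side of the square `R̃_k` the functional is
uniformly convex along `Y`, so that `v ↦ min_{w ∈ Y} f (v + w)` is well defined on `X`; its
critical points are those of `f`. Let `S` be the set of the `(a, b)` for which this reduced
functional is nonnegative at some `v ≠ 0` (`lowerSet`).

* `S` is a lower set, symmetric, and relatively closed. For `l > 0` the space `X` is finite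
  dimensional and closedness is compactness of its unit sphere. For `l < 0` the space `X` is
  infinite dimensional, but then `α, β < 0`, and the compactness of `T` allows one to pass to the
  limit in the fibre condition along weakly convergent sequences (`FiberNonneg.of_frequently`).
* The curve is the upper boundary of `S` in the direction `(1, 1)`. This boundary is a
  graph over an interval of the antidiagonal, and its complement in the square has two connected
  pieces; this is elementary plane geometry.
* On the curve the reduced functional is nowhere positive, since a positive value would persist at
  larger `(a, b)`; a point where it is nonnegative is therefore a maximum, and the corresponding
  minimiser in the fibre is a critical point at level `0` (`exists_critical`).
* A nontrivial critical point has level `0` by homogeneity, and by convexity it minimises `f` on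
  its fibre; so there is none outside `S` (`FiberNonneg.of_critical`).

A horizontal segment in the curve would give a common critical point `h` for two values of `a`,
hence `h⁺ = 0`, and testing with the positive eigenfunction `φ_{(1,0)}`, whose eigenvalue is `1`,
yields `b = 1`. This is impossible for `l < 0`. For `l > 1` it is excluded because, if `z` is an
eigenfunction for `l` and `M` is large, then `v = z - M φ_{(1,0)} ≤ 0` is an element of `X` at
which the reduced functional is positive when `b = 1`: as `v⁺ = 0`, the part `(v + w)⁺` is
controlled by `w`. For `l = 1`, that is `k = 1`, such segments do occur.
-/

noncomputable section

namespace WaveFucik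

open MeasureTheory Set Filter Topology
open scoped InnerProductSpace

/-! ### Positive and negative parts in `L²` -/

section PosPart

variable {Ω : Type*} [MeasurableSpace Ω] {μ : Measure Ω}

theorem posPart_sub_negPart (h : Lp ℝ 2 μ) : Lp.posPart h - Lp.negPart h = h := by
  apply Lp.ext
  filter_upwards [Lp.coeFn_sub (Lp.posPart h) (Lp.negPart h), Lp.coeFn_posPart h,
    Lp.coeFn_negPart_eq_max h] with p h1 h2 h3
  rw [h1, Pi.sub_apply, h2, h3]
  rcases le_total (h p) 0 with h0 | h0
  · rw [max_eq_right h0, max_eq_left (by linarith)]; ring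
  · rw [max_eq_left h0, max_eq_right (by linarith)]; ring

theorem inner_posPart_negPart (h : Lp ℝ 2 μ) : ⟪Lp.posPart h, Lp.negPart h⟫_ℝ = 0 := by
  rw [L2.inner_def]
  refine integral_eq_zero_of_ae ?_
  filter_upwards [Lp.coeFn_posPart h, Lp.coeFn_negPart_eq_max h] with p h2 h3
  rw [h2, h3]
  rcases le_total (h p) 0 with h0 | h0
  · simp [max_eq_right h0]
  · simp [max_eq_right (neg_nonpos.2 h0)]

theorem inner_nonneg_of_ae {x y : Lp ℝ 2 μ} (hx : ∀ᵐ p ∂μ, 0 ≤ x p) (hy : ∀ᵐ p ∂μ, 0 ≤ y p) :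
    0 ≤ ⟪x, y⟫_ℝ := by
  rw [L2.inner_def]
  refine integral_nonneg_of_ae ?_
  filter_upwards [hx, hy] with p h2 h3
  simpa using mul_nonneg h3 h2

theorem posPart_ae_nonneg (h : Lp ℝ 2 μ) : ∀ᵐ p ∂μ, 0 ≤ Lp.posPart h p := by
  filter_upwards [Lp.coeFn_posPart h] with p hp
  rw [hp]; exact le_max_right _ _

theorem inner_posPart_posPart_nonneg (h k : Lp ℝ 2 μ) : 0 ≤ ⟪Lp.posPart h, Lp.posPart k⟫_ℝ :=
  inner_nonneg_of_ae (posPart_ae_nonneg h) (posPart_ae_nonneg k)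

theorem negPart_neg (h : Lp ℝ 2 μ) : Lp.negPart (-h) = Lp.posPart h := by
  rw [Lp.negPart, neg_neg]

theorem posPart_neg (h : Lp ℝ 2 μ) : Lp.posPart (-h) = Lp.negPart h := rfl

theorem norm_posPart_sq_add (h : Lp ℝ 2 μ) :
    ‖Lp.posPart h‖ ^ 2 + ‖Lp.negPart h‖ ^ 2 = ‖h‖ ^ 2 := by
  conv_rhs => rw [← posPart_sub_negPart h, norm_sub_sq_real, inner_posPart_negPart]
  ring

/-- First order expansion of `h ↦ ‖h⁺‖²`: convexity, with a remainder that also controls the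
increment of `h⁺`. -/
theorem posPart_excess (h k : Lp ℝ 2 μ) :
    ‖Lp.posPart (h + k) - Lp.posPart h‖ ^ 2
      ≤ ‖Lp.posPart (h + k)‖ ^ 2 - ‖Lp.posPart h‖ ^ 2 - 2 * ⟪Lp.posPart h, k⟫_ℝ := by
  have hk : k = Lp.posPart (h + k) - Lp.negPart (h + k) - (Lp.posPart h - Lp.negPart h) := by
    rw [posPart_sub_negPart, posPart_sub_negPart]; abel
  have e : ⟪Lp.posPart h, k⟫_ℝ = ⟪Lp.posPart h, Lp.posPart (h + k)⟫_ℝ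
      - ⟪Lp.posPart h, Lp.negPart (h + k)⟫_ℝ - ‖Lp.posPart h‖ ^ 2 := by
    conv_lhs => rw [hk]
    rw [inner_sub_right, inner_sub_right, inner_sub_right, inner_posPart_negPart,
      real_inner_self_eq_norm_sq]
    ring
  rw [e, norm_sub_sq_real, real_inner_comm]
  have := inner_posPart_posPart_nonneg h (-(h + k))
  rw [posPart_neg] at this
  linarith

theorem negPart_excess (h k : Lp ℝ 2 μ) :
    ‖Lp.negPart (h + k) - Lp.negPart h‖ ^ 2
      ≤ ‖Lp.negPart (h + k)‖ ^ 2 - ‖Lp.negPart h‖ ^ 2 + 2 * ⟪Lp.negPart h, k⟫_ℝ := by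
  have := posPart_excess (-h) (-k)
  rw [← neg_add, posPart_neg, posPart_neg, inner_neg_right] at this
  linarith

/-- The two remainders of the first order expansions of `‖h⁺‖²` and `‖h⁻‖²` add up to `‖k‖²`. -/
theorem excess_add (h k : Lp ℝ 2 μ) :
    (‖Lp.posPart (h + k)‖ ^ 2 - ‖Lp.posPart h‖ ^ 2 - 2 * ⟪Lp.posPart h, k⟫_ℝ)
      + (‖Lp.negPart (h + k)‖ ^ 2 - ‖Lp.negPart h‖ ^ 2 + 2 * ⟪Lp.negPart h, k⟫_ℝ) = ‖k‖ ^ 2 := by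
  have h1 := norm_posPart_sq_add (h + k)
  have h2 := norm_posPart_sq_add h
  have h3 := norm_add_sq_real h k
  have h4 : ⟪h, k⟫_ℝ = ⟪Lp.posPart h, k⟫_ℝ - ⟪Lp.negPart h, k⟫_ℝ := by
    rw [← inner_sub_left, posPart_sub_negPart]
  linarith

theorem norm_posPart_add_sub_le (h k : Lp ℝ 2 μ) :
    ‖Lp.posPart (h + k) - Lp.posPart h‖ ≤ ‖k‖ := by
  refine abs_le_of_sq_le_sq' ?_ (norm_nonneg _) |>.2
  have h1 := posPart_excess h k
  have h2 := negPart_excess h k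
  have h3 := excess_add h k
  nlinarith [sq_nonneg ‖Lp.negPart (h + k) - Lp.negPart h‖]

theorem norm_negPart_add_sub_le (h k : Lp ℝ 2 μ) :
    ‖Lp.negPart (h + k) - Lp.negPart h‖ ≤ ‖k‖ := by
  have := norm_posPart_add_sub_le (-h) (-k)
  rwa [← neg_add, posPart_neg, posPart_neg, norm_neg] at this

theorem posPart_smul {c : ℝ} (hc : 0 ≤ c) (h : Lp ℝ 2 μ) :
    Lp.posPart (c • h) = c • Lp.posPart h := by
  apply Lp.ext
  filter_upwards [Lp.coeFn_posPart (c • h), Lp.coeFn_smul c h, Lp.coeFn_posPart h,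
    Lp.coeFn_smul c (Lp.posPart h)] with p h1 h2 h3 h4
  rw [h1, h2, h4, Pi.smul_apply, Pi.smul_apply, h3, smul_eq_mul, smul_eq_mul,
    mul_max_of_nonneg _ _ hc, mul_zero]

theorem negPart_smul {c : ℝ} (hc : 0 ≤ c) (h : Lp ℝ 2 μ) :
    Lp.negPart (c • h) = c • Lp.negPart h := by
  rw [Lp.negPart, ← smul_neg, posPart_smul hc, posPart_neg]

end PosPart

/-! ### The asymmetric quadratic functional -/

section Functional

variable {Ω : Type*} [MeasurableSpace Ω] {μ : Measure Ω}

/-- The asymmetric multiplication `h ↦ α h⁺ - β h⁻`. -/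
def asymMul (x : ℝ × ℝ) (h : Lp ℝ 2 μ) : Lp ℝ 2 μ :=
  x.1 • Lp.posPart h - x.2 • Lp.negPart h

/-- The functional `½ (α ‖h⁺‖² + β ‖h⁻‖² - ⟨T h, h⟩)`, with `x = (α, β)`. -/
def asymForm (T : Lp ℝ 2 μ →L[ℝ] Lp ℝ 2 μ) (x : ℝ × ℝ) (h : Lp ℝ 2 μ) : ℝ :=
  1 / 2 * (x.1 * ‖Lp.posPart h‖ ^ 2 + x.2 * ‖Lp.negPart h‖ ^ 2 - ⟪T h, h⟫_ℝ)

variable {T : Lp ℝ 2 μ →L[ℝ] Lp ℝ 2 μ} {x y : ℝ × ℝ}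

theorem inner_asymMul (h k : Lp ℝ 2 μ) :
    ⟪asymMul x h, k⟫_ℝ = x.1 * ⟪Lp.posPart h, k⟫_ℝ - x.2 * ⟪Lp.negPart h, k⟫_ℝ := by
  rw [asymMul, inner_sub_left, real_inner_smul_left, real_inner_smul_left]

theorem inner_asymMul_self (h : Lp ℝ 2 μ) :
    ⟪asymMul x h, h⟫_ℝ = x.1 * ‖Lp.posPart h‖ ^ 2 + x.2 * ‖Lp.negPart h‖ ^ 2 := by
  rw [inner_asymMul]
  have e1 : ⟪Lp.posPart h, h⟫_ℝ = ‖Lp.posPart h‖ ^ 2 := by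
    conv_lhs => rw [← posPart_sub_negPart h, posPart_sub_negPart h]
    nth_rewrite 2 [← posPart_sub_negPart h]
    rw [inner_sub_right, inner_posPart_negPart, real_inner_self_eq_norm_sq, sub_zero]
  have e2 : ⟪Lp.negPart h, h⟫_ℝ = -‖Lp.negPart h‖ ^ 2 := by
    nth_rewrite 2 [← posPart_sub_negPart h]
    rw [inner_sub_right, real_inner_comm, inner_posPart_negPart, real_inner_self_eq_norm_sq,
      zero_sub]
  rw [e1, e2]; ring

theorem asymForm_eq_inner (h : Lp ℝ 2 μ) :
    asymForm T x h = 1 / 2 * ⟪asymMul x h - T h, h⟫_ℝ := by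
  rw [asymForm, inner_sub_left, inner_asymMul_self]

theorem asymForm_neg (h : Lp ℝ 2 μ) : asymForm T x (-h) = asymForm T x.swap h := by
  simp only [asymForm, posPart_neg, negPart_neg, map_neg, inner_neg_neg, Prod.fst_swap,
    Prod.snd_swap]
  ring

theorem asymMul_neg (h : Lp ℝ 2 μ) : asymMul x (-h) = -asymMul x.swap h := by
  simp only [asymMul, posPart_neg, negPart_neg, Prod.fst_swap, Prod.snd_swap]
  abel

theorem asymForm_smul {c : ℝ} (hc : 0 ≤ c) (h : Lp ℝ 2 μ) :
    asymForm T x (c • h) = c ^ 2 * asymForm T x h := by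
  simp only [asymForm, posPart_smul hc, negPart_smul hc, map_smul, norm_smul, real_inner_smul_left,
    real_inner_smul_right, Real.norm_eq_abs, abs_of_nonneg hc]
  ring

theorem asymForm_mono (h1 : x.1 ≤ y.1) (h2 : x.2 ≤ y.2) (h : Lp ℝ 2 μ) :
    asymForm T x h ≤ asymForm T y h := by
  unfold asymForm
  have := mul_le_mul_of_nonneg_right h1 (sq_nonneg ‖Lp.posPart h‖)
  have := mul_le_mul_of_nonneg_right h2 (sq_nonneg ‖Lp.negPart h‖)
  linarith

theorem asymForm_sub_le {η : ℝ} (h1 : |x.1 - y.1| ≤ η) (h2 : |x.2 - y.2| ≤ η) (h : Lp ℝ 2 μ) :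
    asymForm T x h - asymForm T y h ≤ η / 2 * ‖h‖ ^ 2 := by
  unfold asymForm
  have := mul_le_mul_of_nonneg_right ((le_abs_self _).trans h1) (sq_nonneg ‖Lp.posPart h‖)
  have := mul_le_mul_of_nonneg_right ((le_abs_self _).trans h2) (sq_nonneg ‖Lp.negPart h‖)
  rw [← norm_posPart_sq_add h]
  linarith

/-- Second order lower bound of the functional, along directions in which `T` is small. -/
theorem asymForm_add_ge (hT : ∀ u v, ⟪T u, v⟫_ℝ = ⟪u, T v⟫_ℝ) {c : ℝ} (h k : Lp ℝ 2 μ)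
    (h1 : ⟪T k, k⟫_ℝ ≤ (x.1 - c) * ‖k‖ ^ 2) (h2 : ⟪T k, k⟫_ℝ ≤ (x.2 - c) * ‖k‖ ^ 2) :
    asymForm T x h + ⟪asymMul x h - T h, k⟫_ℝ + c / 2 * ‖k‖ ^ 2 ≤ asymForm T x (h + k) := by
  have e1 := posPart_excess h k
  have e2 := negPart_excess h k
  have e3 := excess_add h k
  have s : ⟪T k, h⟫_ℝ = ⟪T h, k⟫_ℝ := by rw [hT, real_inner_comm]
  have b : (⟪T k, k⟫_ℝ + c * ‖k‖ ^ 2) ≤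
      x.1 * (‖Lp.posPart (h + k)‖ ^ 2 - ‖Lp.posPart h‖ ^ 2 - 2 * ⟪Lp.posPart h, k⟫_ℝ)
      + x.2 * (‖Lp.negPart (h + k)‖ ^ 2 - ‖Lp.negPart h‖ ^ 2 + 2 * ⟪Lp.negPart h, k⟫_ℝ) := by
    have p1 := (sq_nonneg _).trans e1
    have p2 := (sq_nonneg _).trans e2
    set P := ‖Lp.posPart (h + k)‖ ^ 2 - ‖Lp.posPart h‖ ^ 2 - 2 * ⟪Lp.posPart h, k⟫_ℝ
    set N := ‖Lp.negPart (h + k)‖ ^ 2 - ‖Lp.negPart h‖ ^ 2 + 2 * ⟪Lp.negPart h, k⟫_ℝ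
    rw [← e3] at h1 h2 ⊢
    rcases le_total x.1 x.2 with hx | hx
    · nlinarith [mul_le_mul_of_nonneg_right hx p2]
    · nlinarith [mul_le_mul_of_nonneg_right hx p1]
  simp only [asymForm, map_add, inner_add_left, inner_add_right, inner_sub_left, inner_asymMul, s]
  linarith

/-- Second order lower bound of the functional in an arbitrary direction. -/
theorem exists_asymForm_add_ge (hT : ∀ u v, ⟪T u, v⟫_ℝ = ⟪u, T v⟫_ℝ) (x : ℝ × ℝ) :
    ∃ C : ℝ, 0 ≤ C ∧ ∀ h k : Lp ℝ 2 μ,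
      asymForm T x h + ⟪asymMul x h - T h, k⟫_ℝ - C * ‖k‖ ^ 2 ≤ asymForm T x (h + k) := by
  refine ⟨(‖T‖ + |x.1| + |x.2|) / 2, by positivity, fun h k => ?_⟩
  have hk : ⟪T k, k⟫_ℝ ≤ ‖T‖ * ‖k‖ ^ 2 := by
    refine (real_inner_le_norm _ _).trans ?_
    nlinarith [T.le_opNorm k, norm_nonneg k]
  have := asymForm_add_ge hT (x := x) (c := -(‖T‖ + |x.1| + |x.2|)) h k
    (hk.trans (mul_le_mul_of_nonneg_right (by
      linarith [neg_abs_le x.1, abs_nonneg x.2]) (sq_nonneg _)))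
    (hk.trans (mul_le_mul_of_nonneg_right (by
      linarith [neg_abs_le x.2, abs_nonneg x.1]) (sq_nonneg _)))
  linarith

/-- The gradient `h ↦ α h⁺ - β h⁻ - T h` of the functional is Lipschitz. -/
theorem exists_norm_gradient_sub_le (T : Lp ℝ 2 μ →L[ℝ] Lp ℝ 2 μ) (x : ℝ × ℝ) :
    ∃ C : ℝ, 0 ≤ C ∧ ∀ h k : Lp ℝ 2 μ,
      ‖(asymMul x (h + k) - T (h + k)) - (asymMul x h - T h)‖ ≤ C * ‖k‖ := by
  refine ⟨|x.1| + |x.2| + ‖T‖, by positivity, fun h k => ?_⟩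
  have e : (asymMul x (h + k) - T (h + k)) - (asymMul x h - T h)
      = x.1 • (Lp.posPart (h + k) - Lp.posPart h) - x.2 • (Lp.negPart (h + k) - Lp.negPart h)
        - T k := by
    rw [asymMul, asymMul, map_add]; module
  rw [e]
  refine (norm_sub_le _ _).trans ((add_le_add_left (norm_sub_le _ _) _).trans ?_)
  rw [norm_smul, norm_smul, Real.norm_eq_abs, Real.norm_eq_abs, add_mul, add_mul]
  gcongr
  · exact norm_posPart_add_sub_le h k
  · exact norm_negPart_add_sub_le h k
  · exact T.le_opNorm k

theorem continuous_asymForm (T : Lp ℝ 2 μ →L[ℝ] Lp ℝ 2 μ) :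
    Continuous fun z : (ℝ × ℝ) × Lp ℝ 2 μ => asymForm T z.1 z.2 := by
  unfold asymForm
  have h1 : Continuous fun z : (ℝ × ℝ) × Lp ℝ 2 μ => Lp.posPart z.2 :=
    Lp.continuous_posPart.comp continuous_snd
  have h2 : Continuous fun z : (ℝ × ℝ) × Lp ℝ 2 μ => Lp.negPart z.2 :=
    Lp.continuous_negPart.comp continuous_snd
  have h3 : Continuous fun z : (ℝ × ℝ) × Lp ℝ 2 μ => ⟪T z.2, z.2⟫_ℝ :=
    (T.continuous.comp continuous_snd).inner continuous_snd
  fun_prop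

end Functional

/-! ### Minimisation along a subspace -/

section Reduction

theorem eq_zero_of_forall_mul_le_sq {p C : ℝ} (h : ∀ t : ℝ, t * p ≤ C * t ^ 2) : p = 0 := by
  have hC : 0 < |C| + 1 := by positivity
  have h1 := h (p / (|C| + 1))
  have h2 : C * (p / (|C| + 1)) ^ 2 ≤ |C| * (p / (|C| + 1)) ^ 2 :=
    mul_le_mul_of_nonneg_right (le_abs_self C) (sq_nonneg _)
  have h3 : p / (|C| + 1) * p = (|C| + 1) * (p / (|C| + 1)) ^ 2 := by field_simp
  have h4 : (p / (|C| + 1)) ^ 2 ≤ 0 := by linarith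
  have h5 : p / (|C| + 1) = 0 := by nlinarith [sq_nonneg (p / (|C| + 1))]
  rcases div_eq_zero_iff.1 h5 with h | h
  · exact h
  · exact absurd h hC.ne'

variable {Ω : Type*} [MeasurableSpace Ω] {μ : Measure Ω}

/-- Quantitative form of "the largest eigenvalue of `T` on `X` is smaller than `α` and `β`",
which makes the functional uniformly convex along `X`. -/
def Subcritical (T : Lp ℝ 2 μ →L[ℝ] Lp ℝ 2 μ) (X : Submodule ℝ (Lp ℝ 2 μ)) (c : ℝ)
    (x : ℝ × ℝ) : Prop :=
  ∀ k ∈ X, ⟪T k, k⟫_ℝ ≤ (x.1 - c) * ‖k‖ ^ 2 ∧ ⟪T k, k⟫_ℝ ≤ (x.2 - c) * ‖k‖ ^ 2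

/-- Along some fibre `v + Y` with `0 ≠ v ∈ X` the functional is nonnegative. -/
def FiberNonneg (T : Lp ℝ 2 μ →L[ℝ] Lp ℝ 2 μ) (X Y : Submodule ℝ (Lp ℝ 2 μ)) (x : ℝ × ℝ) : Prop :=
  ∃ v ∈ X, v ≠ 0 ∧ ∀ w ∈ Y, 0 ≤ asymForm T x (v + w)

variable {T : Lp ℝ 2 μ →L[ℝ] Lp ℝ 2 μ} {X Y : Submodule ℝ (Lp ℝ 2 μ)} {x y : ℝ × ℝ} {c : ℝ}

theorem FiberNonneg.mono (h : FiberNonneg T X Y x) (h1 : x.1 ≤ y.1) (h2 : x.2 ≤ y.2) :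
    FiberNonneg T X Y y := by
  obtain ⟨v, hv, hv0, hw⟩ := h
  exact ⟨v, hv, hv0, fun w hwY => (hw w hwY).trans (asymForm_mono h1 h2 _)⟩

theorem FiberNonneg.swap (h : FiberNonneg T X Y x) : FiberNonneg T X Y x.swap := by
  obtain ⟨v, hv, hv0, hw⟩ := h
  refine ⟨-v, X.neg_mem hv, neg_ne_zero.2 hv0, fun w hwY => ?_⟩
  have := hw (-w) (Y.neg_mem hwY)
  rwa [← neg_neg (v + -w), asymForm_neg, neg_add, neg_neg] at this

/-- Second order upper bound of the functional in an arbitrary direction. -/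
theorem exists_asymForm_add_le (hT : ∀ u v, ⟪T u, v⟫_ℝ = ⟪u, T v⟫_ℝ) (x : ℝ × ℝ) :
    ∃ C : ℝ, 0 ≤ C ∧ ∀ h k : Lp ℝ 2 μ,
      asymForm T x (h + k) ≤ asymForm T x h + ⟪asymMul x h - T h, k⟫_ℝ + C * ‖k‖ ^ 2 := by
  obtain ⟨C, hC, h1⟩ := exists_asymForm_add_ge hT x
  obtain ⟨C', hC', h2⟩ := exists_norm_gradient_sub_le T x
  refine ⟨C + C', by positivity, fun h k => ?_⟩
  have e1 := h1 (h + k) (-k)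
  rw [add_neg_cancel_right, inner_neg_right, norm_neg] at e1
  have e2 := (real_inner_le_norm ((asymMul x (h + k) - T (h + k)) - (asymMul x h - T h)) k).trans
    (mul_le_mul_of_nonneg_right (h2 h k) (norm_nonneg k))
  rw [inner_sub_left] at e2
  nlinarith

/-- The functional has a minimiser along `v + Y`, at which its gradient is orthogonal to `Y`.
Minimising sequences are Cauchy by uniform convexity. -/
theorem exists_minimizer (hT : ∀ u v, ⟪T u, v⟫_ℝ = ⟪u, T v⟫_ℝ) (hY : IsClosed (Y : Set (Lp ℝ 2 μ)))
    (hc : 0 < c) (hx : Subcritical T Y c x) (v : Lp ℝ 2 μ) :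
    ∃ w ∈ Y, (∀ k ∈ Y, ⟪asymMul x (v + w) - T (v + w), k⟫_ℝ = 0) ∧
      ∀ k ∈ Y, asymForm T x (v + w) + c / 2 * ‖k‖ ^ 2 ≤ asymForm T x (v + w + k) := by
  have lower : ∀ h, ∀ k ∈ Y, asymForm T x h + ⟪asymMul x h - T h, k⟫_ℝ + c / 2 * ‖k‖ ^ 2
      ≤ asymForm T x (h + k) := fun h k hk => asymForm_add_ge hT h k (hx k hk).1 (hx k hk).2
  set s : Set ℝ := (fun w => asymForm T x (v + w)) '' (Y : Set (Lp ℝ 2 μ)) with hs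
  have hne : s.Nonempty := ⟨_, 0, Y.zero_mem, rfl⟩
  have hbdd : BddBelow s := by
    refine ⟨asymForm T x v - ‖asymMul x v - T v‖ ^ 2 / (2 * c), ?_⟩
    rintro _ ⟨w, hw, rfl⟩
    have h1 := lower v w hw
    have h2 := neg_le_of_abs_le (abs_real_inner_le_norm (asymMul x v - T v) w)
    set g := ‖asymMul x v - T v‖
    have h3 : 0 ≤ c / 2 * (‖w‖ - g / c) ^ 2 := by positivity
    have h4 : c / 2 * (‖w‖ - g / c) ^ 2 = c / 2 * ‖w‖ ^ 2 - g * ‖w‖ + g ^ 2 / (2 * c) := by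
      field_simp; ring
    dsimp only
    linarith
  have hm : ∀ w ∈ Y, sInf s ≤ asymForm T x (v + w) := fun w hw => csInf_le hbdd ⟨w, hw, rfl⟩
  have hseq : ∀ n : ℕ, ∃ w ∈ Y, asymForm T x (v + w) < sInf s + 1 / ((n : ℝ) + 1) := by
    intro n
    obtain ⟨_, ⟨w, hw, rfl⟩, h⟩ := exists_lt_of_csInf_lt hne
      (lt_add_of_pos_right (sInf s) (Nat.one_div_pos_of_nat (α := ℝ) (n := n)))
    exact ⟨w, hw, h⟩
  choose u huY hu using hseq
  -- midpoint convexity turns almost minimality into closeness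
  have hclose : ∀ n m N : ℕ, N ≤ n → N ≤ m →
      ‖u n - u m‖ ^ 2 ≤ 8 / c * (1 / ((N : ℝ) + 1)) := by
    intro n m N hn hm'
    set d := (1 / 2 : ℝ) • (u n - u m) with hd
    have hdY : d ∈ Y := Y.smul_mem _ (Y.sub_mem (huY n) (huY m))
    set h := v + (u m + d) with hh
    have e1 : h + d = v + u n := by rw [hh, hd]; module
    have e2 : h + -d = v + u m := by rw [hh, hd]; module
    have l1 := lower h d hdY
    have l2 := lower h (-d) (Y.neg_mem hdY)
    rw [e1] at l1
    rw [e2, inner_neg_right, norm_neg] at l2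
    have l3 := hm (u m + d) (Y.add_mem (huY m) hdY)
    have l4 := hu n
    have l5 := hu m
    have l6 : 1 / ((n : ℝ) + 1) ≤ 1 / ((N : ℝ) + 1) := Nat.one_div_le_one_div hn
    have l7 : 1 / ((m : ℝ) + 1) ≤ 1 / ((N : ℝ) + 1) := Nat.one_div_le_one_div hm'
    have l8 : ‖d‖ ^ 2 = ‖u n - u m‖ ^ 2 / 4 := by
      rw [hd, norm_smul]; norm_num; ring
    rw [l8] at l1 l2
    have l9 : c / 4 * ‖u n - u m‖ ^ 2 ≤ 2 * (1 / ((N : ℝ) + 1)) := by linarith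
    calc ‖u n - u m‖ ^ 2 = 4 / c * (c / 4 * ‖u n - u m‖ ^ 2) := by field_simp
      _ ≤ 4 / c * (2 * (1 / ((N : ℝ) + 1))) := by gcongr
      _ = _ := by ring
  have hcau : CauchySeq u := by
    refine cauchySeq_of_le_tendsto_0' (fun N : ℕ => Real.sqrt (8 / c * (1 / ((N : ℝ) + 1))))
      (fun N n hn => ?_) ?_
    · rw [dist_eq_norm]
      exact Real.le_sqrt_of_sq_le (hclose N n N le_rfl hn)
    · have := (tendsto_one_div_add_atTop_nhds_zero_nat (𝕜 := ℝ)).const_mul (8 / c)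
      rw [mul_zero] at this
      simpa [Function.comp_def] using (Real.continuous_sqrt.tendsto 0).comp this
  obtain ⟨w, hw⟩ := cauchySeq_tendsto_of_complete hcau
  have hwY : w ∈ Y := hY.mem_of_tendsto hw (Eventually.of_forall huY)
  have hcont : Continuous fun w => asymForm T x (v + w) :=
    (continuous_asymForm T).comp (continuous_const.prodMk (continuous_const.add continuous_id))
  have hmin : asymForm T x (v + w) ≤ sInf s := by
    have t1 := (hcont.tendsto w).comp hw
    have t2 := (tendsto_one_div_add_atTop_nhds_zero_nat (𝕜 := ℝ)).const_add (sInf s)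
    rw [add_zero] at t2
    exact le_of_tendsto_of_tendsto' t1 t2 fun n => (hu n).le
  have hcrit : ∀ k ∈ Y, ⟪asymMul x (v + w) - T (v + w), k⟫_ℝ = 0 := by
    obtain ⟨C, -, hC⟩ := exists_asymForm_add_le hT x
    intro k hk
    rw [← neg_eq_zero]
    refine eq_zero_of_forall_mul_le_sq (C := C * ‖k‖ ^ 2) fun t => ?_
    have h1 := hC (v + w) (t • k)
    have h2 := hm (w + t • k) (Y.add_mem hwY (Y.smul_mem t hk))
    rw [← add_assoc] at h2
    rw [real_inner_smul_right, norm_smul, mul_pow, Real.norm_eq_abs, sq_abs] at h1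
    linarith
  refine ⟨w, hwY, hcrit, fun k hk => ?_⟩
  have := lower (v + w) k hk
  rw [hcrit k hk] at this
  linarith

/-- If the minimum of the functional along `v + Y` is positive, the functional stays nonnegative
along `v + Y` for all nearby parameters. -/
theorem eventually_fiberNonneg (hT : ∀ u v, ⟪T u, v⟫_ℝ = ⟪u, T v⟫_ℝ)
    (hY : IsClosed (Y : Set (Lp ℝ 2 μ))) (hc : 0 < c) (hx : Subcritical T Y c x)
    {v : Lp ℝ 2 μ} (hv : v ∈ X) (hv0 : v ≠ 0) {m : ℝ} (hm : 0 < m)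
    (hvm : ∀ w ∈ Y, m ≤ asymForm T x (v + w)) : ∀ᶠ y in 𝓝 x, FiberNonneg T X Y y := by
  obtain ⟨w₀, hw₀, -, hmin⟩ := exists_minimizer hT hY hc hx v
  set K := ‖v + w₀‖ ^ 2 with hK
  have hK0 : 0 ≤ K := sq_nonneg _
  set η := min (c / 2) (m / (K + 1)) with hη
  have hη0 : 0 < η := lt_min (by positivity) (by positivity)
  have h1 : ∀ᶠ y : ℝ × ℝ in 𝓝 x, dist y x < η := Metric.ball_mem_nhds x hη0
  filter_upwards [h1] with y hy
  rw [Prod.dist_eq, max_lt_iff, Real.dist_eq, Real.dist_eq, abs_sub_comm, abs_sub_comm y.2] at hy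
  refine ⟨v, hv, hv0, fun w hw => ?_⟩
  have l1 := asymForm_sub_le (T := T) hy.1.le hy.2.le (v + w)
  have l2 := hmin (w - w₀) (Y.sub_mem hw hw₀)
  have e : v + w₀ + (w - w₀) = v + w := by abel
  rw [e] at l2
  have l3 := hvm w₀ hw₀
  have l4 : ‖v + w‖ ^ 2 ≤ 2 * K + 2 * ‖w - w₀‖ ^ 2 := by
    rw [← e]
    have := norm_add_le (v + w₀) (w - w₀)
    rw [hK]
    nlinarith [sq_nonneg (‖v + w₀‖ - ‖w - w₀‖), norm_nonneg (v + w₀ + (w - w₀))]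
  have l5 : η * K ≤ m := by
    have : η * (K + 1) ≤ m := by
      rw [← le_div_iff₀ (by positivity)]; exact min_le_right _ _
    nlinarith
  have l6 : η ≤ c / 2 := min_le_left _ _
  have l7 : η / 2 * ‖v + w‖ ^ 2 ≤ η / 2 * (2 * K + 2 * ‖w - w₀‖ ^ 2) := by gcongr
  have l8 : η * ‖w - w₀‖ ^ 2 ≤ c / 2 * ‖w - w₀‖ ^ 2 := by gcongr
  nlinarith

/-- The saddle point argument: when the reduced functional `v ↦ min_{w ∈ Y} f (v + w)` is nowhere
positive on `X` and vanishes at `v`, the minimiser along `v + Y` is a critical point on `X ⊔ Y`. -/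
theorem exists_critical (hT : ∀ u v, ⟪T u, v⟫_ℝ = ⟪u, T v⟫_ℝ)
    (hY : IsClosed (Y : Set (Lp ℝ 2 μ))) (hc : 0 < c) (hx : Subcritical T Y c x)
    (hneg : ∀ v ∈ X, ∀ m > 0, ∃ w ∈ Y, asymForm T x (v + w) < m)
    {v : Lp ℝ 2 μ} (hv : v ∈ X) (hvY : ∀ w ∈ Y, 0 ≤ asymForm T x (v + w)) :
    ∃ w ∈ Y, (∀ k ∈ X ⊔ Y, ⟪asymMul x (v + w) - T (v + w), k⟫_ℝ = 0) ∧
      asymForm T x (v + w) = 0 := by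
  obtain ⟨w₀, hw₀, hcrit, hmin⟩ := exists_minimizer hT hY hc hx v
  have hzero : asymForm T x (v + w₀) = 0 := by
    by_contra hne
    have hpos := lt_of_le_of_ne (hvY w₀ hw₀) (Ne.symm hne)
    obtain ⟨w, hw, hlt⟩ := hneg v hv _ hpos
    have := hmin (w - w₀) (Y.sub_mem hw hw₀)
    rw [show v + w₀ + (w - w₀) = v + w by abel] at this
    have h0 : 0 ≤ c / 2 * ‖w - w₀‖ ^ 2 := by positivity
    linarith
  refine ⟨w₀, hw₀, fun k hk => ?_, hzero⟩
  obtain ⟨z, hz, k', hk', rfl⟩ := Submodule.mem_sup.1 hk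
  rw [inner_add_right, hcrit k' hk', add_zero]
  obtain ⟨C, hC0, hC⟩ := exists_asymForm_add_ge hT x
  obtain ⟨L, hL0, hL⟩ := exists_norm_gradient_sub_le T x
  set u := v + w₀ with hu
  refine eq_zero_of_forall_mul_le_sq (C := C * ‖z‖ ^ 2 + (L * ‖z‖) ^ 2 / (2 * c)) fun t => ?_
  -- the minimum over the fibre of `v + t z` differs from the value at `u + t z` by `O(t²)`,
  -- because the gradient along `Y` at `u + t z` is `O(t)`
  have key : ∀ w ∈ Y, asymForm T x (u + t • z) - (L * ‖z‖) ^ 2 / (2 * c) * t ^ 2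
      ≤ asymForm T x (v + t • z + w) := by
    intro w hw
    have hk : w - w₀ ∈ Y := Y.sub_mem hw hw₀
    have l1 := asymForm_add_ge hT (c := c) (u + t • z) (w - w₀) (hx _ hk).1 (hx _ hk).2
    rw [show u + t • z + (w - w₀) = v + t • z + w by rw [hu]; abel] at l1
    have l2 := hL u (t • z)
    have l3 := neg_le_of_abs_le (abs_real_inner_le_norm
      ((asymMul x (u + t • z) - T (u + t • z)) - (asymMul x u - T u)) (w - w₀))
    rw [inner_sub_left, hcrit _ hk, sub_zero] at l3
    set g := ‖(asymMul x (u + t • z) - T (u + t • z)) - (asymMul x u - T u)‖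
    set d := ‖w - w₀‖
    have h3 : 0 ≤ c / 2 * (d - g / c) ^ 2 := by positivity
    have h4 : c / 2 * (d - g / c) ^ 2 = c / 2 * d ^ 2 - g * d + g ^ 2 / (2 * c) := by
      field_simp; ring
    have h5 : g ^ 2 / (2 * c) ≤ (L * ‖z‖) ^ 2 / (2 * c) * t ^ 2 := by
      rw [div_mul_eq_mul_div]
      gcongr
      calc g ^ 2 ≤ (L * ‖t • z‖) ^ 2 := by gcongr
        _ = _ := by rw [norm_smul, Real.norm_eq_abs, ← sq_abs t]; ring
    linarith
  have hle : asymForm T x (u + t • z) - (L * ‖z‖) ^ 2 / (2 * c) * t ^ 2 ≤ 0 := by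
    by_contra hlt
    obtain ⟨w, hw, h⟩ := hneg (v + t • z) (X.add_mem hv (X.smul_mem t hz)) _ (not_le.1 hlt)
    exact absurd (key w hw) (not_le.2 h)
  have h1 := hC u (t • z)
  rw [hzero, real_inner_smul_right, norm_smul, mul_pow, Real.norm_eq_abs, sq_abs] at h1
  linarith

/-- A nontrivial critical point on `X ⊔ Y` gives a fibre on which the functional is nonnegative. -/
theorem FiberNonneg.of_critical (hT : ∀ u v, ⟪T u, v⟫_ℝ = ⟪u, T v⟫_ℝ) (hc : 0 < c)
    (hx : Subcritical T Y c x) {h : Lp ℝ 2 μ} (hh : h ∈ X ⊔ Y) (h0 : h ≠ 0)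
    (hcrit : ∀ k ∈ X ⊔ Y, ⟪asymMul x h - T h, k⟫_ℝ = 0) : FiberNonneg T X Y x := by
  have hf : asymForm T x h = 0 := by rw [asymForm_eq_inner, hcrit h hh, mul_zero]
  obtain ⟨v, hv, w, hw, rfl⟩ := Submodule.mem_sup.1 hh
  have lower : ∀ k ∈ Y, c / 2 * ‖k‖ ^ 2 ≤ asymForm T x (v + w + k) := by
    intro k hk
    have := asymForm_add_ge hT (v + w) k (hx k hk).1 (hx k hk).2
    rw [hf, hcrit k (Submodule.mem_sup_right hk)] at this
    linarith
  refine ⟨v, hv, fun hv0 => h0 ?_, fun k hk => ?_⟩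
  · subst hv0
    have h1 := lower (-w) (Y.neg_mem hw)
    have h2 : asymForm T x 0 = 0 := by simpa using asymForm_smul (T := T) (x := x) le_rfl 0
    rw [zero_add, add_neg_cancel, h2, norm_neg] at h1
    have h3 : ‖w‖ ^ 2 ≤ 0 := by
      by_contra hlt
      have := mul_pos (half_pos hc) (not_le.1 hlt)
      linarith
    rw [zero_add, ← norm_eq_zero]
    exact pow_eq_zero_iff two_ne_zero |>.1 (le_antisymm h3 (sq_nonneg _))
  · have h1 := lower (k - w) (Y.sub_mem hk hw)
    rw [show v + w + (k - w) = v + k by abel] at h1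
    exact le_trans (by positivity) h1

end Reduction

/-! ### Stability of the fibre condition under limits -/

section Closed

/-- Weak compactness of the closed unit ball of a Hilbert space. -/
theorem exists_weak_limit {ι E : Type*} [NormedAddCommGroup E] [InnerProductSpace ℝ E]
    [CompleteSpace E] (𝒰 : Ultrafilter ι) (v : ι → E) (hv : ∀ᶠ i in 𝒰, ‖v i‖ ≤ 1) :
    ∃ u : E, ∀ h, Tendsto (fun i => ⟪v i, h⟫_ℝ) 𝒰 (𝓝 ⟪u, h⟫_ℝ) := by
  set F : ι → WeakDual ℝ E := fun i => StrongDual.toWeakDual (InnerProductSpace.toDual ℝ E (v i))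
  have hK := WeakDual.isCompact_closedBall (𝕜 := ℝ) (E := E) 0 1
  have hF : (𝒰.map F : Filter (WeakDual ℝ E)) ≤
      𝓟 (WeakDual.toStrongDual ⁻¹' Metric.closedBall (0 : StrongDual ℝ E) 1) := by
    rw [le_principal_iff]
    change ∀ᶠ i in (𝒰 : Filter ι), _
    filter_upwards [hv] with i hi
    simpa [F] using hi
  obtain ⟨f, -, hf⟩ := hK.ultrafilter_le_nhds _ hF
  refine ⟨(InnerProductSpace.toDual ℝ E).symm (WeakDual.toStrongDual f), fun h => ?_⟩
  rw [InnerProductSpace.toDual_symm_apply]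
  exact ((WeakDual.eval_continuous h).tendsto f).comp (show Tendsto F 𝒰 (𝓝 f) from hf)

variable {Ω : Type*} [MeasurableSpace Ω] {μ : Measure Ω}
variable {T : Lp ℝ 2 μ →L[ℝ] Lp ℝ 2 μ} {X Y : Submodule ℝ (Lp ℝ 2 μ)} {x : ℝ × ℝ}

theorem FiberNonneg.exists_unit (h : FiberNonneg T X Y x) :
    ∃ v ∈ X, ‖v‖ = 1 ∧ ∀ w ∈ Y, 0 ≤ asymForm T x (v + w) := by
  obtain ⟨v, hv, hv0, hw⟩ := h
  have hn : 0 < ‖v‖ := norm_pos_iff.2 hv0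
  refine ⟨‖v‖⁻¹ • v, X.smul_mem _ hv, norm_smul_inv_norm hv0, fun w hwY => ?_⟩
  have e : ‖v‖⁻¹ • v + w = ‖v‖⁻¹ • (v + ‖v‖ • w) := by
    rw [smul_add, smul_smul, inv_mul_cancel₀ hn.ne', one_smul]
  rw [e, asymForm_smul (inv_nonneg.2 hn.le)]
  exact mul_nonneg (sq_nonneg _) (hw _ (Y.smul_mem _ hwY))

/-- With negative parameters the functional is weakly upper semicontinuous: its asymmetric part is
concave, and its quadratic part is weakly continuous as `T` is compact. -/
theorem asymForm_nonneg_of_weak_limit {ι : Type*} (hT : ∀ u v, ⟪T u, v⟫_ℝ = ⟪u, T v⟫_ℝ)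
    (hTc : IsCompactOperator T) (h1 : x.1 < 0) (h2 : x.2 < 0) (𝒰 : Ultrafilter ι)
    {y : ι → ℝ × ℝ} (hy : Tendsto y 𝒰 (𝓝 x)) {v : ι → Lp ℝ 2 μ} {u : Lp ℝ 2 μ}
    (hv : ∀ᶠ i in 𝒰, ‖v i‖ ≤ 1) (hu : ∀ h, Tendsto (fun i => ⟪v i, h⟫_ℝ) 𝒰 (𝓝 ⟪u, h⟫_ℝ))
    (w : Lp ℝ 2 μ) (hw : ∀ᶠ i in 𝒰, 0 ≤ asymForm T (y i) (v i + w)) :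
    Tendsto (fun i => T (v i)) 𝒰 (𝓝 (T u)) ∧ 0 ≤ asymForm T x (u + w) := by
  have hTv : Tendsto (fun i => T (v i)) 𝒰 (𝓝 (T u)) := by
    obtain ⟨K, hK, hsub⟩ := hTc.image_closedBall_subset_compact 1
    have hle : (𝒰.map (fun i => T (v i)) : Filter (Lp ℝ 2 μ)) ≤ 𝓟 K := by
      rw [le_principal_iff]
      change ∀ᶠ i in (𝒰 : Filter ι), _
      filter_upwards [hv] with i hi
      exact hsub ⟨v i, by simpa using hi, rfl⟩
    obtain ⟨z, -, hz⟩ := hK.ultrafilter_le_nhds _ hle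
    have hz' : Tendsto (fun i => T (v i)) 𝒰 (𝓝 z) := hz
    have : z = T u := by
      refine ext_inner_right ℝ fun h => ?_
      refine tendsto_nhds_unique (hz'.inner tendsto_const_nhds) ?_
      simp only [hT]
      exact hu (T h)
    rwa [this] at hz'
  refine ⟨hTv, ?_⟩
  -- the concave part lies below its linearisation at `u + w`, which is weakly continuous
  have hquad : Tendsto (fun i => ⟪T (v i + w), v i + w⟫_ℝ) 𝒰 (𝓝 ⟪T (u + w), u + w⟫_ℝ) := by
    have e : ∀ a : Lp ℝ 2 μ, ⟪T (a + w), a + w⟫_ℝ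
        = ⟪T a - T u, a⟫_ℝ + ⟪a, T u⟫_ℝ + 2 * ⟪a, T w⟫_ℝ + ⟪T w, w⟫_ℝ := fun a => by
      have s1 := hT a w
      have s2 := real_inner_comm a (T w)
      have s3 := real_inner_comm a (T u)
      simp only [map_add, inner_add_left, inner_add_right, inner_sub_left]
      linarith
    have t1 : Tendsto (fun i => ⟪T (v i) - T u, v i⟫_ℝ) 𝒰 (𝓝 0) := by
      have t : Tendsto (fun i => ‖T (v i) - T u‖) 𝒰 (𝓝 0) := tendsto_iff_norm_sub_tendsto_zero.1 hTv
      refine squeeze_zero_norm' ?_ t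
      filter_upwards [hv] with i hi
      refine (norm_inner_le_norm _ _).trans ?_
      nlinarith [norm_nonneg (T (v i) - T u)]
    simp only [e]
    rw [sub_self, inner_zero_left]
    exact ((t1.add (hu (T u))).add ((hu (T w)).const_mul 2)).add tendsto_const_nhds
  set p := u + w with hp
  have hneg : ∀ᶠ i in 𝒰, (y i).1 < 0 ∧ (y i).2 < 0 :=
    (((continuous_fst.tendsto x).comp hy).eventually_lt_const h1).and
      (((continuous_snd.tendsto x).comp hy).eventually_lt_const h2)
  have ty1 : Tendsto (fun i => (y i).1) 𝒰 (𝓝 x.1) := (continuous_fst.tendsto x).comp hy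
  have ty2 : Tendsto (fun i => (y i).2) 𝒰 (𝓝 x.2) := (continuous_snd.tendsto x).comp hy
  have hlin : ∀ g : Lp ℝ 2 μ, Tendsto (fun i => ⟪g, v i - u⟫_ℝ) 𝒰 (𝓝 0) := fun g => by
    have := (hu g).sub_const ⟪u, g⟫_ℝ
    simp only [← inner_sub_left, sub_self] at this
    simpa only [real_inner_comm, inner_zero_right] using this
  have hlim : Tendsto (fun i => 1 / 2 *
      ((y i).1 * (‖Lp.posPart p‖ ^ 2 + 2 * ⟪Lp.posPart p, v i - u⟫_ℝ)
        + (y i).2 * (‖Lp.negPart p‖ ^ 2 - 2 * ⟪Lp.negPart p, v i - u⟫_ℝ)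
        - ⟪T (v i + w), v i + w⟫_ℝ)) 𝒰 (𝓝 (asymForm T x p)) := by
    have := (((ty1.mul (((hlin (Lp.posPart p)).const_mul 2).const_add (‖Lp.posPart p‖ ^ 2))).add
      (ty2.mul (((hlin (Lp.negPart p)).const_mul 2).const_sub (‖Lp.negPart p‖ ^ 2)))).sub
        hquad).const_mul (1 / 2)
    simpa only [mul_zero, add_zero, sub_zero, asymForm] using this
  refine ge_of_tendsto hlim ?_
  filter_upwards [hw, hneg] with i hi hn
  refine hi.trans ?_
  have e1 := (sq_nonneg _).trans (posPart_excess p (v i - u))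
  have e2 := (sq_nonneg _).trans (negPart_excess p (v i - u))
  have e3 : p + (v i - u) = v i + w := by rw [hp]; abel
  rw [e3] at e1 e2
  unfold asymForm
  have m1 := mul_nonpos_of_nonpos_of_nonneg hn.1.le e1
  have m2 := mul_nonpos_of_nonpos_of_nonneg hn.2.le e2
  linarith

/-- The set of parameters with a nonnegative fibre is closed, when `X` is finite dimensional, or
when `T` is compact and the parameters are negative. -/
theorem FiberNonneg.of_frequently (hT : ∀ u v, ⟪T u, v⟫_ℝ = ⟪u, T v⟫_ℝ)
    (hX : IsClosed (X : Set (Lp ℝ 2 μ)))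
    (hcase : FiniteDimensional ℝ X ∨ (IsCompactOperator T ∧ x.1 < 0 ∧ x.2 < 0))
    (h : ∃ᶠ y in 𝓝 x, FiberNonneg T X Y y) : FiberNonneg T X Y x := by
  have hne : (𝓝 x ⊓ 𝓟 {y | FiberNonneg T X Y y}).NeBot := frequently_mem_iff_neBot.1 h
  set 𝒰 := Ultrafilter.of (𝓝 x ⊓ 𝓟 {y | FiberNonneg T X Y y})
  have h𝒰 : (𝒰 : Filter (ℝ × ℝ)) ≤ 𝓝 x ⊓ 𝓟 {y | FiberNonneg T X Y y} := Ultrafilter.of_le _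
  have hy : Tendsto (fun y : ℝ × ℝ => y) 𝒰 (𝓝 x) := h𝒰.trans inf_le_left
  have hmem : ∀ᶠ y in (𝒰 : Filter (ℝ × ℝ)), FiberNonneg T X Y y :=
    le_principal_iff.1 (h𝒰.trans inf_le_right)
  have hex : ∀ y : ℝ × ℝ, ∃ v : Lp ℝ 2 μ, FiberNonneg T X Y y →
      v ∈ X ∧ ‖v‖ = 1 ∧ ∀ w ∈ Y, 0 ≤ asymForm T y (v + w) := fun y => by
    by_cases hy : FiberNonneg T X Y y
    · obtain ⟨v, h1, h2, h3⟩ := hy.exists_unit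
      exact ⟨v, fun _ => ⟨h1, h2, h3⟩⟩
    · exact ⟨0, fun h => absurd h hy⟩
  choose v hv using hex
  rcases hcase with hfin | ⟨hTc, h1, h2⟩
  · have hK : IsCompact ((↑) '' Metric.sphere (0 : X) 1 : Set (Lp ℝ 2 μ)) :=
      (isCompact_sphere (0 : X) 1).image continuous_subtype_val
    have hle : (𝒰.map v : Filter (Lp ℝ 2 μ)) ≤ 𝓟 ((↑) '' Metric.sphere (0 : X) 1) := by
      rw [le_principal_iff]
      change ∀ᶠ i in (𝒰 : Filter (ℝ × ℝ)), _
      filter_upwards [hmem] with i hi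
      exact ⟨⟨v i, (hv i hi).1⟩, by simpa using (hv i hi).2.1, rfl⟩
    obtain ⟨u, ⟨u', hu', rfl⟩, hz⟩ := hK.ultrafilter_le_nhds _ hle
    refine ⟨u', u'.2, fun h0 => ?_, fun w hw => ?_⟩
    · rw [mem_sphere_zero_iff_norm, Submodule.coe_eq_zero.1 h0, norm_zero] at hu'
      exact zero_ne_one hu'
    · have t := ((continuous_asymForm T).tendsto (x, (u' : Lp ℝ 2 μ) + w)).comp
        (hy.prodMk_nhds ((show Tendsto v 𝒰 (𝓝 (u' : Lp ℝ 2 μ)) from hz).add_const w))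
      refine ge_of_tendsto t ?_
      filter_upwards [hmem] with i hi
      exact (hv i hi).2.2 w hw
  · have hb : ∀ᶠ y in (𝒰 : Filter (ℝ × ℝ)), ‖v y‖ ≤ 1 := by
      filter_upwards [hmem] with i hi using (hv i hi).2.1.le
    obtain ⟨u, hu⟩ := exists_weak_limit 𝒰 v hb
    have main := fun w hw => asymForm_nonneg_of_weak_limit hT hTc h1 h2 𝒰 hy hb hu w
      (by filter_upwards [hmem] with i hi using (hv i hi).2.2 w hw)
    refine ⟨u, ?_, fun h0 => ?_, fun w hw => (main w hw).2⟩
    · have : CompleteSpace X := hX.completeSpace_coe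
      rw [← Submodule.orthogonal_orthogonal X]
      refine (Submodule.mem_orthogonal' _ _).2 fun k hk => ?_
      refine tendsto_nhds_unique (hu k) (tendsto_const_nhds.congr' ?_)
      filter_upwards [hmem] with i hi
      exact (((Submodule.mem_orthogonal _ _).1 hk) (v i) (hv i hi).1).symm
    · -- a zero weak limit would make the quadratic part vanish in the limit, whereas the
      -- asymmetric part stays away from zero on the unit sphere
      have hTv := (main 0 Y.zero_mem).1
      rw [h0, map_zero] at hTv
      set δ := max x.1 x.2 with hδ
      have hδ0 : δ < 0 := max_lt h1 h2
      have t1 : Tendsto (fun y => -‖T (v y)‖) 𝒰 (𝓝 0) := by simpa using hTv.norm.neg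
      have e1 := t1.eventually_const_lt (show δ / 2 < 0 by linarith)
      have e2 := ((continuous_fst.tendsto x).comp hy).eventually_lt_const
        (show x.1 < δ / 2 by linarith [le_max_left x.1 x.2])
      have e3 := ((continuous_snd.tendsto x).comp hy).eventually_lt_const
        (show x.2 < δ / 2 by linarith [le_max_right x.1 x.2])
      obtain ⟨y, hy1, hy2, hy3, hyS⟩ := (e1.and (e2.and (e3.and hmem))).exists
      obtain ⟨-, hn, hpos⟩ := hv y hyS
      have hp := hpos 0 Y.zero_mem
      rw [add_zero, asymForm] at hp
      have n1 := norm_posPart_sq_add (v y)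
      have n2 := neg_le_of_abs_le (abs_real_inner_le_norm (T (v y)) (v y))
      simp only [Function.comp_apply] at hy2 hy3
      rw [hn] at n1 n2
      have m1 := mul_le_mul_of_nonneg_right hy2.le (sq_nonneg ‖Lp.posPart (v y)‖)
      have m2 := mul_le_mul_of_nonneg_right hy3.le (sq_nonneg ‖Lp.negPart (v y)‖)
      nlinarith

end Closed

/-! ### The boundary of a lower set in an open square -/

section Planar

/-- The points of `S` from which every diagonal step upwards leaves `S`. -/
def upperBoundary (S : Set (ℝ × ℝ)) : Set (ℝ × ℝ) :=
  {x ∈ S | ∀ ε > 0, (x.1 + ε, x.2 + ε) ∉ S}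

variable {I : Set ℝ} {S : Set (ℝ × ℝ)}

/-- Two points of the boundary of a lower set are never strictly comparable. -/
theorem not_lt_of_mem_upperBoundary (hI : I.OrdConnected) (hSI : S ⊆ I ×ˢ I)
    (hlow : ∀ x ∈ S, ∀ y ∈ I ×ˢ I, y.1 ≤ x.1 → y.2 ≤ x.2 → y ∈ S) {x y : ℝ × ℝ}
    (hx : x ∈ upperBoundary S) (hy : y ∈ S) (h1 : x.1 < y.1) (h2 : x.2 < y.2) : False := by
  have hε : 0 < min (y.1 - x.1) (y.2 - x.2) := lt_min (by linarith) (by linarith)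
  have e1 := min_le_left (y.1 - x.1) (y.2 - x.2)
  have e2 := min_le_right (y.1 - x.1) (y.2 - x.2)
  refine hx.2 _ hε (hlow y hy _ ⟨?_, ?_⟩ ?_ ?_)
  · exact hI.out (hSI hx.1).1 (hSI hy).1 ⟨by dsimp only; linarith, by dsimp only; linarith⟩
  · exact hI.out (hSI hx.1).2 (hSI hy).2 ⟨by dsimp only; linarith, by dsimp only; linarith⟩
  · dsimp only; linarith
  · dsimp only; linarith

/-- In the rotated coordinates `a - b` and `a + b` the boundary is the graph of a `1`-Lipschitz
function. -/
theorem upperBoundary_lipschitz (hI : I.OrdConnected) (hSI : S ⊆ I ×ˢ I)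
    (hlow : ∀ x ∈ S, ∀ y ∈ I ×ˢ I, y.1 ≤ x.1 → y.2 ≤ x.2 → y ∈ S) {x y : ℝ × ℝ}
    (hx : x ∈ upperBoundary S) (hy : y ∈ upperBoundary S) :
    |(x.1 + x.2) - (y.1 + y.2)| ≤ |(x.1 - x.2) - (y.1 - y.2)| := by
  by_contra! h
  have h1 := le_abs_self ((x.1 - x.2) - (y.1 - y.2))
  have h2 := neg_le_abs ((x.1 - x.2) - (y.1 - y.2))
  rcases le_total ((x.1 + x.2) - (y.1 + y.2)) 0 with h0 | h0
  · rw [abs_of_nonpos h0] at h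
    exact not_lt_of_mem_upperBoundary hI hSI hlow hx hy.1 (by linarith) (by linarith)
  · rw [abs_of_nonneg h0] at h
    exact not_lt_of_mem_upperBoundary hI hSI hlow hy hx.1 (by linarith) (by linarith)

/-- On a diagonal that starts in `S` and ends in the complement there is a boundary point. -/
theorem exists_mem_upperBoundary (hI : I.OrdConnected) (hSI : S ⊆ I ×ˢ I)
    (hlow : ∀ x ∈ S, ∀ y ∈ I ×ˢ I, y.1 ≤ x.1 → y.2 ≤ x.2 → y ∈ S)
    (hU : IsOpen ((I ×ˢ I) \ S)) {x : ℝ × ℝ} (hx : x ∈ S) {r : ℝ} (hr : 0 ≤ r)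
    (hxr : (x.1 + r, x.2 + r) ∈ (I ×ˢ I) \ S) :
    ∃ t, 0 ≤ t ∧ t ≤ r ∧ (x.1 + t, x.2 + t) ∈ upperBoundary S := by
  have hseg : ∀ t ∈ Icc 0 r, ((x.1 + t, x.2 + t) : ℝ × ℝ) ∈ I ×ˢ I := fun t ht =>
    ⟨hI.out (hSI hx).1 hxr.1.1 ⟨by linarith [ht.1], by linarith [ht.2]⟩,
      hI.out (hSI hx).2 hxr.1.2 ⟨by linarith [ht.1], by linarith [ht.2]⟩⟩
  have hcont : Continuous fun t : ℝ => ((x.1 + t, x.2 + t) : ℝ × ℝ) := by fun_prop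
  have hK : IsCompact (Icc 0 r \ (fun t : ℝ => ((x.1 + t, x.2 + t) : ℝ × ℝ)) ⁻¹' ((I ×ˢ I) \ S)) :=
    isCompact_Icc.diff (hU.preimage hcont)
  have hne : (Icc 0 r \ (fun t : ℝ => ((x.1 + t, x.2 + t) : ℝ × ℝ)) ⁻¹' ((I ×ˢ I) \ S)).Nonempty :=
    ⟨0, ⟨le_rfl, hr⟩, fun h => h.2 (by simpa using hx)⟩
  obtain ⟨t, ⟨ht, htS⟩, hmax⟩ := hK.exists_isGreatest hne
  refine ⟨t, ht.1, ht.2, ?_, fun ε hε hmem => ?_⟩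
  · by_contra hn
    exact htS ⟨hseg t ht, hn⟩
  · dsimp only at hmem
    rw [add_assoc, add_assoc] at hmem
    rcases le_or_gt (t + ε) r with hle | hgt
    · have := hmax ⟨⟨by linarith [ht.1], hle⟩, fun h => h.2 hmem⟩
      linarith
    · exact hxr.2 (hlow _ hmem _ hxr.1 (by dsimp only; linarith) (by dsimp only; linarith))

/-- Just above a boundary point lies the complement. -/
theorem exists_above_upperBoundary (hIo : IsOpen I) {x : ℝ × ℝ} (hSI : S ⊆ I ×ˢ I)
    (hx : x ∈ upperBoundary S) {δ : ℝ} (hδ : 0 < δ) :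
    ∃ ε, 0 < ε ∧ ε < δ ∧ (x.1 + ε, x.2 + ε) ∈ (I ×ˢ I) \ S := by
  have hcont : Continuous fun t : ℝ => ((x.1 + t, x.2 + t) : ℝ × ℝ) := by fun_prop
  have h0 : ∀ᶠ t : ℝ in 𝓝[>] 0, ((x.1 + t, x.2 + t) : ℝ × ℝ) ∈ I ×ˢ I := by
    refine nhdsWithin_le_nhds ((hcont.tendsto 0).eventually ?_)
    exact (hIo.prod hIo).mem_nhds (by simpa using hSI hx.1)
  have h1 : ∀ᶠ t : ℝ in 𝓝[>] 0, t ∈ Ioo 0 δ := Ioo_mem_nhdsGT hδ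
  obtain ⟨t, h2, h3⟩ := (h0.and h1).exists
  exact ⟨t, h3.1, h3.2, h2, hx.2 t h3.1⟩

theorem exists_below_mem (hIo : IsOpen I) {x : ℝ × ℝ} (hx : x ∈ I ×ˢ I) :
    ∃ ε > 0, (x.1 - ε, x.2 - ε) ∈ I ×ˢ I := by
  have hcont : Continuous fun t : ℝ => ((x.1 - t, x.2 - t) : ℝ × ℝ) := by fun_prop
  have h0 : ∀ᶠ t : ℝ in 𝓝[>] 0, ((x.1 - t, x.2 - t) : ℝ × ℝ) ∈ I ×ˢ I := by
    refine nhdsWithin_le_nhds ((hcont.tendsto 0).eventually ?_)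
    exact (hIo.prod hIo).mem_nhds (by simpa using hx)
  obtain ⟨t, h2, h3⟩ := (h0.and self_mem_nhdsWithin).exists
  exact ⟨t, h3, h2⟩

theorem isOpen_diff_upperBoundary (hIo : IsOpen I) (hI : I.OrdConnected) (hSI : S ⊆ I ×ˢ I)
    (hlow : ∀ x ∈ S, ∀ y ∈ I ×ˢ I, y.1 ≤ x.1 → y.2 ≤ x.2 → y ∈ S) :
    IsOpen (S \ upperBoundary S) := by
  rw [isOpen_iff_mem_nhds]
  rintro x ⟨hxS, hxD⟩
  obtain ⟨ε, hε, hmem⟩ : ∃ ε > 0, (x.1 + ε, x.2 + ε) ∈ S := by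
    by_contra! h
    exact hxD ⟨hxS, h⟩
  have h1 : ∀ᶠ y : ℝ × ℝ in 𝓝 x, y ∈ I ×ˢ I := (hIo.prod hIo).mem_nhds (hSI hxS)
  have h2 : ∀ᶠ y : ℝ × ℝ in 𝓝 x, y.1 < x.1 + ε :=
    (continuous_fst.tendsto x).eventually_lt_const (by linarith)
  have h3 : ∀ᶠ y : ℝ × ℝ in 𝓝 x, y.2 < x.2 + ε :=
    (continuous_snd.tendsto x).eventually_lt_const (by linarith)
  filter_upwards [h1, h2, h3] with y hy1 hy2 hy3
  exact ⟨hlow _ hmem y hy1 hy2.le hy3.le,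
    fun hyD => not_lt_of_mem_upperBoundary hI hSI hlow hyD hmem hy2 hy3⟩

/-- The boundary of a relatively closed lower set is parametrised by `a - b`, over an interval. -/
theorem isContinuousCurve_upperBoundary (hIo : IsOpen I) (hI : I.OrdConnected) (hSI : S ⊆ I ×ˢ I)
    (hlow : ∀ x ∈ S, ∀ y ∈ I ×ˢ I, y.1 ≤ x.1 → y.2 ≤ x.2 → y ∈ S)
    (hU : IsOpen ((I ×ˢ I) \ S)) (hne : (upperBoundary S).Nonempty) :
    IsContinuousCurve (upperBoundary S) := by
  set J : Set ℝ := (fun x : ℝ × ℝ => x.1 - x.2) '' upperBoundary S with hJ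
  have hex : ∀ q : ℝ, ∃ x : ℝ × ℝ, q ∈ J → x ∈ upperBoundary S ∧ x.1 - x.2 = q := fun q => by
    by_cases hq : q ∈ J
    · obtain ⟨x, hx, hxq⟩ := hq
      exact ⟨x, fun _ => ⟨hx, hxq⟩⟩
    · exact ⟨0, fun h => absurd h hq⟩
  choose γ hγ using hex
  -- a point of `S` below a point of the complement on the same diagonal
  have hcross : ∀ q : ℝ, ∀ x ∈ S, ∀ y ∈ (I ×ˢ I) \ S, x.1 - x.2 = q → y.1 - y.2 = q → q ∈ J := by
    intro q x hx y hy hxq hyq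
    have hle : x.1 ≤ y.1 := by
      by_contra! h
      exact hy.2 (hlow x hx y hy.1 h.le (by linarith))
    have e : (x.1 + (y.1 - x.1), x.2 + (y.1 - x.1)) = y :=
      Prod.ext (by dsimp only; ring) (by dsimp only; linarith)
    obtain ⟨t, -, -, ht⟩ := exists_mem_upperBoundary hI hSI hlow hU hx (sub_nonneg.2 hle)
      (e.symm ▸ hy)
    exact ⟨_, ht, by dsimp only; linarith⟩
  refine ⟨J, γ, ?_, ⟨?_⟩, hne.image _, ?_, ?_, ?_⟩
  · rw [isOpen_iff_mem_nhds]
    rintro _ ⟨x, hx, rfl⟩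
    obtain ⟨ε, hε, -, hε'⟩ := exists_above_upperBoundary hIo hSI hx one_pos
    obtain ⟨δ, hδ, hδ'⟩ := exists_below_mem hIo (hSI hx.1)
    have hS : (x.1 - δ, x.2 - δ) ∈ S \ upperBoundary S :=
      ⟨hlow x hx.1 _ hδ' (by dsimp only; linarith) (by dsimp only; linarith), fun hD =>
        not_lt_of_mem_upperBoundary hI hSI hlow hD hx.1 (by dsimp only; linarith)
          (by dsimp only; linarith)⟩
    have c1 : Continuous fun q : ℝ => ((x.2 + ε + q, x.2 + ε) : ℝ × ℝ) := by fun_prop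
    have c2 : Continuous fun q : ℝ => ((x.2 - δ + q, x.2 - δ) : ℝ × ℝ) := by fun_prop
    have n1 := (c1.tendsto (x.1 - x.2)).eventually (hU.mem_nhds (by
      rw [show x.2 + ε + (x.1 - x.2) = x.1 + ε by ring]; exact hε'))
    have n2 := (c2.tendsto (x.1 - x.2)).eventually
      ((isOpen_diff_upperBoundary hIo hI hSI hlow).mem_nhds (by
        rw [show x.2 - δ + (x.1 - x.2) = x.1 - δ by ring]; exact hS))
    filter_upwards [n1, n2] with q h1 h2
    exact hcross q _ h2.1 _ h1 (by dsimp only; ring) (by dsimp only; ring)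
  · rintro _ ⟨x, hx, rfl⟩ _ ⟨y, hy, rfl⟩ q hq
    dsimp only at hq
    obtain ⟨ε, hε, -, hε'⟩ := exists_above_upperBoundary hIo hSI hx one_pos
    obtain ⟨δ, hδ, -, hδ'⟩ := exists_above_upperBoundary hIo hSI hy one_pos
    have hx' := hSI hx.1
    have hy' := hSI hy.1
    -- for `q ≥ 0` move horizontally or vertically from the endpoint `y`, otherwise from `x`
    rcases le_total 0 q with h0 | h0
    · have i1 : ((y.2 + q, y.2) : ℝ × ℝ) ∈ I ×ˢ I :=
        ⟨hI.out hy'.2 hy'.1 ⟨by linarith, by linarith [hq.2]⟩, hy'.2⟩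
      have i2 : ((y.1 + δ, y.1 + δ - q) : ℝ × ℝ) ∈ I ×ˢ I :=
        ⟨hδ'.1.1, hI.out hδ'.1.2 hδ'.1.1 ⟨by linarith [hq.2], by linarith⟩⟩
      refine hcross q (y.2 + q, y.2) (hlow y hy.1 _ i1 (by dsimp only; linarith [hq.2]) le_rfl)
        (y.1 + δ, y.1 + δ - q) ⟨i2, fun h => hδ'.2 (hlow _ h _ hδ'.1 le_rfl ?_)⟩ ?_ ?_
      · dsimp only; linarith [hq.2]
      · dsimp only; ring
      · dsimp only; ring
    · have i1 : ((x.1, x.1 - q) : ℝ × ℝ) ∈ I ×ˢ I :=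
        ⟨hx'.1, hI.out hx'.1 hx'.2 ⟨by linarith, by linarith [hq.1]⟩⟩
      have i2 : ((x.2 + ε + q, x.2 + ε) : ℝ × ℝ) ∈ I ×ˢ I :=
        ⟨hI.out hε'.1.1 hε'.1.2 ⟨by linarith [hq.1], by linarith⟩, hε'.1.2⟩
      refine hcross q (x.1, x.1 - q) (hlow x hx.1 _ i1 le_rfl (by dsimp only; linarith [hq.1]))
        (x.2 + ε + q, x.2 + ε) ⟨i2, fun h => hε'.2 (hlow _ h _ hε'.1 ?_ le_rfl)⟩ ?_ ?_
      · dsimp only; linarith [hq.1]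
      · dsimp only; ring
      · dsimp only; ring
  · have hlip : LipschitzOnWith 1 γ J := by
      refine LipschitzOnWith.of_dist_le_mul fun q hq r hr => ?_
      have h := upperBoundary_lipschitz hI hSI hlow (hγ q hq).1 (hγ r hr).1
      rw [(hγ q hq).2, (hγ r hr).2] at h
      have e1 := (hγ q hq).2
      have e2 := (hγ r hr).2
      have d := abs_le.1 h
      rw [NNReal.coe_one, one_mul, Prod.dist_eq, Real.dist_eq, Real.dist_eq, Real.dist_eq]
      have a1 := le_abs_self (q - r)
      have a2 := neg_le_abs (q - r)
      refine max_le (abs_le.2 ⟨?_, ?_⟩) (abs_le.2 ⟨?_, ?_⟩) <;> linarith [d.1, d.2]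
    exact hlip.continuousOn
  · intro q hq r hr h
    rw [← (hγ q hq).2, ← (hγ r hr).2, h]
  · ext x
    constructor
    · rintro ⟨q, hq, rfl⟩
      exact (hγ q hq).1
    · intro hx
      have hq : x.1 - x.2 ∈ J := ⟨x, hx, rfl⟩
      refine ⟨_, hq, ?_⟩
      obtain ⟨h1, h2⟩ := hγ _ hq
      have h3 := upperBoundary_lipschitz hI hSI hlow h1 hx
      rw [h2, sub_self, abs_zero, abs_nonpos_iff] at h3
      exact Prod.ext (by linarith) (by linarith)

/-- Any two points of `A` are joined inside `A` by the two segments through a point `z` of `A`,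
provided `z` can be chosen such that these segments stay in `A`. -/
theorem isConnected_of_segments {A : Set (ℝ × ℝ)} (hne : A.Nonempty)
    (h : ∀ x ∈ A, ∀ y ∈ A, ∃ z, segment ℝ x z ⊆ A ∧ segment ℝ y z ⊆ A) : IsConnected A := by
  refine ⟨hne, isPreconnected_of_forall_pair fun x hx y hy => ?_⟩
  obtain ⟨z, h1, h2⟩ := h x hx y hy
  exact ⟨segment ℝ x z ∪ segment ℝ y z, union_subset h1 h2, Or.inl (left_mem_segment _ _ _),
    Or.inr (left_mem_segment _ _ _), IsPreconnected.union z (right_mem_segment _ _ _)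
      (right_mem_segment _ _ _) (convex_segment _ _).isPreconnected
      (convex_segment _ _).isPreconnected⟩

/-- The boundary of a relatively closed lower set separates the square into two connected pieces:
two points above it are joined through their supremum, two points below it through their infimum. -/
theorem dividesWithSide_upperBoundary (hIo : IsOpen I) (hI : I.OrdConnected) (hSI : S ⊆ I ×ˢ I)
    (hlow : ∀ x ∈ S, ∀ y ∈ I ×ˢ I, y.1 ≤ x.1 → y.2 ≤ x.2 → y ∈ S)
    (hU : IsOpen ((I ×ˢ I) \ S)) (hne : (upperBoundary S).Nonempty) {Q : Set (ℝ × ℝ)}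
    (hQ : Q ⊆ (I ×ˢ I) \ S) :
    DividesWithSide (I ×ˢ I) (upperBoundary S) Q ((I ×ˢ I) \ S) := by
  have hconv : Convex ℝ (I ×ˢ I) := hI.convex.prod hI.convex
  have hmax : ∀ a ∈ I, ∀ b ∈ I, max a b ∈ I := fun a ha b hb => by
    rcases max_choice a b with h | h <;> rw [h] <;> assumption
  have hmin : ∀ a ∈ I, ∀ b ∈ I, min a b ∈ I := fun a ha b hb => by
    rcases min_choice a b with h | h <;> rw [h] <;> assumption
  obtain ⟨d, hd⟩ := hne
  refine ⟨S \ upperBoundary S, hU, isOpen_diff_upperBoundary hIo hI hSI hlow, ?_, ?_, ?_, ?_, hQ⟩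
  · refine isConnected_of_segments ?_ fun x hx y hy => ⟨x ⊔ y, ?_, ?_⟩
    · obtain ⟨ε, -, -, h⟩ := exists_above_upperBoundary hIo hSI hd one_pos
      exact ⟨_, h⟩
    all_goals
      have hz : x ⊔ y ∈ I ×ˢ I := ⟨hmax _ hx.1.1 _ hy.1.1, hmax _ hx.1.2 _ hy.1.2⟩
    · intro p hp
      have hpI := hconv.segment_subset hx.1 hz hp
      have hxp : x ≤ p := (segment_subset_Icc le_sup_left hp).1
      exact ⟨hpI, fun hpS => hx.2 (hlow p hpS x hx.1 hxp.1 hxp.2)⟩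
    · intro p hp
      have hpI := hconv.segment_subset hy.1 hz hp
      have hxp : y ≤ p := (segment_subset_Icc le_sup_right hp).1
      exact ⟨hpI, fun hpS => hy.2 (hlow p hpS y hy.1 hxp.1 hxp.2)⟩
  · -- points of `S` below a point of `S` off the boundary are off the boundary
    have hdown : ∀ x ∈ S \ upperBoundary S, ∀ y ∈ I ×ˢ I, y ≤ x → y ∈ S \ upperBoundary S := by
      intro x hx y hy hyx
      refine ⟨hlow x hx.1 y hy hyx.1 hyx.2, fun hyD => hx.2 ⟨hx.1, fun ε hε hmem => ?_⟩⟩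
      exact not_lt_of_mem_upperBoundary hI hSI hlow hyD hmem
        (by dsimp only; linarith [hyx.1]) (by dsimp only; linarith [hyx.2])
    refine isConnected_of_segments ?_ fun x hx y hy => ⟨x ⊓ y, ?_, ?_⟩
    · obtain ⟨δ, hδ, hδ'⟩ := exists_below_mem hIo (hSI hd.1)
      exact ⟨_, hlow d hd.1 _ hδ' (by dsimp only; linarith) (by dsimp only; linarith), fun hD =>
        not_lt_of_mem_upperBoundary hI hSI hlow hD hd.1 (by dsimp only; linarith)
          (by dsimp only; linarith)⟩
    all_goals
      have hx' := hSI hx.1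
      have hy' := hSI hy.1
      have hz : x ⊓ y ∈ I ×ˢ I := ⟨hmin _ hx'.1 _ hy'.1, hmin _ hx'.2 _ hy'.2⟩
    · intro p hp
      refine hdown x hx p (hconv.segment_subset hx' hz hp) ?_
      rw [segment_symm] at hp
      exact (segment_subset_Icc inf_le_left hp).2
    · intro p hp
      refine hdown y hy p (hconv.segment_subset hy' hz hp) ?_
      rw [segment_symm] at hp
      exact (segment_subset_Icc inf_le_right hp).2
  · exact disjoint_left.2 fun x hx hx' => hx.2 hx'.1
  · ext x
    constructor
    · rintro ⟨h1, h2⟩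
      by_cases hx : x ∈ S
      · exact Or.inr ⟨hx, h2⟩
      · exact Or.inl ⟨h1, hx⟩
    · rintro (h | h)
      · exact ⟨h.1, fun hD => h.2 hD.1⟩
      · exact ⟨hSI h.1, h.2⟩

/-- If the boundary contains no horizontal segment and is symmetric, it is the graph of a strictly
decreasing function. -/
theorem isStrictlyDecreasingGraph_upperBoundary (hI : I.OrdConnected) (hSI : S ⊆ I ×ˢ I)
    (hlow : ∀ x ∈ S, ∀ y ∈ I ×ˢ I, y.1 ≤ x.1 → y.2 ≤ x.2 → y ∈ S)
    (hsymm : ∀ a b, (a, b) ∈ upperBoundary S → (b, a) ∈ upperBoundary S)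
    (hseg : ∀ a a' b, (a, b) ∈ upperBoundary S → (a', b) ∈ upperBoundary S → ¬ a < a') :
    IsStrictlyDecreasingGraph (upperBoundary S) := by
  have huniq : ∀ a b b', (a, b) ∈ upperBoundary S → (a, b') ∈ upperBoundary S → b = b' :=
    fun a b b' h h' => le_antisymm (not_lt.1 (hseg _ _ _ (hsymm _ _ h') (hsymm _ _ h)))
      (not_lt.1 (hseg _ _ _ (hsymm _ _ h) (hsymm _ _ h')))
  have hex : ∀ a : ℝ, ∃ b : ℝ, a ∈ Prod.fst '' upperBoundary S → (a, b) ∈ upperBoundary S := by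
    intro a
    by_cases ha : a ∈ Prod.fst '' upperBoundary S
    · obtain ⟨x, hx, rfl⟩ := ha
      exact ⟨x.2, fun _ => hx⟩
    · exact ⟨0, fun h => absurd h ha⟩
  choose f hf using hex
  refine ⟨Prod.fst '' upperBoundary S, f, fun a ha a' ha' hlt => ?_, ?_⟩
  · by_contra! hle
    rcases hle.lt_or_eq with h | h
    · exact not_lt_of_mem_upperBoundary hI hSI hlow (hf a ha) (hf a' ha').1 hlt h
    · have := hf a ha
      rw [h] at this
      exact hseg _ _ _ this (hf a' ha') hlt
  · ext ⟨a, b⟩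
    constructor
    · intro h
      have ha : a ∈ Prod.fst '' upperBoundary S := ⟨_, h, rfl⟩
      exact ⟨a, ha, by rw [huniq a b _ h (hf a ha)]⟩
    · rintro ⟨a', ha', h⟩
      rw [← h]
      exact hf a' ha'

end Planar

/-! ### Completeness of the trigonometric system -/

section Completeness

/-- The linear span of the functions `sin (m s) cos (n t)` and `sin (m s) sin (n t)`. -/
def trigSpan : Submodule ℝ (ℝ × ℝ → ℝ) :=
  Submodule.span ℝ {f | ∃ m n : ℕ, f = phiFun m n ∨ f = psiFun m n}

theorem phiFun_mem_trigSpan (m n : ℕ) : phiFun m n ∈ trigSpan :=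
  Submodule.subset_span ⟨m, n, Or.inl rfl⟩

theorem psiFun_mem_trigSpan (m n : ℕ) : psiFun m n ∈ trigSpan :=
  Submodule.subset_span ⟨m, n, Or.inr rfl⟩

/-- To check that multiplication by `g` preserves `trigSpan` it is enough to treat the
generators. -/
theorem mul_mem_trigSpan {g : ℝ × ℝ → ℝ} (h1 : ∀ m n, g * phiFun m n ∈ trigSpan)
    (h2 : ∀ m n, g * psiFun m n ∈ trigSpan) {e : ℝ × ℝ → ℝ} (he : e ∈ trigSpan) :
    g * e ∈ trigSpan := by
  induction he using Submodule.span_induction with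
  | mem e he =>
    obtain ⟨m, n, rfl | rfl⟩ := he
    · exact h1 m n
    · exact h2 m n
  | zero => rw [mul_zero]; exact trigSpan.zero_mem
  | add e e' _ _ h h' => rw [mul_add]; exact trigSpan.add_mem h h'
  | smul c e _ h => rw [mul_smul_comm]; exact trigSpan.smul_mem c h

theorem cos_mul_sin_nat (k : ℕ) (x : ℝ) : Real.cos x * Real.sin ((k + 1 : ℕ) * x)
    = 1 / 2 * Real.sin ((k + 2 : ℕ) * x) + 1 / 2 * Real.sin (k * x) := by
  have e1 : ((k + 2 : ℕ) : ℝ) * x = (k + 1 : ℕ) * x + x := by push_cast; ring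
  have e2 : (k : ℝ) * x = (k + 1 : ℕ) * x - x := by push_cast; ring
  rw [e1, e2, Real.sin_add, Real.sin_sub]; ring

theorem cos_mul_cos_nat (k : ℕ) (x : ℝ) : Real.cos x * Real.cos ((k + 1 : ℕ) * x)
    = 1 / 2 * Real.cos ((k + 2 : ℕ) * x) + 1 / 2 * Real.cos (k * x) := by
  have e1 : ((k + 2 : ℕ) : ℝ) * x = (k + 1 : ℕ) * x + x := by push_cast; ring
  have e2 : (k : ℝ) * x = (k + 1 : ℕ) * x - x := by push_cast; ring
  rw [e1, e2, Real.cos_add, Real.cos_sub]; ring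

theorem sin_mul_cos_nat (k : ℕ) (x : ℝ) : Real.sin x * Real.cos ((k + 1 : ℕ) * x)
    = 1 / 2 * Real.sin ((k + 2 : ℕ) * x) - 1 / 2 * Real.sin (k * x) := by
  have e1 : ((k + 2 : ℕ) : ℝ) * x = (k + 1 : ℕ) * x + x := by push_cast; ring
  have e2 : (k : ℝ) * x = (k + 1 : ℕ) * x - x := by push_cast; ring
  rw [e1, e2, Real.sin_add, Real.sin_sub]; ring

theorem sin_mul_sin_nat (k : ℕ) (x : ℝ) : Real.sin x * Real.sin ((k + 1 : ℕ) * x)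
    = 1 / 2 * Real.cos (k * x) - 1 / 2 * Real.cos ((k + 2 : ℕ) * x) := by
  have e1 : ((k + 2 : ℕ) : ℝ) * x = (k + 1 : ℕ) * x + x := by push_cast; ring
  have e2 : (k : ℝ) * x = (k + 1 : ℕ) * x - x := by push_cast; ring
  rw [e1, e2, Real.cos_add, Real.cos_sub]; ring

theorem phiFun_zero_left (n : ℕ) : phiFun 0 n = 0 := by ext p; simp [phiFun]
theorem psiFun_zero_left (n : ℕ) : psiFun 0 n = 0 := by ext p; simp [psiFun]
theorem psiFun_zero_right (m : ℕ) : psiFun m 0 = 0 := by ext p; simp [psiFun]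

theorem cos_fst_mul_mem {e : ℝ × ℝ → ℝ} (he : e ∈ trigSpan) :
    (fun p : ℝ × ℝ => Real.cos p.1) * e ∈ trigSpan := by
  refine mul_mem_trigSpan (fun m n => ?_) (fun m n => ?_) he
  · rcases m with _ | k
    · rw [phiFun_zero_left, mul_zero]; exact trigSpan.zero_mem
    · convert trigSpan.add_mem (trigSpan.smul_mem (1 / 2) (phiFun_mem_trigSpan (k + 2) n))
        (trigSpan.smul_mem (1 / 2) (phiFun_mem_trigSpan k n)) using 1
      ext p
      simp only [phiFun, Pi.mul_apply, Pi.add_apply, Pi.smul_apply, smul_eq_mul]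
      linear_combination (Real.sqrt 2 / Real.pi * Real.cos (n * p.2)) * cos_mul_sin_nat k p.1
  · rcases m with _ | k
    · rw [psiFun_zero_left, mul_zero]; exact trigSpan.zero_mem
    · convert trigSpan.add_mem (trigSpan.smul_mem (1 / 2) (psiFun_mem_trigSpan (k + 2) n))
        (trigSpan.smul_mem (1 / 2) (psiFun_mem_trigSpan k n)) using 1
      ext p
      simp only [psiFun, Pi.mul_apply, Pi.add_apply, Pi.smul_apply, smul_eq_mul]
      linear_combination (Real.sqrt 2 / Real.pi * Real.sin (n * p.2)) * cos_mul_sin_nat k p.1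

theorem cos_snd_mul_mem {e : ℝ × ℝ → ℝ} (he : e ∈ trigSpan) :
    (fun p : ℝ × ℝ => Real.cos p.2) * e ∈ trigSpan := by
  refine mul_mem_trigSpan (fun m n => ?_) (fun m n => ?_) he
  · rcases n with _ | k
    · convert phiFun_mem_trigSpan m 1 using 1
      ext p
      simp [phiFun]; ring
    · convert trigSpan.add_mem (trigSpan.smul_mem (1 / 2) (phiFun_mem_trigSpan m (k + 2)))
        (trigSpan.smul_mem (1 / 2) (phiFun_mem_trigSpan m k)) using 1
      ext p
      simp only [phiFun, Pi.mul_apply, Pi.add_apply, Pi.smul_apply, smul_eq_mul]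
      linear_combination (Real.sqrt 2 / Real.pi * Real.sin (m * p.1)) * cos_mul_cos_nat k p.2
  · rcases n with _ | k
    · rw [psiFun_zero_right, mul_zero]; exact trigSpan.zero_mem
    · convert trigSpan.add_mem (trigSpan.smul_mem (1 / 2) (psiFun_mem_trigSpan m (k + 2)))
        (trigSpan.smul_mem (1 / 2) (psiFun_mem_trigSpan m k)) using 1
      ext p
      simp only [psiFun, Pi.mul_apply, Pi.add_apply, Pi.smul_apply, smul_eq_mul]
      linear_combination (Real.sqrt 2 / Real.pi * Real.sin (m * p.1)) * cos_mul_sin_nat k p.2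

theorem sin_snd_mul_mem {e : ℝ × ℝ → ℝ} (he : e ∈ trigSpan) :
    (fun p : ℝ × ℝ => Real.sin p.2) * e ∈ trigSpan := by
  refine mul_mem_trigSpan (fun m n => ?_) (fun m n => ?_) he
  · rcases n with _ | k
    · convert psiFun_mem_trigSpan m 1 using 1
      ext p
      simp [phiFun, psiFun]; ring
    · convert trigSpan.sub_mem (trigSpan.smul_mem (1 / 2) (psiFun_mem_trigSpan m (k + 2)))
        (trigSpan.smul_mem (1 / 2) (psiFun_mem_trigSpan m k)) using 1
      ext p
      simp only [phiFun, psiFun, Pi.mul_apply, Pi.sub_apply, Pi.smul_apply, smul_eq_mul]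
      linear_combination (Real.sqrt 2 / Real.pi * Real.sin (m * p.1)) * sin_mul_cos_nat k p.2
  · rcases n with _ | k
    · rw [psiFun_zero_right, mul_zero]; exact trigSpan.zero_mem
    · convert trigSpan.sub_mem (trigSpan.smul_mem (1 / 2) (phiFun_mem_trigSpan m k))
        (trigSpan.smul_mem (1 / 2) (phiFun_mem_trigSpan m (k + 2))) using 1
      ext p
      simp only [phiFun, psiFun, Pi.mul_apply, Pi.sub_apply, Pi.smul_apply, smul_eq_mul]
      linear_combination (Real.sqrt 2 / Real.pi * Real.sin (m * p.1)) * sin_mul_sin_nat k p.2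

/-- The closed fundamental rectangle of the cylinder. -/
def closedRect : Set (ℝ × ℝ) := Icc 0 Real.pi ×ˢ Icc 0 (2 * Real.pi)

theorem isCompact_closedRect : IsCompact closedRect := isCompact_Icc.prod isCompact_Icc

instance : CompactSpace closedRect := isCompact_iff_compactSpace.1 isCompact_closedRect

theorem ae_mem_openRect :
    ∀ᵐ p ∂cylinderMeasure, p ∈ Ioo 0 Real.pi ×ˢ Ioo 0 (2 * Real.pi) :=
  ae_restrict_mem (measurableSet_Ioo.prod measurableSet_Ioo)

theorem openRect_subset : Ioo 0 Real.pi ×ˢ Ioo 0 (2 * Real.pi) ⊆ closedRect :=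
  prod_mono Ioo_subset_Icc_self Ioo_subset_Icc_self

/-- The map `(s, t) ↦ (cos s, cos t, sin t)`, which on the closed rectangle identifies exactly the
points `(s, 0)` and `(s, 2π)`. -/
def cylMap (p : closedRect) : ℝ × ℝ × ℝ :=
  (Real.cos p.1.1, Real.cos p.1.2, Real.sin p.1.2)

theorem continuous_cylMap : Continuous cylMap := by unfold cylMap; fun_prop

theorem cylMap_eq {p q : closedRect} (h : cylMap p = cylMap q) :
    p.1.1 = q.1.1 ∧ (p.1.2 = q.1.2 ∨
      (p.1.2 ∉ Ioo 0 (2 * Real.pi) ∧ q.1.2 ∉ Ioo 0 (2 * Real.pi))) := by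
  simp only [cylMap, Prod.mk.injEq] at h
  obtain ⟨h1, h2, h3⟩ := h
  refine ⟨Real.injOn_cos p.2.1 q.2.1 h1, ?_⟩
  have hc : Real.cos (p.1.2 - q.1.2) = 1 := by
    rw [Real.cos_sub, h2, h3, ← Real.sin_sq_add_cos_sq q.1.2]; ring
  obtain ⟨k, hk⟩ := (Real.cos_eq_one_iff _).1 hc
  have hp := p.2.2
  have hq := q.2.2
  have hpi := Real.pi_pos
  have k1 : (k : ℝ) ≤ 1 := by
    by_contra! h
    nlinarith [hp.2, hq.1]
  have k2 : (-1 : ℝ) ≤ k := by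
    by_contra! h
    nlinarith [hp.1, hq.2]
  have k1' : k ≤ 1 := by exact_mod_cast k1
  have k2' : -1 ≤ k := by exact_mod_cast k2
  interval_cases k
  · right
    push_cast at hk
    exact ⟨fun h => by linarith [h.1, hq.2], fun h => by linarith [h.2, hp.1]⟩
  · left
    push_cast at hk
    linarith
  · right
    push_cast at hk
    exact ⟨fun h => by linarith [h.2, hq.1], fun h => by linarith [h.1, hp.2]⟩

/-- The image of the closed rectangle in `ℝ³`, a model of the closed cylinder. -/
abbrev CylModel : Type := range cylMap

instance : CompactSpace CylModel := isCompact_iff_compactSpace.1 (isCompact_range continuous_cylMap)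

/-- The projection of the closed rectangle onto the closed cylinder. -/
def cylProj : C(closedRect, CylModel) :=
  ⟨fun p => ⟨cylMap p, p, rfl⟩, continuous_cylMap.subtype_mk _⟩

theorem isQuotientMap_cylProj : IsQuotientMap cylProj :=
  cylProj.continuous.isClosedMap.isQuotientMap cylProj.continuous (by
    rintro ⟨_, p, rfl⟩; exact ⟨p, rfl⟩)

/-- The continuous functions on the cylinder that preserve `trigSpan` under multiplication. -/
def trigMultipliers : Subalgebra ℝ C(CylModel, ℝ) where
  carrier := {c | ∀ e ∈ trigSpan, ∃ e' ∈ trigSpan, ∀ p : closedRect, c (cylProj p) * e p = e' p}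
  mul_mem' := by
    intro c d hc hd e he
    obtain ⟨e₁, he₁, h₁⟩ := hd e he
    obtain ⟨e₂, he₂, h₂⟩ := hc e₁ he₁
    exact ⟨e₂, he₂, fun p => by rw [ContinuousMap.mul_apply, mul_assoc, h₁, h₂]⟩
  add_mem' := by
    intro c d hc hd e he
    obtain ⟨e₁, he₁, h₁⟩ := hd e he
    obtain ⟨e₂, he₂, h₂⟩ := hc e he
    exact ⟨e₂ + e₁, trigSpan.add_mem he₂ he₁, fun p => by
      rw [ContinuousMap.add_apply, add_mul, h₁, h₂, Pi.add_apply]⟩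
  algebraMap_mem' := fun r e he => ⟨r • e, trigSpan.smul_mem r he, fun p => by simp⟩

theorem trigMultipliers_separatesPoints : trigMultipliers.SeparatesPoints := by
  intro x y hxy
  have hne : (x : ℝ × ℝ × ℝ).1 ≠ (y : ℝ × ℝ × ℝ).1 ∨ (x : ℝ × ℝ × ℝ).2.1 ≠ (y : ℝ × ℝ × ℝ).2.1 ∨
      (x : ℝ × ℝ × ℝ).2.2 ≠ (y : ℝ × ℝ × ℝ).2.2 := by
    by_contra! h
    exact hxy (Subtype.ext (Prod.ext h.1 (Prod.ext h.2.1 h.2.2)))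
  rcases hne with h | h | h
  · refine ⟨_, ⟨⟨fun z : CylModel => (z : ℝ × ℝ × ℝ).1, by fun_prop⟩, ?_, rfl⟩, h⟩
    exact fun e he => ⟨_, cos_fst_mul_mem he, fun p => rfl⟩
  · refine ⟨_, ⟨⟨fun z : CylModel => (z : ℝ × ℝ × ℝ).2.1, by fun_prop⟩, ?_, rfl⟩, h⟩
    exact fun e he => ⟨_, cos_snd_mul_mem he, fun p => rfl⟩
  · refine ⟨_, ⟨⟨fun z : CylModel => (z : ℝ × ℝ × ℝ).2.2, by fun_prop⟩, ?_, rfl⟩, h⟩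
    exact fun e he => ⟨_, sin_snd_mul_mem he, fun p => rfl⟩

theorem continuous_phiFun (m n : ℕ) : Continuous (phiFun m n) := by unfold phiFun; fun_prop
theorem continuous_psiFun (m n : ℕ) : Continuous (psiFun m n) := by unfold psiFun; fun_prop

theorem continuous_of_mem_trigSpan {e : ℝ × ℝ → ℝ} (he : e ∈ trigSpan) : Continuous e := by
  induction he using Submodule.span_induction with
  | mem e he =>
    obtain ⟨m, n, rfl | rfl⟩ := he
    · exact continuous_phiFun m n
    · exact continuous_psiFun m n
  | zero => exact continuous_const
  | add e e' _ _ h h' => exact h.add h'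
  | smul c e _ h => exact h.const_smul c

theorem integral_mul_eq_zero_of_mem_trigSpan {u : L2}
    (h1 : ∀ m n, ∫ p, u p * phiFun m n p ∂cylinderMeasure = 0)
    (h2 : ∀ m n, ∫ p, u p * psiFun m n p ∂cylinderMeasure = 0) {e : ℝ × ℝ → ℝ}
    (he : e ∈ trigSpan) : ∫ p, u p * e p ∂cylinderMeasure = 0 := by
  induction he using Submodule.span_induction with
  | mem e he =>
    obtain ⟨m, n, rfl | rfl⟩ := he
    · exact h1 m n
    · exact h2 m n
  | zero => simp
  | add e e' he he' h h' =>
    simp only [Pi.add_apply, mul_add]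
    rw [integral_add (integrable_mul_of_continuous u (continuous_of_mem_trigSpan he))
      (integrable_mul_of_continuous u (continuous_of_mem_trigSpan he')), h, h', add_zero]
  | smul c e _ h =>
    simp only [Pi.smul_apply, smul_eq_mul, mul_left_comm _ c]
    rw [integral_const_mul, h, mul_zero]

/-- A function of `L²` orthogonal to the trigonometric system is orthogonal to `sin s · g` for
every continuous `g` supported in the open rectangle: such a `g` descends to a continuous function
on the cylinder, which is a uniform limit of multipliers of `trigSpan` by Stone–Weierstrass. -/
theorem integral_mul_sin_mul_eq_zero {u : L2}
    (h1 : ∀ m n, ∫ p, u p * phiFun m n p ∂cylinderMeasure = 0)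
    (h2 : ∀ m n, ∫ p, u p * psiFun m n p ∂cylinderMeasure = 0) {g : ℝ × ℝ → ℝ}
    (hg : Continuous g) (hsupp : ∀ p ∉ Ioo 0 Real.pi ×ˢ Ioo 0 (2 * Real.pi), g p = 0) :
    ∫ p, u p * (phiFun 1 0 p * g p) ∂cylinderMeasure = 0 := by
  have hfac : Function.FactorsThrough (fun p : closedRect => g p) cylProj := by
    intro p q hpq
    obtain ⟨e1, e2 | ⟨e2, e3⟩⟩ := cylMap_eq (Subtype.ext_iff.1 hpq)
    · rw [Subtype.ext (Prod.ext e1 e2) (a1 := p) (a2 := q)]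
    · dsimp only
      rw [hsupp p fun h => e2 h.2, hsupp q fun h => e3 h.2]
  set G : C(CylModel, ℝ) := isQuotientMap_cylProj.lift
    ⟨fun p : closedRect => g p, hg.comp continuous_subtype_val⟩ hfac with hG
  have hGp : ∀ p : closedRect, G (cylProj p) = g p := fun p =>
    congrArg (fun f : C(closedRect, ℝ) => f p) (isQuotientMap_cylProj.lift_comp
      ⟨fun p : closedRect => g p, hg.comp continuous_subtype_val⟩ hfac)
  set C := ∫ p, ‖u p * phiFun 1 0 p‖ ∂cylinderMeasure with hC
  have hC0 : 0 ≤ C := integral_nonneg fun _ => norm_nonneg _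
  have hint : Integrable (fun p => u p * phiFun 1 0 p) cylinderMeasure :=
    integrable_mul_of_continuous u (continuous_phiFun 1 0)
  rw [← norm_eq_zero]
  refine le_antisymm (le_of_forall_pos_le_add fun ε hε => ?_) (norm_nonneg _)
  have hGmem : G ∈ trigMultipliers.topologicalClosure := by
    rw [ContinuousMap.subalgebra_topologicalClosure_eq_top_of_separatesPoints _
      trigMultipliers_separatesPoints]
    exact Algebra.mem_top
  obtain ⟨c, hc, hcG⟩ := Metric.mem_closure_iff.1 hGmem (ε / (C + 1)) (by positivity)
  obtain ⟨e, he, hce⟩ := hc _ (phiFun_mem_trigSpan 1 0)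
  have hzero := integral_mul_eq_zero_of_mem_trigSpan h1 h2 he
  have hint1 : Integrable (fun p => u p * (phiFun 1 0 p * g p)) cylinderMeasure :=
    integrable_mul_of_continuous u ((continuous_phiFun 1 0).mul hg)
  have hint2 : Integrable (fun p => u p * e p) cylinderMeasure :=
    integrable_mul_of_continuous u (continuous_of_mem_trigSpan he)
  rw [zero_add, ← sub_zero (∫ p, u p * (phiFun 1 0 p * g p) ∂cylinderMeasure), ← hzero,
    ← integral_sub hint1 hint2]
  calc ‖∫ p, (u p * (phiFun 1 0 p * g p) - u p * e p) ∂cylinderMeasure‖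
      ≤ ∫ p, ε / (C + 1) * ‖u p * phiFun 1 0 p‖ ∂cylinderMeasure := by
        refine norm_integral_le_of_norm_le (hint.norm.const_mul _) ?_
        filter_upwards [ae_mem_openRect] with p hp
        set p' : closedRect := ⟨p, openRect_subset hp⟩
        have e1 := hGp p'
        have e2 := hce p'
        have e3 : ‖G (cylProj p') - c (cylProj p')‖ ≤ ε / (C + 1) := by
          rw [← dist_eq_norm]
          exact (ContinuousMap.dist_apply_le_dist _).trans hcG.le
        have e4 : u p * (phiFun 1 0 p * g p) - u p * e p
            = (G (cylProj p') - c (cylProj p')) * (u p * phiFun 1 0 p) := by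
          rw [show e p = c (cylProj p') * phiFun 1 0 p from e2.symm,
            show g p = G (cylProj p') from e1.symm]
          ring
        rw [e4, norm_mul]
        gcongr
    _ = ε / (C + 1) * C := by rw [integral_const_mul]
    _ ≤ ε := by
        rw [div_mul_eq_mul_div, div_le_iff₀ (by positivity)]
        nlinarith

theorem phiFun_one_zero_pos {p : ℝ × ℝ} (hp : p ∈ Ioo 0 Real.pi ×ˢ Ioo 0 (2 * Real.pi)) :
    0 < phiFun 1 0 p := by
  have := Real.sin_pos_of_mem_Ioo hp.1
  have := Real.pi_pos
  simp only [phiFun, Nat.cast_one, one_mul, Nat.cast_zero, zero_mul, Real.cos_zero, mul_one]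
  positivity

/-- Completeness of the trigonometric system in `L²`. -/
theorem eq_zero_of_integral_mul_eq_zero {u : L2}
    (h1 : ∀ m n, ∫ p, u p * phiFun m n p ∂cylinderMeasure = 0)
    (h2 : ∀ m n, ∫ p, u p * psiFun m n p ∂cylinderMeasure = 0) : u = 0 := by
  have hint : Integrable (fun p => u p * phiFun 1 0 p) cylinderMeasure :=
    integrable_mul_of_continuous u (continuous_phiFun 1 0)
  have key := (isOpen_Ioo.prod isOpen_Ioo :
    IsOpen (Ioo 0 Real.pi ×ˢ Ioo 0 (2 * Real.pi))).ae_eq_zero_of_integral_contDiff_smul_eq_zero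
    (μ := cylinderMeasure) (f := fun p => u p * phiFun 1 0 p)
    (hint.locallyIntegrable.locallyIntegrableOn _) (fun g hg _ hsub => by
      have := integral_mul_sin_mul_eq_zero h1 h2 hg.continuous
        (fun p hp => image_eq_zero_of_notMem_tsupport fun h => hp (hsub h))
      rw [← this]
      refine integral_congr_ae (Eventually.of_forall fun p => ?_)
      simp only [smul_eq_mul]; ring)
  apply Lp.ext
  filter_upwards [key, ae_mem_openRect, Lp.coeFn_zero ℝ 2 cylinderMeasure] with p h3 h4 h5
  rw [h5]
  exact (mul_eq_zero.1 (h3 h4)).resolve_right (phiFun_one_zero_pos h4).ne'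

end Completeness

/-! ### Weak derivatives of the trigonometric system -/

section WeakDerivatives

theorem memLp_of_continuous {F : ℝ × ℝ → ℝ} (hF : Continuous F) : MemLp F 2 cylinderMeasure := by
  obtain ⟨C, hC⟩ := isCompact_closedRect.exists_bound_of_continuousOn hF.continuousOn
  refine MemLp.of_bound hF.aestronglyMeasurable C ?_
  filter_upwards [ae_mem_openRect] with p hp using hC p (openRect_subset hp)

/-- The class in `L²` of a continuous function. -/
def toL2 (F : ℝ × ℝ → ℝ) (hF : Continuous F) : L2 := (memLp_of_continuous hF).toLp F

theorem coeFn_toL2 {F : ℝ × ℝ → ℝ} (hF : Continuous F) : toL2 F hF =ᵐ[cylinderMeasure] F :=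
  MemLp.coeFn_toLp _

theorem inner_toL2_right (x : L2) {F : ℝ × ℝ → ℝ} (hF : Continuous F) :
    ⟪x, toL2 F hF⟫_ℝ = ∫ p, x p * F p ∂cylinderMeasure := by
  rw [L2.inner_def]
  refine integral_congr_ae ?_
  filter_upwards [coeFn_toL2 hF] with p hp
  rw [hp]
  exact mul_comm _ _

theorem toL2_smul (c : ℝ) {F G : ℝ × ℝ → ℝ} (hF : Continuous F) (hG : Continuous G)
    (h : ∀ p, F p = c * G p) : toL2 F hF = c • toL2 G hG := by
  apply Lp.ext
  filter_upwards [coeFn_toL2 hF, coeFn_toL2 hG, Lp.coeFn_smul c (toL2 G hG)] with p h1 h2 h3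
  rw [h1, h3, Pi.smul_apply, h2, h, smul_eq_mul]

theorem integral_cylinderMeasure (f : ℝ × ℝ → ℝ) :
    ∫ p, f p ∂cylinderMeasure
      = ∫ p in Icc ((0, 0) : ℝ × ℝ) (Real.pi, 2 * Real.pi), f p := by
  rw [cylinderMeasure, Icc_prod_eq]
  refine setIntegral_congr_set ?_
  rw [Measure.volume_eq_prod]
  exact Measure.set_prod_ae_eq Ioo_ae_eq_Icc Ioo_ae_eq_Icc

theorem integral_fderiv_fst_eq_zero {H : ℝ × ℝ → ℝ} (hH : ContDiff ℝ 1 H)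
    (h0 : ∀ t, H (0, t) = 0) (h1 : ∀ t, H (Real.pi, t) = 0) :
    ∫ p, fderiv ℝ H p (1, 0) ∂cylinderMeasure = 0 := by
  have hpi := Real.pi_pos
  have hc : Continuous fun p => fderiv ℝ H p (1, 0) :=
    (hH.continuous_fderiv one_ne_zero).clm_apply continuous_const
  have := integral_divergence_prod_Icc_of_hasFDerivAt_of_le H 0 (fderiv ℝ H) 0 (0, 0)
    (Real.pi, 2 * Real.pi) ⟨hpi.le, by positivity⟩ hH.continuous.continuousOn
    continuousOn_const (fun x _ => (hH.differentiable one_ne_zero x).hasFDerivAt)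
    (fun x _ => hasFDerivAt_const 0 x)
    (by simpa using hc.continuousOn.integrableOn_compact isCompact_Icc)
  simp only [Pi.zero_apply, zero_apply, add_zero, h0, h1,
    intervalIntegral.integral_zero, sub_zero] at this
  rw [integral_cylinderMeasure, this]

theorem integral_fderiv_snd_eq_zero {H : ℝ × ℝ → ℝ} (hH : ContDiff ℝ 1 H)
    (h0 : ∀ s, H (s, 2 * Real.pi) = H (s, 0)) :
    ∫ p, fderiv ℝ H p (0, 1) ∂cylinderMeasure = 0 := by
  have hpi := Real.pi_pos
  have hc : Continuous fun p => fderiv ℝ H p (0, 1) :=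
    (hH.continuous_fderiv one_ne_zero).clm_apply continuous_const
  have := integral_divergence_prod_Icc_of_hasFDerivAt_of_le 0 H 0 (fderiv ℝ H) (0, 0)
    (Real.pi, 2 * Real.pi) ⟨hpi.le, by positivity⟩ continuousOn_const
    hH.continuous.continuousOn (fun x _ => hasFDerivAt_const 0 x)
    (fun x _ => (hH.differentiable one_ne_zero x).hasFDerivAt)
    (by simpa using hc.continuousOn.integrableOn_compact isCompact_Icc)
  simp only [Pi.zero_apply, zero_apply, zero_add, h0,
    intervalIntegral.integral_zero, sub_self, add_zero] at this
  rw [integral_cylinderMeasure, this]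

theorem isWeakDeriv_of_integral_eq_zero {F G : ℝ × ℝ → ℝ} {e : ℝ × ℝ} (hF : ContDiff ℝ ∞ F)
    (hG : Continuous G) (hFG : ∀ p, fderiv ℝ F p e = G p)
    (h : ∀ η, IsTestFunction η →
      ∫ p, fderiv ℝ (fun p => F p * η p) p e ∂cylinderMeasure = 0) :
    IsWeakDeriv e (toL2 F hF.continuous) (toL2 G hG) := by
  intro η hη
  have e1 : ∫ p, toL2 F hF.continuous p * fderiv ℝ η p e ∂cylinderMeasure
      = ∫ p, F p * fderiv ℝ η p e ∂cylinderMeasure := by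
    refine integral_congr_ae ?_
    filter_upwards [coeFn_toL2 hF.continuous] with p hp
    rw [hp]
  have e2 : ∫ p, toL2 G hG p * η p ∂cylinderMeasure = ∫ p, G p * η p ∂cylinderMeasure := by
    refine integral_congr_ae ?_
    filter_upwards [coeFn_toL2 hG] with p hp
    rw [hp]
  have e3 : ∀ p, fderiv ℝ (fun p => F p * η p) p e = F p * fderiv ℝ η p e + G p * η p := by
    intro p
    rw [fderiv_fun_mul (hF.differentiable (by simp) p) (hη.1.differentiable (by simp) p)]
    simp only [add_apply, smul_apply, smul_eq_mul, hFG]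
    ring
  have hi : ∀ {f : ℝ × ℝ → ℝ}, Continuous f → Integrable f cylinderMeasure := fun hf =>
    (memLp_of_continuous hf).integrable (by norm_num)
  have := h η hη
  simp only [e3] at this
  have i1 : Integrable (fun p => F p * fderiv ℝ η p e) cylinderMeasure :=
    hi (hF.continuous.mul (hη.continuous_fderiv_apply e))
  have i2 : Integrable (fun p => G p * η p) cylinderMeasure := hi (hG.mul hη.1.continuous)
  rw [integral_add i1 i2] at this
  rw [e1, e2]
  linarith

theorem isWeakDeriv_fst {F G : ℝ × ℝ → ℝ} (hF : ContDiff ℝ ∞ F) (hG : Continuous G)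
    (hFG : ∀ p, fderiv ℝ F p (1, 0) = G p) (h0 : ∀ t, F (0, t) = 0)
    (h1 : ∀ t, F (Real.pi, t) = 0) :
    IsWeakDeriv (1, 0) (toL2 F hF.continuous) (toL2 G hG) :=
  isWeakDeriv_of_integral_eq_zero hF hG hFG fun η hη =>
    integral_fderiv_fst_eq_zero ((hF.mul hη.1).of_le (by simp)) (fun t => by simp [h0])
      (fun t => by simp [h1])

theorem isWeakDeriv_snd {F G : ℝ × ℝ → ℝ} (hF : IsTestFunction F) (hG : Continuous G)
    (hFG : ∀ p, fderiv ℝ F p (0, 1) = G p) :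
    IsWeakDeriv (0, 1) (toL2 F hF.1.continuous) (toL2 G hG) :=
  isWeakDeriv_of_integral_eq_zero hF.1 hG hFG fun η hη =>
    integral_fderiv_snd_eq_zero ((hF.1.mul hη.1).of_le (by simp)) (fun s => by
      have e1 := hF.2 s 0
      have e2 := hη.2 s 0
      rw [zero_add] at e1 e2
      simp only [e1, e2])

theorem fderiv_apply_fst {F : ℝ × ℝ → ℝ} (hF : Differentiable ℝ F) {p : ℝ × ℝ} {d : ℝ}
    (h : HasDerivAt (fun s => F (s, p.2)) d p.1) : fderiv ℝ F p (1, 0) = d := by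
  have h1 : HasDerivAt (fun s : ℝ => (s, p.2)) ((1, 0) : ℝ × ℝ) p.1 :=
    (hasDerivAt_id p.1).prodMk (hasDerivAt_const _ _)
  exact ((hF p).hasFDerivAt.comp_hasDerivAt p.1 h1).unique h

theorem fderiv_apply_snd {F : ℝ × ℝ → ℝ} (hF : Differentiable ℝ F) {p : ℝ × ℝ} {d : ℝ}
    (h : HasDerivAt (fun t => F (p.1, t)) d p.2) : fderiv ℝ F p (0, 1) = d := by
  have h1 : HasDerivAt (fun t : ℝ => (p.1, t)) ((0, 1) : ℝ × ℝ) p.2 :=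
    (hasDerivAt_const _ _).prodMk (hasDerivAt_id p.2)
  exact ((hF p).hasFDerivAt.comp_hasDerivAt p.2 h1).unique h

/-- `sin` or `cos`, according to the parity `b`. -/
def trig (b : Bool) (x : ℝ) : ℝ := if b then Real.sin x else Real.cos x

/-- The sign in the derivative of `trig b`. -/
def trigSign (b : Bool) : ℝ := if b then 1 else -1

theorem contDiff_trig (b : Bool) : ContDiff ℝ ∞ (trig b) := by
  cases b
  · exact Real.contDiff_cos
  · exact Real.contDiff_sin

theorem hasDerivAt_trig (b : Bool) (x : ℝ) : HasDerivAt (trig b) (trigSign b * trig (!b) x) x := by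
  cases b
  · exact (Real.hasDerivAt_cos x).congr_deriv (by simp [trig, trigSign])
  · exact (Real.hasDerivAt_sin x).congr_deriv (by simp [trig, trigSign])

theorem trigSign_mul_not (b : Bool) : trigSign b * trigSign (!b) = -1 := by
  cases b <;> simp [trigSign]

theorem trig_add_period (b : Bool) (n : ℕ) (t : ℝ) :
    trig b (n * (t + 2 * Real.pi)) = trig b (n * t) := by
  rw [mul_add]
  cases b
  · exact Real.cos_add_nat_mul_two_pi _ n
  · exact Real.sin_add_nat_mul_two_pi _ n

theorem hasDerivAt_trig_mul (b : Bool) (n : ℕ) (t : ℝ) :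
    HasDerivAt (fun t => trig b (n * t)) (n * trigSign b * trig (!b) (n * t)) t := by
  have h := (hasDerivAt_trig b (n * t)).comp t ((hasDerivAt_id t).const_mul (n : ℝ))
  exact h.congr_deriv (by ring)

/-- The product of `trig b₁ (m s)` and `trig b₂ (n t)`, with the normalisation of `phiFun`. It is
`phiFun m n` for the parities `true, false`, and `psiFun m n` for `true, true`. -/
def wave (b₁ b₂ : Bool) (m n : ℕ) (p : ℝ × ℝ) : ℝ :=
  Real.sqrt 2 / Real.pi * trig b₁ (m * p.1) * trig b₂ (n * p.2)

theorem isTestFunction_wave (b₁ b₂ : Bool) (m n : ℕ) : IsTestFunction (wave b₁ b₂ m n) := by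
  constructor
  · unfold wave
    exact (contDiff_const.mul ((contDiff_trig b₁).comp (contDiff_const.mul contDiff_fst))).mul
      ((contDiff_trig b₂).comp (contDiff_const.mul contDiff_snd))
  · intro s t
    simp only [wave, trig_add_period]

theorem continuous_wave (b₁ b₂ : Bool) (m n : ℕ) : Continuous (wave b₁ b₂ m n) :=
  (isTestFunction_wave b₁ b₂ m n).1.continuous

theorem fderiv_wave_fst (b₁ b₂ : Bool) (m n : ℕ) (p : ℝ × ℝ) :
    fderiv ℝ (wave b₁ b₂ m n) p (1, 0) = m * trigSign b₁ * wave (!b₁) b₂ m n p := by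
  refine fderiv_apply_fst ((isTestFunction_wave b₁ b₂ m n).1.differentiable (by simp)) ?_
  exact (((hasDerivAt_trig_mul b₁ m p.1).const_mul (Real.sqrt 2 / Real.pi)).mul_const
    (trig b₂ (n * p.2))).congr_deriv (by simp only [wave]; ring)

theorem fderiv_wave_snd (b₁ b₂ : Bool) (m n : ℕ) (p : ℝ × ℝ) :
    fderiv ℝ (wave b₁ b₂ m n) p (0, 1) = n * trigSign b₂ * wave b₁ (!b₂) m n p := by
  refine fderiv_apply_snd ((isTestFunction_wave b₁ b₂ m n).1.differentiable (by simp)) ?_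
  exact ((hasDerivAt_trig_mul b₂ n p.2).const_mul
    (Real.sqrt 2 / Real.pi * trig b₁ (m * p.1))).congr_deriv (by simp only [wave]; ring)

/-- `wave` as an element of `L²`. -/
def waveL2 (b₁ b₂ : Bool) (m n : ℕ) : L2 := toL2 (wave b₁ b₂ m n) (continuous_wave b₁ b₂ m n)

theorem isWeakDeriv_wave_fst (b : Bool) (m n : ℕ) :
    IsWeakDeriv (1, 0) (waveL2 true b m n) ((m : ℝ) • waveL2 false b m n) := by
  have hc : Continuous fun p => (m : ℝ) * wave false b m n p :=
    continuous_const.mul (continuous_wave false b m n)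
  rw [waveL2, waveL2, ← toL2_smul (m : ℝ) hc (continuous_wave false b m n) fun p => rfl]
  refine isWeakDeriv_fst (isTestFunction_wave true b m n).1 hc (fun p => ?_) (fun t => ?_)
    fun t => ?_
  · rw [fderiv_wave_fst]; simp [trigSign]
  · simp [wave, trig]
  · simp [wave, trig]

theorem isWeakDeriv_wave_snd (b₁ b₂ : Bool) (m n : ℕ) :
    IsWeakDeriv (0, 1) (waveL2 b₁ b₂ m n) ((n * trigSign b₂) • waveL2 b₁ (!b₂) m n) := by
  have hc : Continuous fun p => (n * trigSign b₂) * wave b₁ (!b₂) m n p :=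
    continuous_const.mul (continuous_wave b₁ (!b₂) m n)
  rw [waveL2, waveL2, ← toL2_smul (n * trigSign b₂) hc (continuous_wave b₁ (!b₂) m n) fun p => rfl]
  exact isWeakDeriv_snd (isTestFunction_wave b₁ b₂ m n) hc (fderiv_wave_snd b₁ b₂ m n)

/-- Integration by parts against the `s`-derivative of an eigenfunction. -/
theorem IsWeakDeriv.inner_wave_fst {x g : L2} (h : IsWeakDeriv (1, 0) x g) (b : Bool) (m n : ℕ) :
    ⟪g, (m : ℝ) • waveL2 false b m n⟫_ℝ = (m : ℝ) ^ 2 * ⟪x, waveL2 true b m n⟫_ℝ := by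
  have h1 := h _ (isTestFunction_wave false b m n)
  simp only [fderiv_wave_fst] at h1
  rw [real_inner_smul_right, waveL2, waveL2, inner_toL2_right, inner_toL2_right]
  have e : ∫ p, x p * (m * trigSign false * wave (!false) b m n p) ∂cylinderMeasure
      = -m * ∫ p, x p * wave true b m n p ∂cylinderMeasure := by
    rw [← integral_const_mul]
    refine integral_congr_ae (Eventually.of_forall fun p => ?_)
    simp only [trigSign, Bool.not_false, Bool.false_eq_true, if_false]; ring
  rw [e] at h1
  linear_combination (m : ℝ) * h1

/-- Integration by parts against the `t`-derivative of an eigenfunction. -/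
theorem IsWeakDeriv.inner_wave_snd {x g : L2} (h : IsWeakDeriv (0, 1) x g) (b₁ b₂ : Bool)
    (m n : ℕ) : ⟪g, (n * trigSign b₂) • waveL2 b₁ (!b₂) m n⟫_ℝ
      = (n : ℝ) ^ 2 * ⟪x, waveL2 b₁ b₂ m n⟫_ℝ := by
  have h1 := h _ (isTestFunction_wave b₁ (!b₂) m n)
  simp only [fderiv_wave_snd] at h1
  rw [real_inner_smul_right, waveL2, waveL2, inner_toL2_right, inner_toL2_right]
  have e : ∫ p, x p * (n * trigSign (!b₂) * wave b₁ (!!b₂) m n p) ∂cylinderMeasure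
      = n * trigSign (!b₂) * ∫ p, x p * wave b₁ b₂ m n p ∂cylinderMeasure := by
    rw [← integral_const_mul]
    refine integral_congr_ae (Eventually.of_forall fun p => ?_)
    simp only [Bool.not_not]; ring
  rw [e] at h1
  have hs := trigSign_mul_not b₂
  linear_combination (n * trigSign b₂) * h1
    - (n : ℝ) ^ 2 * (∫ p, x p * wave b₁ b₂ m n p ∂cylinderMeasure) * hs

end WeakDerivatives

/-! ### Diagonal operators -/

section Diagonal

variable {ι E : Type*} [NormedAddCommGroup E] [InnerProductSpace ℝ E]

theorem summable_smul_of_orthogonal [CompleteSpace E] {d : ι → E}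
    (hd : Pairwise fun i j => ⟪d i, d j⟫_ℝ = 0)
    {c : ι → ℝ} (h : Summable fun i => (c i * ‖d i‖) ^ 2) : Summable fun i => c i • d i := by
  have hV : OrthogonalFamily ℝ (fun i => Submodule.span ℝ {d i})
      (fun i => (Submodule.span ℝ {d i}).subtypeₗᵢ) := by
    intro i j hij v w
    obtain ⟨r, hr⟩ := Submodule.mem_span_singleton.1 v.2
    obtain ⟨s, hs⟩ := Submodule.mem_span_singleton.1 w.2
    simp only [Submodule.coe_subtypeₗᵢ, Submodule.subtype_apply]
    rw [← hr, ← hs, real_inner_smul_left, real_inner_smul_right, hd hij, mul_zero, mul_zero]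
  refine (hV.summable_iff_norm_sq_summable fun i =>
    ⟨c i • d i, Submodule.smul_mem _ _ (Submodule.mem_span_singleton_self _)⟩).2 ?_
  refine h.congr fun i => ?_
  rw [Submodule.coe_norm, norm_smul, Real.norm_eq_abs, mul_pow, mul_pow, sq_abs]

variable (b : HilbertBasis ι ℝ E) {τ : ι → ℝ} {T : E →L[ℝ] E}

theorem hasSum_inner_sq (x : E) : HasSum (fun i => ⟪b i, x⟫_ℝ ^ 2) (‖x‖ ^ 2) := by
  have := b.hasSum_inner_mul_inner x x
  rw [real_inner_self_eq_norm_sq] at this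
  refine this.congr_fun fun i => ?_
  rw [real_inner_comm, sq]

theorem ext_inner_hilbertBasis {x y : E} (h : ∀ i, ⟪b i, x⟫_ℝ = ⟪b i, y⟫_ℝ) : x = y := by
  apply b.repr.injective
  ext i
  rw [b.repr_apply_apply, b.repr_apply_apply, h]

theorem inner_hilbertBasis_self (i : ι) : ⟪b i, b i⟫_ℝ = 1 := by
  rw [real_inner_self_eq_norm_sq, b.orthonormal.norm_eq_one, one_pow]

theorem inner_hilbertBasis_ne {i j : ι} (h : i ≠ j) : ⟪b i, b j⟫_ℝ = 0 := b.orthonormal.2 h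

/-- Bounded sequences of eigenvalues define bounded diagonal operators. -/
theorem exists_diagonal [CompleteSpace E] (hτ : ∀ i, |τ i| ≤ 1) :
    ∃ T : E →L[ℝ] E, ∀ i x, ⟪b i, T x⟫_ℝ = τ i * ⟪b i, x⟫_ℝ := by
  have hex : ∀ x : E, ∃ y : E, ∀ i, ⟪b i, y⟫_ℝ = τ i * ⟪b i, x⟫_ℝ := by
    intro x
    have hs : Summable fun i => (τ i * ⟪b i, x⟫_ℝ) • b i := by
      refine summable_smul_of_orthogonal (fun i j hij => inner_hilbertBasis_ne b hij) ?_
      refine Summable.of_nonneg_of_le (fun i => sq_nonneg _) (fun i => ?_)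
        (hasSum_inner_sq b x).summable
      rw [b.orthonormal.norm_eq_one, mul_one, mul_pow]
      have : τ i ^ 2 ≤ 1 := by rw [← sq_abs]; exact pow_le_one₀ (abs_nonneg _) (hτ i)
      nlinarith [sq_nonneg ⟪b i, x⟫_ℝ]
    obtain ⟨y, hy⟩ := hs
    refine ⟨y, fun i => ?_⟩
    have h1 := hy.mapL (innerSL ℝ (b i))
    refine h1.unique ?_
    have h2 := hasSum_single (f := fun j => innerSL ℝ (b i) ((τ j * ⟪b j, x⟫_ℝ) • b j)) i
      (fun j hj => by
        rw [innerSL_apply_apply, real_inner_smul_right, inner_hilbertBasis_ne b hj.symm, mul_zero])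
    rwa [innerSL_apply_apply, real_inner_smul_right, inner_hilbertBasis_self, mul_one] at h2
  choose f hf using hex
  set L : E →ₗ[ℝ] E :=
    { toFun := f
      map_add' := fun x y => ext_inner_hilbertBasis b fun i => by
        rw [inner_add_right, hf, hf, hf, inner_add_right, mul_add]
      map_smul' := fun c x => ext_inner_hilbertBasis b fun i => by
        rw [RingHom.id_apply, real_inner_smul_right, hf, hf, real_inner_smul_right]; ring }
  have hL : L.IsSymmetric := by
    intro x y
    refine (b.hasSum_inner_mul_inner (L x) y).unique ?_
    refine (b.hasSum_inner_mul_inner x (L y)).congr_fun fun i => ?_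
    change ⟪f x, b i⟫_ℝ * ⟪b i, y⟫_ℝ = ⟪x, b i⟫_ℝ * ⟪b i, f y⟫_ℝ
    rw [real_inner_comm, hf, hf, real_inner_comm x]; ring
  exact ⟨⟨L, hL.continuous⟩, fun i x => hf x i⟩

theorem diagonal_symm (hT : ∀ i x, ⟪b i, T x⟫_ℝ = τ i * ⟪b i, x⟫_ℝ) (x y : E) :
    ⟪T x, y⟫_ℝ = ⟪x, T y⟫_ℝ := by
  refine (b.hasSum_inner_mul_inner (T x) y).unique ?_
  refine (b.hasSum_inner_mul_inner x (T y)).congr_fun fun i => ?_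
  rw [real_inner_comm, hT, hT, real_inner_comm x]; ring

theorem hasSum_diagonal_form (hT : ∀ i x, ⟪b i, T x⟫_ℝ = τ i * ⟪b i, x⟫_ℝ) (x : E) :
    HasSum (fun i => τ i * ⟪b i, x⟫_ℝ ^ 2) ⟪T x, x⟫_ℝ := by
  refine (b.hasSum_inner_mul_inner (T x) x).congr_fun fun i => ?_
  rw [← real_inner_comm (T x), hT]; ring

theorem diagonal_apply_basis (hT : ∀ i x, ⟪b i, T x⟫_ℝ = τ i * ⟪b i, x⟫_ℝ) (i : ι) :
    T (b i) = τ i • b i := by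
  refine ext_inner_hilbertBasis b fun j => ?_
  rw [hT, real_inner_smul_right]
  by_cases h : j = i
  · rw [h]
  · rw [inner_hilbertBasis_ne b h, mul_zero, mul_zero]

/-- A diagonal operator whose eigenvalues tend to zero is compact. -/
theorem isCompactOperator_diagonal [CompleteSpace E]
    (hT : ∀ i x, ⟪b i, T x⟫_ℝ = τ i * ⟪b i, x⟫_ℝ)
    (hfin : ∀ ε > 0, {i | ε < |τ i|}.Finite) :
    IsCompactOperator T := by
  classical
  have hcl : T ∈ closure {f : E →L[ℝ] E | IsCompactOperator f} := by
    refine Metric.mem_closure_iff.2 fun ε hε => ?_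
    set F := (hfin (ε / 2) (half_pos hε)).toFinset with hF
    set R : E →L[ℝ] E := ∑ i ∈ F, (innerSL ℝ (b i)).smulRight (τ i • b i) with hR
    have hRi : ∀ i x, ⟪b i, R x⟫_ℝ = if i ∈ F then τ i * ⟪b i, x⟫_ℝ else 0 := by
      intro i x
      rw [hR, sum_apply, inner_sum]
      have : ∀ j ∈ F, ⟪b i, ((innerSL ℝ (b j)).smulRight (τ j • b j)) x⟫_ℝ
          = if j = i then τ i * ⟪b i, x⟫_ℝ else 0 := by
        intro j _
        rw [ContinuousLinearMap.smulRight_apply, innerSL_apply_apply, real_inner_smul_right,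
          real_inner_smul_right]
        split_ifs with h
        · rw [h, inner_hilbertBasis_self]; ring
        · rw [inner_hilbertBasis_ne b (Ne.symm h)]; ring
      rw [Finset.sum_congr rfl this, Finset.sum_ite_eq']
    refine ⟨R, ?_, ?_⟩
    · have : ∀ s : Finset ι, IsCompactOperator
          (∑ i ∈ s, (innerSL ℝ (b i)).smulRight (τ i • b i) : E →L[ℝ] E) := by
        intro s
        induction s using Finset.induction_on with
        | empty => simpa using isCompactOperator_zero
        | insert i s hi ih =>
          rw [Finset.sum_insert hi]
          refine IsCompactOperator.add ?_ ih
          have hc : IsCompactOperator (innerSL ℝ (b i)) :=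
            isCompactOperator_of_locallyCompactSpace_dom _
          exact hc.clm_comp (ContinuousLinearMap.toSpanSingleton ℝ (τ i • b i))
      exact this F
    · rw [dist_eq_norm]
      refine lt_of_le_of_lt (ContinuousLinearMap.opNorm_le_bound _ (half_pos hε).le fun x => ?_)
        (half_lt_self hε)
      refine abs_le_of_sq_le_sq' ?_ (by positivity) |>.2
      rw [mul_pow]
      refine hasSum_le (fun i => ?_) (hasSum_inner_sq b ((T - R) x))
        ((hasSum_inner_sq b x).mul_left ((ε / 2) ^ 2))
      rw [sub_apply, inner_sub_right, hT, hRi]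
      split_ifs with h
      · rw [sub_self, zero_pow two_ne_zero]; positivity
      · rw [sub_zero, mul_pow]
        refine mul_le_mul_of_nonneg_right ?_ (sq_nonneg _)
        have : |τ i| ≤ ε / 2 := by
          by_contra! hlt
          exact h ((hfin (ε / 2) (half_pos hε)).mem_toFinset.2 hlt)
        rw [← sq_abs]
        gcongr
  rwa [isClosed_setOfPred_isCompactOperator.closure_eq] at hcl

/-- The closed subspace of the vectors whose coordinates vanish outside `s`. -/
def coordSubspace (s : Set ι) : Submodule ℝ E where
  carrier := {x | ∀ i ∉ s, ⟪b i, x⟫_ℝ = 0}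
  zero_mem' := fun i _ => inner_zero_right _
  add_mem' := fun hx hy i hi => by rw [inner_add_right, hx i hi, hy i hi, add_zero]
  smul_mem' := fun c x hx i hi => by rw [real_inner_smul_right, hx i hi, mul_zero]

variable {b} {s t : Set ι}

theorem coordSubspace_mono (h : s ⊆ t) : coordSubspace b s ≤ coordSubspace b t :=
  fun _ hx i hi => hx i fun h' => hi (h h')

theorem isClosed_coordSubspace (s : Set ι) : IsClosed (coordSubspace b s : Set E) := by
  have : (coordSubspace b s : Set E) = ⋂ i ∈ sᶜ, {x | ⟪b i, x⟫_ℝ = 0} := by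
    ext x; simp [coordSubspace]
  rw [this]
  exact isClosed_biInter fun i _ =>
    isClosed_eq (continuous_const.inner continuous_id) continuous_const

theorem basis_mem_coordSubspace {i : ι} (hi : i ∈ s) : b i ∈ coordSubspace b s :=
  fun _ hj => inner_hilbertBasis_ne b fun h => hj (h ▸ hi)

/-- `coordSubspace b s` is the smallest closed subspace containing the `b i`, `i ∈ s`. -/
theorem coordSubspace_le {K : Submodule ℝ E} (hK : IsClosed (K : Set E)) (h : ∀ i ∈ s, b i ∈ K) :
    coordSubspace b s ≤ K := by
  intro x hx
  refine hK.mem_of_tendsto (b.hasSum_repr x) (Eventually.of_forall fun F => ?_)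
  refine K.sum_mem fun i _ => ?_
  rw [b.repr_apply_apply]
  by_cases hi : i ∈ s
  · exact K.smul_mem _ (h i hi)
  · rw [hx i hi, zero_smul]; exact K.zero_mem

theorem finiteDimensional_coordSubspace (hs : s.Finite) :
    FiniteDimensional ℝ (coordSubspace b s) := by
  have : FiniteDimensional ℝ (Submodule.span ℝ (b '' s)) :=
    FiniteDimensional.span_of_finite ℝ (hs.image b)
  exact Submodule.finiteDimensional_of_le (coordSubspace_le
    (Submodule.closed_of_finiteDimensional (Submodule.span ℝ (b '' s)))
    fun i hi => Submodule.subset_span ⟨i, hi, rfl⟩)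

theorem coordSubspace_sup [CompleteSpace E] :
    coordSubspace b s ⊔ coordSubspace b t = coordSubspace b (s ∪ t) := by
  refine le_antisymm (sup_le (coordSubspace_mono subset_union_left)
    (coordSubspace_mono subset_union_right)) fun x hx => ?_
  have : CompleteSpace (coordSubspace b s) := (isClosed_coordSubspace s).completeSpace_coe
  obtain ⟨v, hv, w, hw, hvw⟩ := (coordSubspace b s).exists_add_mem_mem_orthogonal x
  refine Submodule.mem_sup.2 ⟨v, hv, w, fun i hi => ?_, hvw.symm⟩
  by_cases his : i ∈ s
  · exact (Submodule.mem_orthogonal _ _).1 hw _ (basis_mem_coordSubspace his)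
  · have h1 := hx i fun h => h.elim his hi
    rwa [hvw, inner_add_right, hv i his, zero_add] at h1

theorem diagonal_form_le (hT : ∀ i x, ⟪b i, T x⟫_ℝ = τ i * ⟪b i, x⟫_ℝ) {C : ℝ}
    (h : ∀ i ∈ s, τ i ≤ C) {x : E} (hx : x ∈ coordSubspace b s) : ⟪T x, x⟫_ℝ ≤ C * ‖x‖ ^ 2 := by
  refine hasSum_le (fun i => ?_) (hasSum_diagonal_form b hT x) ((hasSum_inner_sq b x).mul_left C)
  by_cases hi : i ∈ s
  · exact mul_le_mul_of_nonneg_right (h i hi) (sq_nonneg _)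
  · simp [hx i hi]

theorem le_diagonal_form (hT : ∀ i x, ⟪b i, T x⟫_ℝ = τ i * ⟪b i, x⟫_ℝ) {C : ℝ}
    (h : ∀ i ∈ s, C ≤ τ i) {x : E} (hx : x ∈ coordSubspace b s) : C * ‖x‖ ^ 2 ≤ ⟪T x, x⟫_ℝ := by
  refine hasSum_le (fun i => ?_) ((hasSum_inner_sq b x).mul_left C) (hasSum_diagonal_form b hT x)
  by_cases hi : i ∈ s
  · exact mul_le_mul_of_nonneg_right (h i hi) (sq_nonneg _)
  · simp [hx i hi]

end Diagonal

/-! ### The eigenbasis of the wave operator -/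

section Eigenbasis

/-- Indices `(m, n, b)` of the eigenfunctions: `m ≥ 1`, and `b` is true for `ψ_{(m,n)}`, `n ≥ 1`,
and false for `φ_{(m,n)}`, `n ≥ 0`. -/
def Mode : Type := {q : ℕ × ℕ × Bool // 1 ≤ q.1 ∧ (q.2.2 = true → 1 ≤ q.2.1)}

/-- The frequency in `s`. -/
def Mode.m (i : Mode) : ℕ := i.1.1

/-- The frequency in `t`. -/
def Mode.n (i : Mode) : ℕ := i.1.2.1

/-- The parity in `t`. -/
def Mode.b (i : Mode) : Bool := i.1.2.2

theorem Mode.one_le_m (i : Mode) : 1 ≤ i.m := i.2.1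

theorem Mode.ext_iff' {i j : Mode} : i = j ↔ i.m = j.m ∧ i.n = j.n ∧ i.b = j.b := by
  constructor
  · rintro rfl; exact ⟨rfl, rfl, rfl⟩
  · rintro ⟨h1, h2, h3⟩
    exact Subtype.ext (Prod.ext h1 (Prod.ext h2 h3))

/-- The eigenvalue `m² - n²` of a mode. -/
def Mode.eig (i : Mode) : ℤ := (i.m : ℤ) ^ 2 - (i.n : ℤ) ^ 2

/-- The eigenfunction of a mode. -/
def Mode.vec (i : Mode) : L2 := waveL2 true i.b i.m i.n

/-- The `s`-derivative of the eigenfunction of a mode. -/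
def Mode.vecS (i : Mode) : L2 := (i.m : ℝ) • waveL2 false i.b i.m i.n

/-- The `t`-derivative of the eigenfunction of a mode. -/
def Mode.vecT (i : Mode) : L2 := (i.n * trigSign i.b) • waveL2 true (!i.b) i.m i.n

theorem Mode.isWeakDeriv_vecS (i : Mode) : IsWeakDeriv (1, 0) i.vec i.vecS :=
  isWeakDeriv_wave_fst _ _ _

theorem Mode.isWeakDeriv_vecT (i : Mode) : IsWeakDeriv (0, 1) i.vec i.vecT :=
  isWeakDeriv_wave_snd _ _ _ _

theorem Mode.inner_vecS (i : Mode) {x g : L2} (h : IsWeakDeriv (1, 0) x g) :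
    ⟪g, i.vecS⟫_ℝ = (i.m : ℝ) ^ 2 * ⟪x, i.vec⟫_ℝ := h.inner_wave_fst _ _ _

theorem Mode.inner_vecT (i : Mode) {x g : L2} (h : IsWeakDeriv (0, 1) x g) :
    ⟪g, i.vecT⟫_ℝ = (i.n : ℝ) ^ 2 * ⟪x, i.vec⟫_ℝ := h.inner_wave_snd _ _ _ _

theorem Mode.vec_ne_zero (i : Mode) : i.vec ≠ 0 := by
  intro h0
  have hpi := Real.pi_pos
  have hm : (1 : ℝ) ≤ i.m := by exact_mod_cast i.one_le_m
  have hae : wave true i.b i.m i.n =ᵐ[volume.restrict (Ioo 0 Real.pi ×ˢ Ioo 0 (2 * Real.pi))]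
      fun _ => 0 := by
    have h1 := coeFn_toL2 (continuous_wave true i.b i.m i.n)
    have h2 := Lp.coeFn_zero ℝ 2 cylinderMeasure
    change toL2 _ (continuous_wave true i.b i.m i.n) = 0 at h0
    rw [h0] at h1
    exact h1.symm.trans h2
  have hz := Measure.eqOn_open_of_ae_eq hae (isOpen_Ioo.prod isOpen_Ioo)
    (continuous_wave _ _ _ _).continuousOn continuousOn_const
  have hn0 : (0 : ℝ) ≤ i.n := Nat.cast_nonneg _
  -- a point where `sin (m s) = 1` and `n t` lies in `[0, π/4)`
  have hp : ((Real.pi / (2 * i.m), Real.pi / (4 * (i.n + 1))) : ℝ × ℝ) ∈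
      Ioo 0 Real.pi ×ˢ Ioo 0 (2 * Real.pi) := by
    refine ⟨⟨by positivity, ?_⟩, ⟨by positivity, ?_⟩⟩
    · rw [div_lt_iff₀ (by positivity)]; nlinarith
    · rw [div_lt_iff₀ (by positivity)]; nlinarith
  have hval := hz hp
  simp only [wave] at hval
  have e1 : (i.m : ℝ) * (Real.pi / (2 * i.m)) = Real.pi / 2 := by
    field_simp
  have hlt : (i.n : ℝ) * (Real.pi / (4 * (i.n + 1))) < Real.pi / 2 := by
    rw [mul_div_assoc', div_lt_div_iff₀ (by positivity) (by positivity)]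
    nlinarith
  have hge : 0 ≤ (i.n : ℝ) * (Real.pi / (4 * (i.n + 1))) := by positivity
  have hs : trig true ((i.m : ℝ) * (Real.pi / (2 * i.m))) = 1 := by
    rw [e1]; simp [trig]
  have ht : 0 < trig i.b ((i.n : ℝ) * (Real.pi / (4 * (i.n + 1)))) := by
    rcases hb : i.b with _ | _
    · exact Real.cos_pos_of_mem_Ioo ⟨by linarith, hlt⟩
    · have hn : (1 : ℝ) ≤ i.n := by exact_mod_cast i.2.2 hb
      exact Real.sin_pos_of_pos_of_lt_pi (by positivity) (by linarith)
  rw [hs] at hval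
  have : 0 < Real.sqrt 2 / Real.pi * 1 *
      trig i.b ((i.n : ℝ) * (Real.pi / (4 * (i.n + 1)))) := by positivity
  exact this.ne' hval

/-- Eigenfunctions with different indices are orthogonal: the two integrations by parts of
`⟨∂ₛ e_i, ∂ₛ e_j⟩`, and likewise in `t`, give different multiples of `⟨e_i, e_j⟩` if the frequencies
differ. If only the parities differ, `∂ₜ e_i` and `∂ₜ e_j` are multiples of `e_j` and `e_i` with
opposite signs, which gives `n² ⟨e_i, e_j⟩ = -n² ⟨e_i, e_j⟩`. -/
theorem Mode.inner_vec_eq_zero {i j : Mode} (hij : i ≠ j) : ⟪i.vec, j.vec⟫_ℝ = 0 := by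
  by_contra hne
  have s1 := j.inner_vecS i.isWeakDeriv_vecS
  have s2 := i.inner_vecS j.isWeakDeriv_vecS
  rw [real_inner_comm, real_inner_comm i.vec] at s2
  have t1 := j.inner_vecT i.isWeakDeriv_vecT
  have t2 := i.inner_vecT j.isWeakDeriv_vecT
  rw [real_inner_comm, real_inner_comm i.vec] at t2
  have hm : i.m = j.m := by
    have : ((j.m : ℝ)) ^ 2 = (i.m : ℝ) ^ 2 := mul_right_cancel₀ hne (s1.symm.trans s2)
    have h := (pow_left_inj₀ (Nat.cast_nonneg _) (Nat.cast_nonneg _) two_ne_zero).1 this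
    exact_mod_cast h.symm
  have hn : i.n = j.n := by
    have : ((j.n : ℝ)) ^ 2 = (i.n : ℝ) ^ 2 := mul_right_cancel₀ hne (t1.symm.trans t2)
    have h := (pow_left_inj₀ (Nat.cast_nonneg _) (Nat.cast_nonneg _) two_ne_zero).1 this
    exact_mod_cast h.symm
  have hb : j.b = !i.b := by
    have : i.b ≠ j.b := fun h => hij (Mode.ext_iff'.2 ⟨hm, hn, h⟩)
    revert this
    cases i.b <;> cases j.b <;> simp
  have hn1 : 1 ≤ i.n := by
    rcases h : i.b with _ | _
    · rw [hn]; exact j.2.2 (by change j.b = true; rw [hb, h]; rfl)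
    · exact i.2.2 h
  have key : ⟪i.vecT, j.vecT⟫_ℝ = -((i.n : ℝ) ^ 2 * ⟪i.vec, j.vec⟫_ℝ) := by
    simp only [Mode.vecT, Mode.vec, hb, Bool.not_not, ← hm, ← hn, real_inner_smul_left,
      real_inner_smul_right]
    rw [real_inner_comm]
    linear_combination (i.n : ℝ) ^ 2 * ⟪waveL2 true i.b i.m i.n, waveL2 true (!i.b) i.m i.n⟫_ℝ *
      trigSign_mul_not i.b
  rw [t1, ← hn] at key
  have : (i.n : ℝ) ^ 2 * ⟪i.vec, j.vec⟫_ℝ = 0 := by linarith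
  rcases mul_eq_zero.1 this with h | h
  · have h' : (i.n : ℝ) = 0 := pow_eq_zero_iff two_ne_zero |>.1 h
    have : i.n = 0 := by exact_mod_cast h'
    omega
  · exact hne h

/-- The normalised eigenfunction of a mode. -/
def Mode.unit (i : Mode) : L2 := ‖i.vec‖⁻¹ • i.vec

theorem orthonormal_unit : Orthonormal ℝ Mode.unit :=
  ⟨fun i => norm_smul_inv_norm i.vec_ne_zero, fun i j hij => by
    change ⟪‖i.vec‖⁻¹ • i.vec, ‖j.vec‖⁻¹ • j.vec⟫_ℝ = 0
    rw [real_inner_smul_left, real_inner_smul_right,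
      Mode.inner_vec_eq_zero hij, mul_zero, mul_zero]⟩

theorem span_unit_orthogonal : (Submodule.span ℝ (range Mode.unit))ᗮ = ⊥ := by
  rw [Submodule.eq_bot_iff]
  intro u hu
  have h0 : ∀ i : Mode, ⟪u, i.vec⟫_ℝ = 0 := by
    intro i
    have h := (Submodule.mem_orthogonal' _ _).1 hu i.unit (Submodule.subset_span ⟨i, rfl⟩)
    rw [Mode.unit, real_inner_smul_right] at h
    exact (mul_eq_zero.1 h).resolve_left (inv_ne_zero (norm_ne_zero_iff.2 i.vec_ne_zero))
  refine eq_zero_of_integral_mul_eq_zero (fun m n => ?_) (fun m n => ?_)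
  · rcases Nat.eq_zero_or_pos m with rfl | hm
    · simp [phiFun_zero_left]
    · have h : ⟪u, waveL2 true false m n⟫_ℝ = 0 := h0 ⟨(m, n, false), hm, by simp⟩
      rwa [waveL2, inner_toL2_right] at h
  · rcases Nat.eq_zero_or_pos m with rfl | hm
    · simp [psiFun_zero_left]
    rcases Nat.eq_zero_or_pos n with rfl | hn
    · simp [psiFun_zero_right]
    · have h : ⟪u, waveL2 true true m n⟫_ℝ = 0 := h0 ⟨(m, n, true), hm, fun _ => hn⟩
      rwa [waveL2, inner_toL2_right] at h

/-- The Hilbert basis of eigenfunctions of the wave operator. -/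
def eigenbasis : HilbertBasis Mode ℝ L2 :=
  HilbertBasis.mkOfOrthogonalEqBot orthonormal_unit span_unit_orthogonal

theorem eigenbasis_apply (i : Mode) : eigenbasis i = ‖i.vec‖⁻¹ • i.vec := by
  rw [eigenbasis, HilbertBasis.coe_mkOfOrthogonalEqBot]; rfl

theorem abs_eig_ge {i : Mode} (h : i.eig ≠ 0) : (i.m : ℝ) + i.n ≤ |(i.eig : ℝ)| := by
  have key : (i.m : ℤ) + i.n ≤ |i.eig| := by
    have hne : (i.m : ℤ) - i.n ≠ 0 := by
      intro h0
      exact h (by rw [Mode.eig, sq_sub_sq, h0, mul_zero])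
    rw [Mode.eig, sq_sub_sq, abs_mul, abs_of_nonneg (by positivity : (0 : ℤ) ≤ i.m + i.n)]
    exact le_mul_of_one_le_right (by positivity) (Int.one_le_abs hne)
  exact_mod_cast key

/-- The inverse of the eigenvalue of a mode; it is `0⁻¹ = 0` on the kernel of the wave operator. -/
def Mode.inv (i : Mode) : ℝ := (i.eig : ℝ)⁻¹

theorem Mode.abs_inv_mul_add_le (i : Mode) : |i.inv| * (i.m + i.n) ≤ 1 := by
  rcases eq_or_ne i.eig 0 with h | h
  · simp [Mode.inv, h]
  · rw [Mode.inv, abs_inv, inv_mul_le_iff₀ (abs_pos.2 (by exact_mod_cast h)), mul_one]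
    exact abs_eig_ge h

theorem Mode.abs_inv_mul_m_le (i : Mode) : |i.inv| * i.m ≤ 1 := by
  refine le_trans ?_ i.abs_inv_mul_add_le
  have : (0 : ℝ) ≤ i.n := Nat.cast_nonneg _
  gcongr; linarith

theorem Mode.abs_inv_mul_n_le (i : Mode) : |i.inv| * i.n ≤ 1 := by
  refine le_trans ?_ i.abs_inv_mul_add_le
  have : (0 : ℝ) ≤ i.m := Nat.cast_nonneg _
  gcongr; linarith

theorem Mode.abs_inv_le_one (i : Mode) : |i.inv| ≤ 1 := by
  refine le_trans ?_ i.abs_inv_mul_m_le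
  exact le_mul_of_one_le_right (abs_nonneg _) (by exact_mod_cast i.one_le_m)

/-- Only finitely many modes have a nonzero eigenvalue of bounded size. -/
theorem finite_modes (C : ℝ) : {i : Mode | i.eig ≠ 0 ∧ |(i.eig : ℝ)| ≤ C}.Finite := by
  have hfin : ((Iic ⌊C⌋₊ ×ˢ Iic ⌊C⌋₊ ×ˢ univ : Set (ℕ × ℕ × Bool))).Finite :=
    (finite_Iic _).prod ((finite_Iic _).prod finite_univ)
  refine (hfin.preimage (Subtype.val_injective.injOn)).subset ?_
  rintro (i : Mode) ⟨h0, hC⟩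
  have h := (abs_eig_ge h0).trans hC
  have hm : (0 : ℝ) ≤ i.m := Nat.cast_nonneg _
  have hn : (0 : ℝ) ≤ i.n := Nat.cast_nonneg _
  exact ⟨Nat.le_floor (show (i.m : ℝ) ≤ C by linarith),
    Nat.le_floor (show (i.n : ℝ) ≤ C by linarith), mem_univ _⟩

/-- The inverse of the wave operator on its range, extended by `0` to its kernel. -/
def invWave : L2 →L[ℝ] L2 := (exists_diagonal eigenbasis Mode.abs_inv_le_one).choose

theorem inner_invWave (i : Mode) (x : L2) :
    ⟪eigenbasis i, invWave x⟫_ℝ = i.inv * ⟪eigenbasis i, x⟫_ℝ :=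
  (exists_diagonal eigenbasis Mode.abs_inv_le_one).choose_spec i x

theorem isCompactOperator_invWave : IsCompactOperator invWave := by
  refine isCompactOperator_diagonal eigenbasis inner_invWave fun ε hε => ?_
  refine (finite_modes ε⁻¹).subset fun i hi => ?_
  have h0 : i.eig ≠ 0 := by
    intro h
    simp only [Mode.inv, h, mem_ofPred_eq, Int.cast_zero, inv_zero, abs_zero] at hi
    exact absurd hi (not_lt.2 hε.le)
  refine ⟨h0, ?_⟩
  simp only [Mode.inv, abs_inv, mem_ofPred_eq] at hi
  exact (le_inv_comm₀ hε (abs_pos.2 (by exact_mod_cast h0))).1 hi.le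

theorem invWave_symm (x y : L2) : ⟪invWave x, y⟫_ℝ = ⟪x, invWave y⟫_ℝ :=
  diagonal_symm eigenbasis inner_invWave x y

/-! ### The spaces `𝓡`, `𝓝` and `𝓗¹` in coordinates -/

theorem eig_eq_zero_iff (i : Mode) : i.eig = 0 ↔ i.m = i.n := by
  rw [Mode.eig, sub_eq_zero, sq_eq_sq₀ (by positivity) (by positivity)]
  exact_mod_cast Iff.rfl

theorem coordSubspace_eigenbasis_le {K : Submodule ℝ L2} {s : Set Mode}
    (hs : ∀ i ∈ s, i.vec ∈ K) (hK : IsClosed (K : Set L2)) : coordSubspace eigenbasis s ≤ K :=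
  coordSubspace_le hK fun i hi => by
    rw [eigenbasis_apply]; exact K.smul_mem _ (hs i hi)

theorem vec_mem_coordSubspace {i : Mode} {s : Set Mode} (hi : i ∈ s) :
    i.vec ∈ coordSubspace eigenbasis s := by
  have h : i.vec = ‖i.vec‖ • eigenbasis i := by
    rw [eigenbasis_apply, smul_smul, mul_inv_cancel₀ (norm_ne_zero_iff.2 i.vec_ne_zero), one_smul]
  rw [h]
  exact Submodule.smul_mem _ _ (basis_mem_coordSubspace hi)

theorem psi_zero_right (m : ℕ) : psi m 0 = 0 := by
  have : psi m 0 = (0 : ℝ) • psi m 0 :=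
    toL2_smul 0 (continuous_psiFun m 0) (continuous_psiFun m 0) (by simp [psiFun])
  rw [this, zero_smul]

theorem rangeSpace_eq : rangeSpace = coordSubspace eigenbasis {i | i.eig ≠ 0} := by
  refine le_antisymm ?_ (coordSubspace_eigenbasis_le (fun i hi => ?_)
    (Submodule.isClosed_topologicalClosure _))
  · refine Submodule.topologicalClosure_minimal _ (Submodule.span_le.2 ?_)
      (isClosed_coordSubspace _)
    rintro v ⟨m, n, hm, hmn, rfl | rfl⟩
    · exact vec_mem_coordSubspace (i := ⟨(m, n, false), hm, by simp⟩)
        fun h => hmn ((eig_eq_zero_iff _).1 h)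
    · rcases Nat.eq_zero_or_pos n with rfl | hn
      · rw [psi_zero_right]; exact Submodule.zero_mem _
      · exact vec_mem_coordSubspace (i := ⟨(m, n, true), hm, fun _ => hn⟩)
          fun h => hmn ((eig_eq_zero_iff _).1 h)
  · refine Submodule.le_topologicalClosure _ (Submodule.subset_span ?_)
    refine ⟨i.m, i.n, i.one_le_m, fun h => hi ((eig_eq_zero_iff i).2 h), ?_⟩
    rcases h : i.b with _ | _
    · left; rw [Mode.vec, h]; rfl
    · right; rw [Mode.vec, h]; rfl

theorem kernelSpace_eq : kernelSpace = coordSubspace eigenbasis {i | i.eig = 0} := by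
  refine le_antisymm ?_ (coordSubspace_eigenbasis_le (fun i hi => ?_)
    (Submodule.isClosed_topologicalClosure _))
  · refine Submodule.topologicalClosure_minimal _ (Submodule.span_le.2 ?_)
      (isClosed_coordSubspace _)
    rintro v ⟨l, hl, rfl | rfl⟩
    · exact vec_mem_coordSubspace (i := ⟨(l, l, false), hl, by simp⟩) ((eig_eq_zero_iff _).2 rfl)
    · exact vec_mem_coordSubspace (i := ⟨(l, l, true), hl, fun _ => hl⟩) ((eig_eq_zero_iff _).2 rfl)
  · refine Submodule.le_topologicalClosure _ (Submodule.subset_span ?_)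
    have hmn : i.m = i.n := (eig_eq_zero_iff i).1 hi
    refine ⟨i.m, i.one_le_m, ?_⟩
    rcases h : i.b with _ | _
    · left; rw [Mode.vec, h, ← hmn]; rfl
    · right; rw [Mode.vec, h, ← hmn]; rfl

/-- Weak derivatives are stable under summation. -/
theorem IsWeakDeriv.hasSum {ι : Type*} {e : ℝ × ℝ} {x g : ι → L2} {x₀ g₀ : L2}
    (h : ∀ i, IsWeakDeriv e (x i) (g i)) (hx : HasSum x x₀) (hg : HasSum g g₀) :
    IsWeakDeriv e x₀ g₀ := by
  intro η hη
  have hc := hη.continuous_fderiv_apply e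
  rw [← inner_toL2_right x₀ hc, ← inner_toL2_right g₀ hη.1.continuous, real_inner_comm,
    real_inner_comm _ g₀]
  refine (hx.mapL (innerSL ℝ (toL2 _ hc))).unique ?_
  refine (hg.mapL (innerSL ℝ (toL2 _ hη.1.continuous))).neg.congr_fun fun i => ?_
  rw [innerSL_apply_apply, innerSL_apply_apply, real_inner_comm, real_inner_comm (g i),
    inner_toL2_right, inner_toL2_right, h i η hη]

theorem hasSum_invWave (h : L2) : HasSum
    (fun i : Mode => (i.inv * ⟪eigenbasis i, h⟫_ℝ * ‖i.vec‖⁻¹) • i.vec) (invWave h) := by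
  refine (eigenbasis.hasSum_repr (invWave h)).congr_fun fun i => ?_
  rw [eigenbasis.repr_apply_apply, inner_invWave, eigenbasis_apply, smul_smul]

/-- The series of the derivatives of the terms of `hasSum_invWave` converges, by orthogonality and
`|m² - n²| ≥ m + n`. -/
theorem summable_deriv {d : Mode → L2} {k : Mode → ℕ}
    (hd : ∀ i j, ⟪d i, d j⟫_ℝ = (k j : ℝ) ^ 2 * ⟪i.vec, j.vec⟫_ℝ)
    (hk : ∀ i, |i.inv| * k i ≤ 1) (h : L2) :
    Summable fun i : Mode => (i.inv * ⟪eigenbasis i, h⟫_ℝ * ‖i.vec‖⁻¹) • d i := by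
  refine summable_smul_of_orthogonal (fun i j hij => by
    dsimp only
    rw [hd, Mode.inner_vec_eq_zero hij, mul_zero]) ?_
  refine Summable.of_nonneg_of_le (fun i => sq_nonneg _) (fun i => ?_)
    (hasSum_inner_sq eigenbasis h).summable
  have e1 : ‖d i‖ ^ 2 = (k i : ℝ) ^ 2 * ‖i.vec‖ ^ 2 := by
    rw [← real_inner_self_eq_norm_sq, hd, real_inner_self_eq_norm_sq]
  have e2 : ‖i.vec‖⁻¹ ^ 2 * ‖i.vec‖ ^ 2 = 1 := by
    rw [← mul_pow, inv_mul_cancel₀ (norm_ne_zero_iff.2 i.vec_ne_zero), one_pow]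
  have e3 : i.inv ^ 2 * (k i : ℝ) ^ 2 ≤ 1 := by
    rw [← sq_abs, ← mul_pow]
    exact pow_le_one₀ (by positivity) (hk i)
  calc (i.inv * ⟪eigenbasis i, h⟫_ℝ * ‖i.vec‖⁻¹ * ‖d i‖) ^ 2
      = (i.inv ^ 2 * (k i : ℝ) ^ 2) * ⟪eigenbasis i, h⟫_ℝ ^ 2 * (‖i.vec‖⁻¹ ^ 2 * ‖i.vec‖ ^ 2) := by
        rw [mul_pow, e1]; ring
    _ ≤ ⟪eigenbasis i, h⟫_ℝ ^ 2 := by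
        rw [e2, mul_one]
        exact mul_le_of_le_one_left (sq_nonneg _) e3

/-- `invWave h` lies in `𝓗¹`, and the wave operator maps it back to `h` in the weak sense. -/
theorem exists_mem_H1_invWave {h : L2} (hh : h ∈ rangeSpace) :
    ∃ q ∈ H1, q.1 = invWave h ∧
      ∀ r ∈ H1, ⟪q.2.1, r.2.1⟫_ℝ - ⟪q.2.2, r.2.2⟫_ℝ = ⟪h, r.1⟫_ℝ := by
  obtain ⟨gs, hgs⟩ := summable_deriv (d := Mode.vecS) (k := Mode.m)
    (fun i j => j.inner_vecS i.isWeakDeriv_vecS) Mode.abs_inv_mul_m_le h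
  obtain ⟨gt, hgt⟩ := summable_deriv (d := Mode.vecT) (k := Mode.n)
    (fun i j => j.inner_vecT i.isWeakDeriv_vecT) Mode.abs_inv_mul_n_le h
  rw [rangeSpace_eq] at hh
  refine ⟨(invWave h, gs, gt), ⟨?_, ?_, ?_⟩, rfl, fun r hr => ?_⟩
  · rw [rangeSpace_eq]
    intro i hi
    rw [inner_invWave, hh i hi, mul_zero]
  · exact IsWeakDeriv.hasSum (fun i => i.isWeakDeriv_vecS.smul _) (hasSum_invWave h) hgs
  · exact IsWeakDeriv.hasSum (fun i => i.isWeakDeriv_vecT.smul _) (hasSum_invWave h) hgt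
  · have h1 := (hgs.mapL (innerSL ℝ r.2.1)).sub (hgt.mapL (innerSL ℝ r.2.2))
    simp only [innerSL_apply_apply] at h1
    rw [real_inner_comm, real_inner_comm r.2.2]
    refine h1.unique ?_
    refine (eigenbasis.hasSum_inner_mul_inner h r.1).congr_fun fun i => ?_
    rw [real_inner_smul_right, real_inner_smul_right, i.inner_vecS hr.2.1, i.inner_vecT hr.2.2,
      eigenbasis_apply, real_inner_smul_left, real_inner_smul_left, real_inner_smul_right,
      real_inner_comm r.1, real_inner_comm h]
    by_cases hi : i.eig = 0
    · have h0 := hh i (by simpa using hi)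
      rw [eigenbasis_apply, real_inner_smul_left, real_inner_comm] at h0
      linear_combination (i.inv * ‖i.vec‖⁻¹ * ((i.m : ℝ) ^ 2 - (i.n : ℝ) ^ 2) * ⟪r.1, i.vec⟫_ℝ
        - ‖i.vec‖⁻¹ * ⟪r.1, i.vec⟫_ℝ) * h0
    · have : i.inv * ((i.m : ℝ) ^ 2 - (i.n : ℝ) ^ 2) = 1 := by
        have hne : ((i.eig : ℤ) : ℝ) ≠ 0 := by exact_mod_cast hi
        rw [Mode.inv, inv_mul_eq_one₀ hne, Mode.eig]; push_cast; rfl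
      linear_combination (‖i.vec‖⁻¹ * ⟪h, i.vec⟫_ℝ * ‖i.vec‖⁻¹ * ⟪r.1, i.vec⟫_ℝ) * this

end Eigenbasis

/-! ### The dual formulation of the boundary value problem -/

section Dual

theorem coeFn_asymMul {Ω : Type*} [MeasurableSpace Ω] {μ : Measure Ω} (x : ℝ × ℝ)
    (h : Lp ℝ 2 μ) : ∀ᵐ p ∂μ, asymMul x h p = x.1 * max (h p) 0 - x.2 * max (-h p) 0 := by
  filter_upwards [Lp.coeFn_sub (x.1 • Lp.posPart h) (x.2 • Lp.negPart h),
    Lp.coeFn_smul x.1 (Lp.posPart h), Lp.coeFn_smul x.2 (Lp.negPart h), Lp.coeFn_posPart h,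
    Lp.coeFn_negPart_eq_max h] with p h1 h2 h3 h4 h5
  rw [asymMul, h1, Pi.sub_apply, h2, h3, Pi.smul_apply, Pi.smul_apply, h4, h5, smul_eq_mul,
    smul_eq_mul]

theorem asymMul_inv_of_pos {Ω : Type*} [MeasurableSpace Ω] {μ : Measure Ω} {a b : ℝ} (ha : 0 < a)
    (hb : 0 < b) (u : Lp ℝ 2 μ) : asymMul (a⁻¹, b⁻¹) (asymMul (a, b) u) = u := by
  apply Lp.ext
  filter_upwards [coeFn_asymMul (a⁻¹, b⁻¹) (asymMul (a, b) u), coeFn_asymMul (a, b) u]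
    with p h1 h2
  rw [h1, h2]
  rcases le_total 0 (u p) with h | h
  · rw [max_eq_left h, max_eq_right (neg_nonpos.2 h), mul_zero, sub_zero,
      max_eq_left (mul_nonneg ha.le h), max_eq_right (neg_nonpos.2 (mul_nonneg ha.le h))]
    field_simp; ring
  · have h' : 0 ≤ b * -u p := mul_nonneg hb.le (neg_nonneg.2 h)
    rw [max_eq_right h, max_eq_left (neg_nonneg.2 h), mul_zero, zero_sub, neg_neg,
      max_eq_left h', max_eq_right (neg_nonpos.2 h')]
    field_simp; ring

/-- For negative coefficients `u ↦ a u⁺ - b u⁻` exchanges the two signs. -/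
theorem asymMul_inv_of_neg {Ω : Type*} [MeasurableSpace Ω] {μ : Measure Ω} {a b : ℝ} (ha : a < 0)
    (hb : b < 0) (u : Lp ℝ 2 μ) : asymMul (b⁻¹, a⁻¹) (asymMul (a, b) u) = u := by
  apply Lp.ext
  filter_upwards [coeFn_asymMul (b⁻¹, a⁻¹) (asymMul (a, b) u), coeFn_asymMul (a, b) u]
    with p h1 h2
  rw [h1, h2]
  have ha' := ha.ne
  have hb' := hb.ne
  rcases le_total 0 (u p) with h | h
  · have h' : a * u p ≤ 0 := mul_nonpos_of_nonpos_of_nonneg ha.le h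
    rw [max_eq_left h, max_eq_right (neg_nonpos.2 h), mul_zero, sub_zero,
      max_eq_right h', max_eq_left (neg_nonneg.2 h')]
    field_simp; ring
  · have h' : b * -u p ≤ 0 := mul_nonpos_of_nonpos_of_nonneg hb.le (neg_nonneg.2 h)
    rw [max_eq_right h, max_eq_left (neg_nonneg.2 h), mul_zero, zero_sub, neg_neg,
      max_eq_right h', max_eq_left (neg_nonneg.2 h')]
    field_simp; ring

theorem asymMul_zero {Ω : Type*} [MeasurableSpace Ω] {μ : Measure Ω} (x : ℝ × ℝ) :
    asymMul x (0 : Lp ℝ 2 μ) = 0 := by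
  have h1 : Lp.posPart (0 : Lp ℝ 2 μ) = 0 := by
    simpa using posPart_smul (le_refl (0 : ℝ)) (0 : Lp ℝ 2 μ)
  have h2 : Lp.negPart (0 : Lp ℝ 2 μ) = 0 := by
    simpa using negPart_smul (le_refl (0 : ℝ)) (0 : Lp ℝ 2 μ)
  rw [asymMul, h1, h2, smul_zero, smul_zero, sub_zero]

theorem hasFDerivAt_norm_posPart_sq {Ω : Type*} [MeasurableSpace Ω] {μ : Measure Ω}
    (u : Lp ℝ 2 μ) :
    HasFDerivAt (fun v : Lp ℝ 2 μ => ‖Lp.posPart v‖ ^ 2)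
      ((2 : ℝ) • innerSL ℝ (Lp.posPart u)) u := by
  rw [hasFDerivAt_iff_isLittleO_nhds_zero]
  refine Asymptotics.IsBigO.trans_isLittleO (g := fun k : Lp ℝ 2 μ => ‖k‖ ^ 2)
    (Asymptotics.IsBigO.of_bound 1 (Eventually.of_forall fun k => ?_))
    (Asymptotics.isLittleO_norm_pow_id one_lt_two)
  have e1 := (sq_nonneg _).trans (posPart_excess u k)
  have e2 := (sq_nonneg _).trans (negPart_excess u k)
  have e3 := excess_add u k
  rw [smul_apply, innerSL_apply_apply, smul_eq_mul, Real.norm_eq_abs, abs_of_nonneg e1, one_mul,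
    Real.norm_eq_abs, abs_of_nonneg (sq_nonneg _)]
  linarith

theorem hasFDerivAt_norm_negPart_sq {Ω : Type*} [MeasurableSpace Ω] {μ : Measure Ω}
    (u : Lp ℝ 2 μ) :
    HasFDerivAt (fun v : Lp ℝ 2 μ => ‖Lp.negPart v‖ ^ 2)
      (-((2 : ℝ) • innerSL ℝ (Lp.negPart u))) u := by
  have h := (hasFDerivAt_norm_posPart_sq (-u)).comp u (hasFDerivAt_id u).neg
  refine h.congr_fderiv ?_
  ext k
  simp [posPart_neg]

/-- The map `(x, y) ↦ x + y` as a continuous linear map. -/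
def toFunctionL : H1 × kernelSpace →L[ℝ] L2 :=
  (ContinuousLinearMap.fst ℝ L2 (L2 × L2)).comp
    (H1.subtypeL.comp (ContinuousLinearMap.fst ℝ H1 kernelSpace))
  + kernelSpace.subtypeL.comp (ContinuousLinearMap.snd ℝ H1 kernelSpace)

theorem toFunctionL_apply (z : H1 × kernelSpace) : toFunctionL z = toFunction z := rfl

/-- The `s`-derivative on `𝓗¹ × 𝓝` as a continuous linear map. -/
def derivS : H1 × kernelSpace →L[ℝ] L2 :=
  ((ContinuousLinearMap.fst ℝ L2 L2).comp (ContinuousLinearMap.snd ℝ L2 (L2 × L2))).comp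
    (H1.subtypeL.comp (ContinuousLinearMap.fst ℝ H1 kernelSpace))

/-- The `t`-derivative on `𝓗¹ × 𝓝` as a continuous linear map. -/
def derivT : H1 × kernelSpace →L[ℝ] L2 :=
  ((ContinuousLinearMap.snd ℝ L2 L2).comp (ContinuousLinearMap.snd ℝ L2 (L2 × L2))).comp
    (H1.subtypeL.comp (ContinuousLinearMap.fst ℝ H1 kernelSpace))

/-- The derivative of the energy functional. -/
def energyDeriv (a b : ℝ) (z : H1 × kernelSpace) : H1 × kernelSpace →L[ℝ] ℝ :=
  (innerSL ℝ (derivS z)).comp derivS - (innerSL ℝ (derivT z)).comp derivT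
    - (innerSL ℝ (asymMul (a, b) (toFunction z))).comp toFunctionL

theorem hasFDerivAt_energy (a b : ℝ) (z : H1 × kernelSpace) :
    HasFDerivAt (energy a b) (energyDeriv a b z) z := by
  have h1 := (derivS.hasFDerivAt (x := z)).norm_sq
  have h2 := (derivT.hasFDerivAt (x := z)).norm_sq
  have h3 := (hasFDerivAt_norm_posPart_sq (toFunctionL z)).comp z toFunctionL.hasFDerivAt
  have h4 := (hasFDerivAt_norm_negPart_sq (toFunctionL z)).comp z toFunctionL.hasFDerivAt
  have h := (((h1.sub h2).sub (h3.const_mul a)).sub (h4.const_mul b)).const_mul (1 / 2)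
  refine h.congr_fderiv ?_
  ext w
  · simp [energyDeriv, inner_asymMul, toFunctionL_apply]; ring
  · simp [energyDeriv, inner_asymMul, toFunctionL_apply]; ring

theorem isWeakSolution_iff {a b : ℝ} {z : H1 × kernelSpace} :
    IsWeakSolution a b z ↔ ∀ w : H1 × kernelSpace,
      ⟪derivS z, derivS w⟫_ℝ - ⟪derivT z, derivT w⟫_ℝ
        - ⟪asymMul (a, b) (toFunction z), toFunction w⟫_ℝ = 0 := by
  constructor
  · intro h w
    have := (hasFDerivAt_energy a b z).unique h
    have hw := congrArg (fun L : H1 × kernelSpace →L[ℝ] ℝ => L w) this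
    simpa [energyDeriv, toFunctionL_apply] using hw
  · intro h
    have : energyDeriv a b z = 0 := by
      refine ContinuousLinearMap.ext fun w => ?_
      simpa [energyDeriv, toFunctionL_apply] using h w
    rw [IsWeakSolution, ← this]
    exact hasFDerivAt_energy a b z

/-- A critical point on `𝓡` of the dual functional with coefficients `x = (α, β)`. -/
def IsDualSolution (x : ℝ × ℝ) (h : L2) : Prop :=
  h ∈ rangeSpace ∧ ∀ k ∈ rangeSpace, ⟪asymMul x h - invWave h, k⟫_ℝ = 0

theorem IsDualSolution.neg {x : ℝ × ℝ} {h : L2} (hh : IsDualSolution x h) :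
    IsDualSolution x.swap (-h) := by
  refine ⟨rangeSpace.neg_mem hh.1, fun k hk => ?_⟩
  rw [asymMul_neg, Prod.swap_swap, map_neg, ← neg_sub', inner_neg_left, hh.2 k hk, neg_zero]

theorem inner_eq_zero_of_mem {h l : L2} (hh : h ∈ rangeSpace) (hl : l ∈ kernelSpace) :
    ⟪h, l⟫_ℝ = 0 := by
  rw [rangeSpace_eq] at hh
  rw [kernelSpace_eq] at hl
  refine (eigenbasis.hasSum_inner_mul_inner h l).unique (hasSum_zero.congr_fun fun i => ?_)
  by_cases hi : i.eig = 0
  · rw [real_inner_comm, hh i (by simpa using hi), zero_mul]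
  · rw [hl i hi, mul_zero]

theorem inner_rangeSpace_eq_zero {v : L2} (hv : ∀ i : Mode, i.eig ≠ 0 → ⟪eigenbasis i, v⟫_ℝ = 0)
    {k : L2} (hk : k ∈ rangeSpace) : ⟪v, k⟫_ℝ = 0 := by
  have : v ∈ kernelSpace := by
    rw [kernelSpace_eq]; exact fun i hi => hv i hi
  rw [real_inner_comm, inner_eq_zero_of_mem hk this]

/-- The right-hand side `h = a u⁺ - b u⁻` of a weak solution `u` lies in `𝓡`, and the component of
`u` in `𝓡` is the inverse of the wave operator applied to `h`. -/
theorem IsWeakSolution.dual {a b : ℝ} {z : H1 × kernelSpace} (hz : IsWeakSolution a b z) :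
    asymMul (a, b) (toFunction z) ∈ rangeSpace ∧ ∀ k ∈ rangeSpace,
      ⟪toFunction z - invWave (asymMul (a, b) (toFunction z)), k⟫_ℝ = 0 := by
  rw [isWeakSolution_iff] at hz
  set h := asymMul (a, b) (toFunction z) with hh
  have hmem : h ∈ rangeSpace := by
    rw [rangeSpace_eq]
    intro i hi
    have hi' : eigenbasis i ∈ kernelSpace := by
      rw [kernelSpace_eq]
      exact basis_mem_coordSubspace (by simpa using hi)
    have := hz (0, ⟨eigenbasis i, hi'⟩)
    simpa [derivS, derivT, toFunction, real_inner_comm] using this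
  refine ⟨hmem, fun k hk => inner_rangeSpace_eq_zero (fun i hi => ?_) hk⟩
  have hiH : ((i.vec, i.vecS, i.vecT) : L2 × L2 × L2) ∈ H1 :=
    ⟨by rw [rangeSpace_eq]; exact vec_mem_coordSubspace hi, i.isWeakDeriv_vecS, i.isWeakDeriv_vecT⟩
  have h1 := hz (⟨_, hiH⟩, 0)
  have e1 : ⟪derivS z, i.vecS⟫_ℝ = (i.m : ℝ) ^ 2 * ⟪(z.1 : L2 × L2 × L2).1, i.vec⟫_ℝ :=
    i.inner_vecS z.1.2.2.1
  have e2 : ⟪derivT z, i.vecT⟫_ℝ = (i.n : ℝ) ^ 2 * ⟪(z.1 : L2 × L2 × L2).1, i.vec⟫_ℝ :=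
    i.inner_vecT z.1.2.2.2
  have e3 : toFunction (⟨(i.vec, i.vecS, i.vecT), hiH⟩, 0) = i.vec := by simp [toFunction]
  have e4 : ⟪toFunction z, i.vec⟫_ℝ = ⟪(z.1 : L2 × L2 × L2).1, i.vec⟫_ℝ := by
    rw [toFunction, inner_add_left, real_inner_comm _ (z.2 : L2),
      inner_eq_zero_of_mem hiH.1 z.2.2, add_zero]
  change ⟪derivS z, i.vecS⟫_ℝ - ⟪derivT z, i.vecT⟫_ℝ - _ = 0 at h1
  rw [e1, e2, e3, ← e4] at h1
  have hne : ((i.eig : ℤ) : ℝ) ≠ 0 := by exact_mod_cast hi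
  have h2 : (i.eig : ℝ) * ⟪i.vec, toFunction z⟫_ℝ = ⟪i.vec, h⟫_ℝ := by
    rw [real_inner_comm, real_inner_comm h, Mode.eig]
    push_cast
    linarith
  rw [inner_sub_right, inner_invWave, eigenbasis_apply, real_inner_smul_left, real_inner_smul_left,
    Mode.inv, ← h2]
  field_simp
  ring

/-- A critical point of the dual functional gives back a weak solution. -/
theorem hasNontrivialWeakSolution_of_dual {a b : ℝ} {u h : L2} (hu : asymMul (a, b) u = h)
    (hh : h ∈ rangeSpace) (hcrit : ∀ k ∈ rangeSpace, ⟪u - invWave h, k⟫_ℝ = 0) (h0 : h ≠ 0) :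
    HasNontrivialWeakSolution a b := by
  obtain ⟨q, hq, hq1, hq2⟩ := exists_mem_H1_invWave hh
  have hy : u - invWave h ∈ kernelSpace := by
    rw [kernelSpace_eq]
    intro i hi
    rw [real_inner_comm]
    refine hcrit _ ?_
    rw [rangeSpace_eq]
    exact basis_mem_coordSubspace hi
  have hz : toFunction (⟨q, hq⟩, ⟨u - invWave h, hy⟩) = u := by
    simp only [toFunction, hq1]; abel
  refine ⟨(⟨q, hq⟩, ⟨u - invWave h, hy⟩), isWeakSolution_iff.2 fun w => ?_, ?_⟩
  · rw [hz, hu, toFunction, inner_add_right, inner_eq_zero_of_mem hh w.2.2, add_zero,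
      ← hq2 _ w.1.2]
    exact sub_self _
  · rw [hz]
    rintro rfl
    exact h0 (hu ▸ asymMul_zero _)

/-- Duality: `u` solves the boundary value problem with coefficients `(a, b)` of equal sign iff
`± (a u⁺ - b u⁻)` is a critical point of the dual functional with coefficients `(1/a, 1/b)`. -/
theorem hasNontrivialWeakSolution_iff {a b : ℝ} (hab : (0 < a ∧ 0 < b) ∨ (a < 0 ∧ b < 0)) :
    HasNontrivialWeakSolution a b ↔ ∃ h, h ≠ 0 ∧ IsDualSolution (a⁻¹, b⁻¹) h := by
  constructor
  · rintro ⟨z, hz, hz0⟩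
    obtain ⟨h1, h2⟩ := hz.dual
    rcases hab with ⟨ha, hb⟩ | ⟨ha, hb⟩
    · have e := asymMul_inv_of_pos ha hb (toFunction z)
      refine ⟨asymMul (a, b) (toFunction z), fun h => hz0 ?_, h1, ?_⟩
      · rw [← e, h, asymMul_zero]
      · rwa [e]
    · have e := asymMul_inv_of_neg ha hb (toFunction z)
      refine ⟨-asymMul (a, b) (toFunction z), fun h => hz0 ?_, ?_⟩
      · rw [← e, neg_eq_zero.1 h, asymMul_zero]
      · exact IsDualSolution.neg (x := (b⁻¹, a⁻¹)) ⟨h1, by rwa [e]⟩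
  · rintro ⟨h, h0, hh⟩
    rcases hab with ⟨ha, hb⟩ | ⟨ha, hb⟩
    · have e := asymMul_inv_of_pos (inv_pos.2 ha) (inv_pos.2 hb) h
      rw [inv_inv, inv_inv] at e
      exact hasNontrivialWeakSolution_of_dual e hh.1 hh.2 h0
    · have e := asymMul_inv_of_neg (inv_lt_zero.2 hb) (inv_lt_zero.2 ha) (-h)
      rw [inv_inv, inv_inv] at e
      exact hasNontrivialWeakSolution_of_dual e hh.neg.1 hh.neg.2 (neg_ne_zero.2 h0)

end Dual

/-! ### The sequence of eigenvalues -/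

section Eigenvalues

theorem isEigenvalue_eig (i : Mode) : IsEigenvalue i.eig := ⟨i.m, i.n, i.one_le_m, rfl⟩

theorem isEigenvalue_zero : IsEigenvalue 0 := ⟨1, 1, le_rfl, by norm_num⟩

theorem infinite_isEigenvalue : {j : ℕ | IsEigenvalue (j : ℤ)}.Infinite := by
  refine infinite_of_injective_forall_mem (f := fun n : ℕ => 2 * n + 1)
    (fun a b h => by simpa using h) fun n => ⟨n + 1, n, by omega, ?_⟩
  push_cast; ring

theorem infinite_isEigenvalue_neg : {j : ℕ | 0 < j ∧ IsEigenvalue (-(j : ℤ))}.Infinite := by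
  refine infinite_of_injective_forall_mem (f := fun n : ℕ => 2 * n + 3)
    (fun a b h => by simpa using h) fun n => ⟨by omega, n + 1, n + 2, by omega, ?_⟩
  push_cast; ring

theorem nth_isEigenvalue_zero : Nat.nth (fun j : ℕ => IsEigenvalue (j : ℤ)) 0 = 0 :=
  Nat.nth_zero_of_zero isEigenvalue_zero

theorem isEigenvalue_eigenvalueInt (k : ℤ) : IsEigenvalue (eigenvalueInt k) := by
  rcases k with n | n
  · exact Nat.nth_mem_of_infinite infinite_isEigenvalue n
  · exact (Nat.nth_mem_of_infinite infinite_isEigenvalue_neg n).2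

theorem eigenvalueInt_negSucc_neg (n : ℕ) : eigenvalueInt (Int.negSucc n) < 0 := by
  have := (Nat.nth_mem_of_infinite infinite_isEigenvalue_neg n).1
  simp only [eigenvalueInt]
  omega

theorem eigenvalueInt_lt_succ (k : ℤ) : eigenvalueInt k < eigenvalueInt (k + 1) := by
  rcases k with n | _ | n
  · have := Nat.nth_strictMono infinite_isEigenvalue (Nat.lt_succ_self n)
    change ((Nat.nth _ n : ℕ) : ℤ) < ((Nat.nth _ (n + 1) : ℕ) : ℤ)
    exact_mod_cast this
  · have h := eigenvalueInt_negSucc_neg 0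
    change eigenvalueInt (Int.negSucc 0) < ((Nat.nth _ 0 : ℕ) : ℤ)
    omega
  · have := Nat.nth_strictMono infinite_isEigenvalue_neg (Nat.lt_succ_self n)
    change -((Nat.nth _ (n + 1) : ℕ) : ℤ) < -((Nat.nth _ n : ℕ) : ℤ)
    simp only [Nat.succ_eq_add_one] at this
    omega

/-- There is no eigenvalue strictly between `λ_k` and `λ_{k+1}`. -/
theorem eigenvalueInt_gap (k : ℤ) {j : ℤ} (hj : IsEigenvalue j) :
    j ≤ eigenvalueInt k ∨ eigenvalueInt (k + 1) ≤ j := by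
  by_contra! h
  obtain ⟨h1, h2⟩ := h
  rcases k with n | _ | n
  · change ((Nat.nth (fun j : ℕ => IsEigenvalue (j : ℤ)) n : ℕ) : ℤ) < j at h1
    change j < ((Nat.nth _ (n + 1) : ℕ) : ℤ) at h2
    lift j to ℕ using by omega
    have := Nat.le_nth_of_lt_nth_succ (by exact_mod_cast h2) hj
    omega
  · change -((Nat.nth (fun j : ℕ => 0 < j ∧ IsEigenvalue (-(j : ℤ))) 0 : ℕ) : ℤ) < j at h1
    change j < ((Nat.nth _ 0 : ℕ) : ℤ) at h2
    rw [nth_isEigenvalue_zero] at h2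
    obtain ⟨i, rfl⟩ : ∃ i : ℕ, j = -(i : ℤ) := ⟨j.natAbs, by omega⟩
    have hi : 0 < i ∧ IsEigenvalue (-(i : ℤ)) := ⟨by omega, hj⟩
    have h3 : Nat.nth (fun j : ℕ => 0 < j ∧ IsEigenvalue (-(j : ℤ))) 0 ≤ i := by
      rw [Nat.nth_zero]; exact Nat.sInf_le hi
    omega
  · change -((Nat.nth (fun j : ℕ => 0 < j ∧ IsEigenvalue (-(j : ℤ))) (n + 1) : ℕ) : ℤ) < j at h1
    change j < -((Nat.nth _ n : ℕ) : ℤ) at h2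
    obtain ⟨i, rfl⟩ : ∃ i : ℕ, j = -(i : ℤ) := ⟨j.natAbs, by omega⟩
    have hi : 0 < i ∧ IsEigenvalue (-(i : ℤ)) := ⟨by omega, hj⟩
    have := Nat.le_nth_of_lt_nth_succ (p := fun j : ℕ => 0 < j ∧ IsEigenvalue (-(j : ℤ))) (k := n)
      (by omega) hi
    omega

theorem one_lt_eigenvalueInt {k : ℤ} (hk : k ≠ 1) (h : 0 < eigenvalueInt k) :
    1 < eigenvalueInt k := by
  rcases k with n | n
  · have hn0 : n ≠ 0 := by
      rintro rfl
      change 0 < ((Nat.nth _ 0 : ℕ) : ℤ) at h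
      rw [nth_isEigenvalue_zero] at h
      omega
    have hn1 : n ≠ 1 := by rintro rfl; exact hk rfl
    have h1 := Nat.nth_strictMono infinite_isEigenvalue (show 0 < 1 by omega)
    have h2 := Nat.nth_strictMono infinite_isEigenvalue (show 1 < n by omega)
    change 1 < ((Nat.nth _ n : ℕ) : ℤ)
    omega
  · exact absurd h (eigenvalueInt_negSucc_neg n).not_gt

end Eigenvalues

/-! ### The splitting of `𝓡` and the curve -/

section Curve

/-- The modes whose inverse eigenvalue is at least that of `l`. -/
def highModes (l : ℤ) : Set Mode := {i | i.eig ≠ 0 ∧ (l : ℝ)⁻¹ ≤ i.inv}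

/-- The modes whose inverse eigenvalue is smaller than that of `l`. -/
def lowModes (l : ℤ) : Set Mode := {i | i.eig ≠ 0 ∧ i.inv < (l : ℝ)⁻¹}

/-- The finite or cofinite dimensional part of `𝓡` on which the sign of the reduced functional is
studied. -/
abbrev highSpace (l : ℤ) : Submodule ℝ L2 := coordSubspace eigenbasis (highModes l)

/-- The complementary part of `𝓡`, along which the dual functional is convex. -/
abbrev lowSpace (l : ℤ) : Submodule ℝ L2 := coordSubspace eigenbasis (lowModes l)

theorem highSpace_sup_lowSpace (l : ℤ) : highSpace l ⊔ lowSpace l = rangeSpace := by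
  rw [coordSubspace_sup, rangeSpace_eq]
  congr 1
  ext i
  constructor
  · rintro (h | h) <;> exact h.1
  · intro h
    rcases le_or_gt (l : ℝ)⁻¹ i.inv with h' | h'
    · exact Or.inl ⟨h, h'⟩
    · exact Or.inr ⟨h, h'⟩

theorem inner_high_low {l : ℤ} {v w : L2} (hv : v ∈ highSpace l) (hw : w ∈ lowSpace l) :
    ⟪v, w⟫_ℝ = 0 := by
  refine (eigenbasis.hasSum_inner_mul_inner v w).unique (hasSum_zero.congr_fun fun i => ?_)
  by_cases hi : i ∈ highModes l
  · rw [hw i fun h => absurd hi.2 (not_le.2 h.2), mul_zero]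
  · rw [real_inner_comm, hv i hi, zero_mul]

/-- Consecutive eigenvalues `l < r` of the wave operator, with `l ≠ 0`. -/
structure IsGap (l r : ℤ) : Prop where
  lt : l < r
  ne_zero : l ≠ 0
  isEigenvalue : IsEigenvalue l
  gap : ∀ j, IsEigenvalue j → j ≤ l ∨ r ≤ j

/-- The side of the open square `R̃_k`, where `l = λ_k` and `r = λ_{k+1}`. -/
def side (l r : ℤ) : Set ℝ := if l < 0 then Iio (r : ℝ) else Ioo 0 (r : ℝ)

variable {l r : ℤ}

theorem IsGap.right_nonpos (h : IsGap l r) (hl : l < 0) : r ≤ 0 := by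
  rcases h.gap 0 isEigenvalue_zero with h' | h' <;> omega

theorem IsGap.side_cases (h : IsGap l r) {a : ℝ} (ha : a ∈ side l r) :
    (0 < l ∧ 0 < a ∧ a < r) ∨ (l < 0 ∧ a < 0 ∧ a < r) := by
  rcases lt_or_gt_of_ne h.ne_zero with hl | hl
  · right
    rw [side, if_pos hl] at ha
    exact ⟨hl, lt_of_lt_of_le ha (by exact_mod_cast h.right_nonpos hl), ha⟩
  · left
    rw [side, if_neg hl.not_gt] at ha
    exact ⟨hl, ha.1, ha.2⟩

theorem isOpen_side : IsOpen (side l r) := by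
  unfold side; split_ifs
  · exact isOpen_Iio
  · exact isOpen_Ioo

theorem ordConnected_side : (side l r).OrdConnected := by
  unfold side; split_ifs
  · exact ordConnected_Iio
  · exact ordConnected_Ioo

theorem IsGap.Ico_subset_side (h : IsGap l r) : Ico (l : ℝ) r ⊆ side l r := by
  intro a ha
  unfold side
  split_ifs with hl
  · exact ha.2
  · have : (0 : ℝ) < l := by exact_mod_cast lt_of_le_of_ne (not_lt.1 hl) h.ne_zero.symm
    exact ⟨this.trans_le ha.1, ha.2⟩

theorem IsGap.inv_lt_inv (h : IsGap l r) {a b : ℝ} (ha : a ∈ side l r) (hb : b ∈ side l r)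
    (hab : a < b) : b⁻¹ < a⁻¹ := by
  rcases h.side_cases ha with ⟨h1, h2, -⟩ | ⟨h1, h2, -⟩
  · exact inv_strictAnti₀ h2 hab
  · rcases h.side_cases hb with ⟨h3, -, -⟩ | ⟨-, h4, -⟩
    · omega
    · exact (inv_lt_inv_of_neg h4 h2).2 hab

theorem IsGap.inv_le_inv (h : IsGap l r) {a b : ℝ} (ha : a ∈ side l r) (hb : b ∈ side l r)
    (hab : a ≤ b) : b⁻¹ ≤ a⁻¹ := by
  rcases hab.eq_or_lt with rfl | hab
  · exact le_rfl
  · exact (h.inv_lt_inv ha hb hab).le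

theorem IsGap.left_mem (h : IsGap l r) : (l : ℝ) ∈ side l r :=
  h.Ico_subset_side ⟨le_rfl, by exact_mod_cast h.lt⟩

/-- The inverse eigenvalues of the low modes stay below `1 / a`, for `a` in the side of the
square. -/
theorem IsGap.exists_inv_le (h : IsGap l r) {a : ℝ} (ha : a ∈ side l r) :
    ∃ c > 0, ∀ i ∈ lowModes l, i.inv ≤ a⁻¹ - c := by
  rcases h.side_cases ha with ⟨h1, h2, h3⟩ | ⟨h1, h2, h3⟩
  · have hl : (0 : ℝ) < l := by exact_mod_cast h1
    have hr : (0 : ℝ) < r := h2.trans h3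
    refine ⟨a⁻¹ - (r : ℝ)⁻¹, sub_pos.2 (inv_strictAnti₀ h2 h3), fun i hi => ?_⟩
    rw [sub_sub_cancel]
    rcases h.gap _ (isEigenvalue_eig i) with hj | hj
    · have hneg : i.eig < 0 := by
        by_contra! hnn
        have hpos : (0 : ℝ) < i.eig := by exact_mod_cast lt_of_le_of_ne hnn hi.1.symm
        exact absurd hi.2 (not_lt.2 (inv_anti₀ hpos (by exact_mod_cast hj)))
      have : i.inv < 0 := inv_lt_zero.2 (by exact_mod_cast hneg)
      exact this.le.trans (inv_nonneg.2 hr.le)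
    · exact inv_anti₀ hr (by exact_mod_cast hj)
  · have hl : (l : ℝ) < 0 := by exact_mod_cast h1
    have hlow : ∀ i ∈ lowModes l, i.eig < 0 ∧ r ≤ i.eig := by
      intro i hi
      have hinv : i.inv < 0 := hi.2.trans (inv_lt_zero.2 hl)
      have hneg : (i.eig : ℝ) < 0 := inv_lt_zero.1 hinv
      refine ⟨by exact_mod_cast hneg, (h.gap _ (isEigenvalue_eig i)).resolve_left fun hj => ?_⟩
      exact absurd hi.2 (not_lt.2 ((inv_le_inv_of_neg hl hneg).2 (by exact_mod_cast hj)))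
    rcases (h.right_nonpos h1).eq_or_lt with hr | hr
    · exact ⟨1, one_pos, fun i hi => by have := hlow i hi; omega⟩
    · have hr' : (r : ℝ) < 0 := by exact_mod_cast hr
      refine ⟨a⁻¹ - (r : ℝ)⁻¹, sub_pos.2 ((inv_lt_inv_of_neg hr' h2).2 h3), fun i hi => ?_⟩
      rw [sub_sub_cancel]
      obtain ⟨e1, e2⟩ := hlow i hi
      exact (inv_le_inv_of_neg (show (i.eig : ℝ) < 0 by exact_mod_cast e1) hr').2
        (by exact_mod_cast e2)

/-- The pair of the inverses of the coefficients. -/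
def invPair (x : ℝ × ℝ) : ℝ × ℝ := (x.1⁻¹, x.2⁻¹)

theorem IsGap.exists_subcritical (h : IsGap l r) {x : ℝ × ℝ} (hx : x ∈ side l r ×ˢ side l r) :
    ∃ c > 0, Subcritical invWave (lowSpace l) c (invPair x) := by
  obtain ⟨c, hc, h1⟩ := h.exists_inv_le hx.1
  obtain ⟨c', hc', h2⟩ := h.exists_inv_le hx.2
  refine ⟨min c c', lt_min hc hc', fun k hk => ⟨?_, ?_⟩⟩
  · exact diagonal_form_le inner_invWave
      (fun i hi => (h1 i hi).trans (sub_le_sub_left (min_le_left _ _) _)) hk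
  · exact diagonal_form_le inner_invWave
      (fun i hi => (h2 i hi).trans (sub_le_sub_left (min_le_right _ _) _)) hk

/-- The parameters on and below the curve. -/
def lowerSet (l r : ℤ) : Set (ℝ × ℝ) :=
  {x | x ∈ side l r ×ˢ side l r ∧ FiberNonneg invWave (highSpace l) (lowSpace l) (invPair x)}

theorem lowerSet_subset : lowerSet l r ⊆ side l r ×ˢ side l r := fun _ hx => hx.1

theorem IsGap.lowerSet_lower (h : IsGap l r) : ∀ x ∈ lowerSet l r, ∀ y ∈ side l r ×ˢ side l r,
    y.1 ≤ x.1 → y.2 ≤ x.2 → y ∈ lowerSet l r := fun _ hx _ hy h1 h2 =>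
  ⟨hy, hx.2.mono (h.inv_le_inv hy.1 hx.1.1 h1) (h.inv_le_inv hy.2 hx.1.2 h2)⟩

theorem lowerSet_swap {x : ℝ × ℝ} (hx : x ∈ lowerSet l r) : x.swap ∈ lowerSet l r :=
  ⟨⟨hx.1.2, hx.1.1⟩, hx.2.swap⟩

theorem IsGap.continuousAt_invPair (h : IsGap l r) {x : ℝ × ℝ} (hx : x ∈ side l r ×ˢ side l r) :
    ContinuousAt invPair x := by
  have hne : ∀ a ∈ side l r, a ≠ 0 := fun a ha => by
    rcases h.side_cases ha with ⟨-, h2, -⟩ | ⟨-, h2, -⟩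
    · exact h2.ne'
    · exact h2.ne
  exact (continuousAt_fst.inv₀ (hne _ hx.1)).prodMk (continuousAt_snd.inv₀ (hne _ hx.2))

theorem finite_highModes (hl : 0 < l) : (highModes l).Finite := by
  have hl' : (0 : ℝ) < l := by exact_mod_cast hl
  refine (finite_modes l).subset fun i hi => ⟨hi.1, ?_⟩
  have hpos : (0 : ℝ) < i.eig := inv_pos.1 ((inv_pos.2 hl').trans_le hi.2)
  rw [abs_of_pos hpos]
  exact (inv_le_inv₀ hl' hpos).1 hi.2

theorem IsGap.isOpen_diff_lowerSet (h : IsGap l r) :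
    IsOpen ((side l r ×ˢ side l r) \ lowerSet l r) := by
  rw [isOpen_iff_mem_nhds]
  rintro x ⟨hx, hxS⟩
  have hcase : FiniteDimensional ℝ (highSpace l) ∨
      (IsCompactOperator invWave ∧ (invPair x).1 < 0 ∧ (invPair x).2 < 0) := by
    rcases h.side_cases hx.1 with ⟨h1, -, -⟩ | ⟨h1, h2, -⟩
    · exact Or.inl (finiteDimensional_coordSubspace (finite_highModes h1))
    · rcases h.side_cases hx.2 with ⟨h3, -, -⟩ | ⟨-, h4, -⟩
      · omega
      · exact Or.inr ⟨isCompactOperator_invWave, inv_lt_zero.2 h2, inv_lt_zero.2 h4⟩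
  have hnot : ∀ᶠ y in 𝓝 (invPair x), ¬ FiberNonneg invWave (highSpace l) (lowSpace l) y := by
    rw [← not_frequently]
    exact fun hf => hxS ⟨hx, FiberNonneg.of_frequently invWave_symm (isClosed_coordSubspace _)
      hcase hf⟩
  filter_upwards [(h.continuousAt_invPair hx).eventually hnot,
    (isOpen_side.prod isOpen_side).mem_nhds hx] with y hy hyI
  exact ⟨hyI, fun hyS => hy hyS.2⟩

theorem IsGap.exists_mode (h : IsGap l r) :
    ∃ i : Mode, i.eig = l ∧ i.b = false ∧ i ∈ highModes l := by
  obtain ⟨m, n, hm, hmn⟩ := h.isEigenvalue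
  set i : Mode := ⟨(m, n, false), hm, by simp⟩ with hi
  have hil : i.eig = l := hmn.symm
  exact ⟨i, hil, rfl, by rw [hil]; exact h.ne_zero, by rw [Mode.inv, hil]⟩

theorem IsGap.diagonal_mem (h : IsGap l r) : ((l : ℝ), (l : ℝ)) ∈ lowerSet l r := by
  obtain ⟨i, hi, -, hih⟩ := h.exists_mode
  refine ⟨⟨h.left_mem, h.left_mem⟩, eigenbasis i, basis_mem_coordSubspace hih,
    eigenbasis.orthonormal.ne_zero i, fun w hw => ?_⟩
  have hmem : eigenbasis i + w ∈ coordSubspace eigenbasis ({i} ∪ lowModes l) :=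
    Submodule.add_mem _ (basis_mem_coordSubspace (Or.inl rfl))
      (coordSubspace_mono subset_union_right hw)
  have hle : ∀ j ∈ {i} ∪ lowModes l, j.inv ≤ (l : ℝ)⁻¹ := by
    rintro j (rfl | hj)
    · rw [Mode.inv, hi]
    · exact hj.2.le
  have := diagonal_form_le inner_invWave hle hmem
  rw [asymForm, invPair, ← mul_add, norm_posPart_sq_add]
  linarith

/-- Above the diagonal point the functional is negative on the high modes. -/
theorem IsGap.notMem_lowerSet (h : IsGap l r) {x : ℝ × ℝ} (h1 : (l : ℝ) < x.1)
    (h2 : (l : ℝ) < x.2) : x ∉ lowerSet l r := by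
  rintro ⟨hx, v, hv, hv0, hvw⟩
  have e1 := h.inv_lt_inv h.left_mem hx.1 h1
  have e2 := h.inv_lt_inv h.left_mem hx.2 h2
  have h0 := hvw 0 (Submodule.zero_mem _)
  have hge := le_diagonal_form inner_invWave (C := (l : ℝ)⁻¹) (fun i hi => hi.2) hv
  rw [add_zero, asymForm, invPair] at h0
  dsimp only at h0
  rw [← norm_posPart_sq_add] at hge
  have hpos : 0 < ‖Lp.posPart v‖ ^ 2 + ‖Lp.negPart v‖ ^ 2 := by
    rw [norm_posPart_sq_add]; positivity
  rcases (sq_nonneg ‖Lp.posPart v‖).eq_or_lt with hp | hp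
  · rw [← hp] at hpos h0 hge
    nlinarith
  · nlinarith [sq_nonneg ‖Lp.negPart v‖, mul_lt_mul_of_pos_right e1 hp,
      mul_le_mul_of_nonneg_right e2.le (sq_nonneg ‖Lp.negPart v‖)]

theorem IsGap.diagonal_mem_upperBoundary (h : IsGap l r) :
    ((l : ℝ), (l : ℝ)) ∈ upperBoundary (lowerSet l r) :=
  ⟨h.diagonal_mem, fun ε hε => h.notMem_lowerSet (by dsimp only; linarith)
    (by dsimp only; linarith)⟩

/-- On the curve the reduced functional is nowhere positive. -/
theorem IsGap.exists_lt_of_mem_upperBoundary (h : IsGap l r) {x : ℝ × ℝ}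
    (hx : x ∈ upperBoundary (lowerSet l r)) : ∀ v ∈ highSpace l, ∀ m > 0, ∃ w ∈ lowSpace l,
      asymForm invWave (invPair x) (v + w) < m := by
  intro v hv m hm
  by_contra! hcon
  have hv0 : v ≠ 0 := by
    rintro rfl
    have h1 := hcon 0 (Submodule.zero_mem _)
    have h2 : asymForm invWave (invPair x) 0 = 0 := by
      simpa using asymForm_smul (T := invWave) (x := invPair x) le_rfl 0
    rw [add_zero, h2] at h1
    linarith
  obtain ⟨c, hc, hsub⟩ := h.exists_subcritical hx.1.1
  have hev := (h.continuousAt_invPair hx.1.1).eventually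
    (eventually_fiberNonneg invWave_symm (isClosed_coordSubspace _) hc hsub hv hv0 hm hcon)
  have hev' := hev.and ((isOpen_side.prod isOpen_side).mem_nhds hx.1.1)
  have hcont : Continuous fun ε : ℝ => ((x.1 + ε, x.2 + ε) : ℝ × ℝ) := by fun_prop
  have ht : Tendsto (fun ε : ℝ => ((x.1 + ε, x.2 + ε) : ℝ × ℝ)) (𝓝[>] 0) (𝓝 x) :=
    ((hcont.tendsto' 0 x (by simp)).mono_left nhdsWithin_le_nhds)
  obtain ⟨ε, ⟨h1, h2⟩, hε⟩ := ((ht.eventually hev').and self_mem_nhdsWithin).exists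
  exact hx.2 ε hε ⟨h2, h1⟩

theorem IsGap.same_sign (h : IsGap l r) {x : ℝ × ℝ} (hx : x ∈ side l r ×ˢ side l r) :
    (0 < x.1 ∧ 0 < x.2) ∨ (x.1 < 0 ∧ x.2 < 0) := by
  rcases h.side_cases hx.1 with ⟨h1, h2, -⟩ | ⟨h1, h2, -⟩ <;>
    rcases h.side_cases hx.2 with ⟨h3, h4, -⟩ | ⟨h3, h4, -⟩
  · exact Or.inl ⟨h2, h4⟩
  · omega
  · omega
  · exact Or.inr ⟨h2, h4⟩

/-- At a point of the curve, a fibre with nonnegative values carries a dual solution. -/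
theorem IsGap.exists_dual (h : IsGap l r) {x : ℝ × ℝ} (hx : x ∈ upperBoundary (lowerSet l r))
    {v : L2} (hv : v ∈ highSpace l) (hv0 : v ≠ 0)
    (hvw : ∀ w ∈ lowSpace l, 0 ≤ asymForm invWave (invPair x) (v + w)) :
    ∃ w ∈ lowSpace l, v + w ≠ 0 ∧ IsDualSolution (invPair x) (v + w) ∧
      asymForm invWave (invPair x) (v + w) = 0 := by
  obtain ⟨c, hc, hsub⟩ := h.exists_subcritical hx.1.1
  obtain ⟨w, hw, hcrit, hzero⟩ := exists_critical invWave_symm (isClosed_coordSubspace _) hc hsub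
    (h.exists_lt_of_mem_upperBoundary hx) hv hvw
  rw [highSpace_sup_lowSpace] at hcrit
  refine ⟨w, hw, fun h0 => hv0 ?_, ⟨?_, hcrit⟩, hzero⟩
  · have h1 := inner_high_low hv hw
    rw [eq_neg_of_add_eq_zero_right h0, inner_neg_right, neg_eq_zero, inner_self_eq_zero] at h1
    exact h1
  · rw [← highSpace_sup_lowSpace l]
    exact Submodule.add_mem _ (Submodule.mem_sup_left hv) (Submodule.mem_sup_right hw)

theorem IsGap.hasNontrivialWeakSolution (h : IsGap l r) {x : ℝ × ℝ}
    (hx : x ∈ upperBoundary (lowerSet l r)) : HasNontrivialWeakSolution x.1 x.2 := by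
  obtain ⟨v, hv, hv0, hvw⟩ := hx.1.2
  obtain ⟨w, -, h0, hdual, -⟩ := h.exists_dual hx hv hv0 hvw
  exact (hasNontrivialWeakSolution_iff (h.same_sign hx.1.1)).2 ⟨v + w, h0, hdual⟩

theorem IsGap.not_hasNontrivialWeakSolution (h : IsGap l r) {x : ℝ × ℝ}
    (hx : x ∈ (side l r ×ˢ side l r) \ lowerSet l r) : ¬ HasNontrivialWeakSolution x.1 x.2 := by
  rw [hasNontrivialWeakSolution_iff (h.same_sign hx.1)]
  rintro ⟨u, h0, hu⟩
  obtain ⟨c, hc, hsub⟩ := h.exists_subcritical hx.1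
  refine hx.2 ⟨hx.1, FiberNonneg.of_critical invWave_symm hc hsub ?_ h0 ?_⟩
  · rw [highSpace_sup_lowSpace]; exact hu.1
  · rw [highSpace_sup_lowSpace]; exact hu.2

end Curve

/-! ### Strict monotonicity of the curve -/

section Strict

variable {l r : ℤ}

theorem abs_sin_natCast_mul_le (m : ℕ) (s : ℝ) : |Real.sin (m * s)| ≤ m * |Real.sin s| := by
  induction m with
  | zero => simp
  | succ m ih =>
    have e : Real.sin ((m + 1 : ℕ) * s)
        = Real.sin (m * s) * Real.cos s + Real.cos (m * s) * Real.sin s := by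
      rw [← Real.sin_add]; push_cast; ring_nf
    rw [e]
    have h1 := abs_add_le (Real.sin (m * s) * Real.cos s) (Real.cos (m * s) * Real.sin s)
    rw [abs_mul, abs_mul] at h1
    have h2 := mul_le_of_le_one_right (abs_nonneg (Real.sin (m * s))) (Real.abs_cos_le_one s)
    have h3 := mul_le_of_le_one_left (abs_nonneg (Real.sin s)) (Real.abs_cos_le_one (m * s))
    push_cast
    linarith

/-- The positive eigenfunction `φ_{(1,0)}` dominates every eigenfunction. -/
theorem phiFun_le_mul_phiFun_one_zero (m n : ℕ) {p : ℝ × ℝ}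
    (hp : p ∈ Ioo 0 Real.pi ×ˢ Ioo 0 (2 * Real.pi)) : phiFun m n p ≤ m * phiFun 1 0 p := by
  have hc : 0 ≤ Real.sqrt 2 / Real.pi := div_nonneg (Real.sqrt_nonneg _) Real.pi_pos.le
  have hs := abs_of_pos (Real.sin_pos_of_mem_Ioo hp.1)
  have h1 := abs_sin_natCast_mul_le m p.1
  have h2 : Real.sin (m * p.1) * Real.cos (n * p.2) ≤ |Real.sin (m * p.1)| := by
    refine (le_abs_self _).trans ?_
    rw [abs_mul]
    exact mul_le_of_le_one_right (abs_nonneg _) (Real.abs_cos_le_one _)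
  rw [hs] at h1
  simp only [phiFun, Nat.cast_one, one_mul, Nat.cast_zero, zero_mul, Real.cos_zero, mul_one]
  have h3 := mul_le_mul_of_nonneg_left (h2.trans h1) hc
  linarith

theorem posPart_eq_zero {Ω : Type*} [MeasurableSpace Ω] {μ : Measure Ω} {h : Lp ℝ 2 μ}
    (hh : ∀ᵐ p ∂μ, h p ≤ 0) : Lp.posPart h = 0 := by
  apply Lp.ext
  filter_upwards [Lp.coeFn_posPart h, Lp.coeFn_zero ℝ 2 μ, hh] with p h1 h2 h3
  rw [h1, h2, max_eq_right h3]; rfl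

theorem eq_zero_of_inner_eq_zero {Ω : Type*} [MeasurableSpace Ω] {μ : Measure Ω} {u e : Lp ℝ 2 μ}
    (hu : ∀ᵐ p ∂μ, 0 ≤ u p) (he : ∀ᵐ p ∂μ, 0 < e p) (h : ⟪u, e⟫_ℝ = 0) : u = 0 := by
  rw [L2.inner_def] at h
  have hmul : ∀ x y : ℝ, ⟪x, y⟫_ℝ = y * x := fun x y => rfl
  have h0 := (integral_eq_zero_iff_of_nonneg_ae (by
    filter_upwards [hu, he] with p h1 h2
    rw [hmul]
    exact mul_nonneg h2.le h1) (L2.integrable_inner u e)).1 h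
  apply Lp.ext
  filter_upwards [h0, he, Lp.coeFn_zero ℝ 2 μ] with p h1 h2 h3
  rw [hmul] at h1
  rw [h3]
  exact (mul_eq_zero.1 h1).resolve_left h2.ne'

/-- The mode of the positive eigenfunction `φ_{(1,0)}`, with eigenvalue `1`. -/
def oneMode : Mode := ⟨(1, 0, false), le_rfl, by simp⟩

theorem oneMode_eig : oneMode.eig = 1 := by simp [oneMode, Mode.eig, Mode.m, Mode.n]

theorem coeFn_vec {i : Mode} (hb : i.b = false) :
    i.vec =ᵐ[cylinderMeasure] phiFun i.m i.n := by
  rw [Mode.vec, hb]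
  exact coeFn_toL2 (continuous_wave true false i.m i.n)

theorem vec_oneMode_pos : ∀ᵐ p ∂cylinderMeasure, 0 < oneMode.vec p := by
  filter_upwards [coeFn_vec (i := oneMode) rfl, ae_mem_openRect] with p h1 h2
  rw [h1]; exact phiFun_one_zero_pos h2

theorem posPart_vec_sub {i : Mode} (hb : i.b = false) :
    Lp.posPart (i.vec - (i.m : ℝ) • oneMode.vec) = 0 := by
  refine posPart_eq_zero ?_
  filter_upwards [coeFn_vec hb, coeFn_vec (i := oneMode) rfl, ae_mem_openRect,
    Lp.coeFn_sub i.vec ((i.m : ℝ) • oneMode.vec), Lp.coeFn_smul (i.m : ℝ) oneMode.vec]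
    with p h1 h2 h3 h4 h5
  rw [h4, Pi.sub_apply, h5, Pi.smul_apply, h1, h2, smul_eq_mul]
  exact sub_nonpos.2 (phiFun_le_mul_phiFun_one_zero _ _ h3)

theorem invWave_vec (i : Mode) : invWave i.vec = i.inv • i.vec := by
  have h : invWave (eigenbasis i) = i.inv • eigenbasis i :=
    diagonal_apply_basis eigenbasis inner_invWave i
  have hn : ‖i.vec‖⁻¹ ≠ 0 := inv_ne_zero (norm_ne_zero_iff.2 i.vec_ne_zero)
  rw [eigenbasis_apply, map_smul, smul_comm] at h
  exact smul_right_injective _ hn h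

/-- If `1 < l`, the function `z - M φ_{(1,0)} ≤ 0`, where `z` is an eigenfunction for `l`, shows
that the reduced functional takes positive values at the points `(a, 1)`. -/
theorem IsGap.one_notMem_upperBoundary (h : IsGap l r) (hl : 1 < l) (a : ℝ) :
    (a, (1 : ℝ)) ∉ upperBoundary (lowerSet l r) := by
  intro hx
  obtain ⟨i, hil, hib, hih⟩ := h.exists_mode
  have hl1 : (1 : ℝ) < l := by exact_mod_cast hl
  have hinv : i.inv = (l : ℝ)⁻¹ := by rw [Mode.inv, hil]
  have h1inv : oneMode.inv = 1 := by rw [Mode.inv, oneMode_eig]; simp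
  have h1h : oneMode ∈ highModes l :=
    ⟨by rw [oneMode_eig]; exact one_ne_zero, by rw [h1inv]; exact inv_le_one_of_one_le₀ hl1.le⟩
  have hne : i ≠ oneMode := by
    intro he
    rw [he, oneMode_eig] at hil
    omega
  set z := i.vec with hz
  set e := oneMode.vec with he
  set M : ℝ := (i.m : ℝ) with hM
  have hzh : z ∈ highSpace l := vec_mem_coordSubspace hih
  have heh : e ∈ highSpace l := vec_mem_coordSubspace h1h
  have hvh : z - M • e ∈ highSpace l := Submodule.sub_mem _ hzh (Submodule.smul_mem _ _ heh)
  have hze : ⟪z, e⟫_ℝ = 0 := Mode.inner_vec_eq_zero hne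
  have hTz : invWave z = (l : ℝ)⁻¹ • z := by rw [hz, invWave_vec, hinv]
  have hTe : invWave e = e := by rw [he, invWave_vec, h1inv, one_smul]
  have hzpos : 0 < ‖z‖ ^ 2 := by
    have := norm_pos_iff.2 i.vec_ne_zero
    positivity
  have hlt : (l : ℝ)⁻¹ < 1 := inv_lt_one_of_one_lt₀ hl1
  obtain ⟨c, hc, hsub⟩ := h.exists_subcritical hx.1.1
  obtain ⟨w, hw, hlt'⟩ := h.exists_lt_of_mem_upperBoundary hx _ hvh
    (1 / 2 * ((1 - (l : ℝ)⁻¹) * ‖z‖ ^ 2)) (by have := sub_pos.2 hlt; positivity)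
  refine absurd hlt' (not_lt.2 ?_)
  have hzw := inner_high_low hzh hw
  have hew := inner_high_low heh hw
  have hnorm : ‖z - M • e + w‖ ^ 2 = ‖z‖ ^ 2 + M ^ 2 * ‖e‖ ^ 2 + ‖w‖ ^ 2 := by
    rw [norm_add_sq_real, inner_high_low hvh hw, norm_sub_sq_real, real_inner_smul_right, hze,
      norm_smul, mul_pow, Real.norm_eq_abs, sq_abs]
    ring
  have hT : ⟪invWave (z - M • e + w), z - M • e + w⟫_ℝ
      = (l : ℝ)⁻¹ * ‖z‖ ^ 2 + M ^ 2 * ‖e‖ ^ 2 + ⟪invWave w, w⟫_ℝ := by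
    have h1 : ⟪invWave w, z⟫_ℝ = 0 := by
      rw [invWave_symm, hTz, real_inner_smul_right, real_inner_comm, hzw, mul_zero]
    have h2 : ⟪invWave w, e⟫_ℝ = 0 := by rw [invWave_symm, hTe, real_inner_comm, hew]
    rw [map_add, map_sub, map_smul, hTz, hTe]
    simp only [inner_add_left, inner_add_right, inner_sub_left, inner_sub_right,
      real_inner_smul_left, real_inner_smul_right, real_inner_self_eq_norm_sq, h1, h2, hzw, hew,
      hze, real_inner_comm z e, norm_smul, mul_pow, Real.norm_eq_abs, sq_abs]
    ring
  have hpos : ‖Lp.posPart (z - M • e + w)‖ ^ 2 ≤ ‖w‖ ^ 2 := by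
    have := norm_posPart_add_sub_le (z - M • e) w
    rw [posPart_vec_sub hib, sub_zero] at this
    exact pow_le_pow_left₀ (norm_nonneg _) this 2
  have hsplit := norm_posPart_sq_add (z - M • e + w)
  obtain ⟨s1, s2⟩ := hsub w hw
  have hcw : 0 ≤ c * ‖w‖ ^ 2 := by positivity
  rw [asymForm, hT]
  simp only [invPair, inv_one] at s1 s2 ⊢
  have hp0 := sq_nonneg ‖Lp.posPart (z - M • e + w)‖
  rcases le_total a⁻¹ 1 with ha | ha
  · nlinarith [mul_le_mul_of_nonneg_left hpos (sub_nonneg.2 ha)]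
  · nlinarith [mul_nonneg (sub_nonneg.2 ha) hp0]

/-- A dual solution without positive part is a multiple of the positive eigenfunction, hence
belongs to the coefficient `1`. -/
theorem IsDualSolution.eq_one {x : ℝ × ℝ} {h : L2} (hd : IsDualSolution x h) (h0 : h ≠ 0)
    (hp : Lp.posPart h = 0) : x.2 = 1 := by
  have hh : h = -Lp.negPart h := by
    conv_lhs => rw [← posPart_sub_negPart h, hp, zero_sub]
  have h1inv : oneMode.inv = 1 := by rw [Mode.inv, oneMode_eig]; simp
  have he : oneMode.vec ∈ rangeSpace := by
    rw [rangeSpace_eq]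
    exact vec_mem_coordSubspace (by rw [mem_ofPred_eq, oneMode_eig]; exact one_ne_zero)
  have h1 := hd.2 _ he
  rw [inner_sub_left, invWave_symm, invWave_vec, h1inv, one_smul, inner_asymMul, hp,
    inner_zero_left, mul_zero, zero_sub] at h1
  have h2 : ⟪h, oneMode.vec⟫_ℝ = -⟪Lp.negPart h, oneMode.vec⟫_ℝ := by
    conv_lhs => rw [hh, inner_neg_left]
  have h3 : ⟪Lp.negPart h, oneMode.vec⟫_ℝ ≠ 0 := by
    intro h4
    have h5 := eq_zero_of_inner_eq_zero (posPart_ae_nonneg (-h)) vec_oneMode_pos h4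
    exact h0 (by rw [hh, show Lp.negPart h = 0 from h5, neg_zero])
  rw [h2] at h1
  have h6 : (1 - x.2) * ⟪Lp.negPart h, oneMode.vec⟫_ℝ = 0 := by linarith
  linarith [(mul_eq_zero.1 h6).resolve_right h3]

/-- The curve contains no horizontal segment, except possibly for `l = 1`. -/
theorem IsGap.not_lt_of_mem (h : IsGap l r) (hl : l < 0 ∨ 1 < l) (a a' b : ℝ)
    (h1 : (a, b) ∈ upperBoundary (lowerSet l r)) (h2 : (a', b) ∈ upperBoundary (lowerSet l r)) :
    ¬ a < a' := by
  intro haa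
  have hlt := h.inv_lt_inv h1.1.1.1 h2.1.1.1 haa
  obtain ⟨v, hv, hv0, hvw⟩ := h2.1.2
  obtain ⟨w, hw, hne, hdual, hzero⟩ := h.exists_dual h1 hv hv0 fun w hw =>
    (hvw w hw).trans
      (asymForm_mono (x := invPair (a', b)) (y := invPair (a, b)) hlt.le le_rfl _)
  have h3 := hvw w hw
  have hpz : Lp.posPart (v + w) = 0 := by
    simp only [asymForm, invPair] at h3 hzero
    have h4 : 0 ≤ (a'⁻¹ - a⁻¹) * ‖Lp.posPart (v + w)‖ ^ 2 := by linarith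
    have h5 : ‖Lp.posPart (v + w)‖ ^ 2 ≤ 0 := by
      by_contra! hcon
      nlinarith [mul_pos (sub_pos.2 hlt) hcon]
    exact norm_eq_zero.1 (pow_eq_zero_iff two_ne_zero |>.1 (le_antisymm h5 (sq_nonneg _)))
  have hb : b = 1 := inv_eq_one.1 (hdual.eq_one hne hpz)
  rcases hl with hl | hl
  · rcases h.side_cases h1.1.1.2 with ⟨h6, -, -⟩ | ⟨-, h6, -⟩
    · omega
    · dsimp only at h6
      linarith
  · rw [hb] at h1
    exact h.one_notMem_upperBoundary hl a h1

end Strict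

/-! ### Identification of the regions -/

theorem isGap_eigenvalueInt {k : ℤ} (hk : eigenvalue k ≠ 0) :
    IsGap (eigenvalueInt k) (eigenvalueInt (k + 1)) where
  lt := eigenvalueInt_lt_succ k
  ne_zero := fun h => hk (by rw [eigenvalue, h, Int.cast_zero])
  isEigenvalue := isEigenvalue_eigenvalueInt k
  gap := fun _ hj => eigenvalueInt_gap k hj

theorem region_eq (k : ℤ) : region k =
    side (eigenvalueInt k) (eigenvalueInt (k + 1)) ×ˢ
      side (eigenvalueInt k) (eigenvalueInt (k + 1)) := by
  have hiff : eigenvalue k < 0 ↔ eigenvalueInt k < 0 := by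
    rw [eigenvalue]; exact_mod_cast Iff.rfl
  unfold region side
  by_cases h : eigenvalue k < 0
  · rw [if_pos h, if_pos (hiff.1 h)]; rfl
  · rw [if_neg h, if_neg (fun h' => h (hiff.2 h'))]; rfl

theorem upperBoundary_lowerSet_swap {l r : ℤ} {a b : ℝ}
    (h : (a, b) ∈ upperBoundary (lowerSet l r)) : (b, a) ∈ upperBoundary (lowerSet l r) :=
  ⟨lowerSet_swap h.1, fun ε hε hm => h.2 ε hε (lowerSet_swap hm)⟩

end WaveFucik

end

open WaveFucik

theorem mainTheorem2 (k : ℤ) (hk : WaveFucik.eigenvalue k ≠ 0) :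
    ∃ D : Set (ℝ × ℝ),
      D ⊆ WaveFucik.region k ∧
      WaveFucik.IsContinuousCurve D ∧
      (WaveFucik.eigenvalue k, WaveFucik.eigenvalue k) ∈ D ∧
      (∀ a b : ℝ, (a, b) ∈ D → (b, a) ∈ D) ∧
      (k ≠ 1 → WaveFucik.IsStrictlyDecreasingGraph D) ∧
      (∀ a b : ℝ, (a, b) ∈ D → WaveFucik.HasNontrivialWeakSolution a b) ∧
      ∃ U : Set (ℝ × ℝ),
        WaveFucik.DividesWithSide (WaveFucik.region k) D
          (Set.Ioo (WaveFucik.eigenvalue k) (WaveFucik.eigenvalue (k + 1)) ×ˢ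
            Set.Ioo (WaveFucik.eigenvalue k) (WaveFucik.eigenvalue (k + 1))) U ∧
        ∀ a b : ℝ, (a, b) ∈ U → ¬ WaveFucik.HasNontrivialWeakSolution a b := by
  have h := isGap_eigenvalueInt hk
  have hdiag := h.diagonal_mem_upperBoundary
  have hsymm : ∀ a b : ℝ, (a, b) ∈ upperBoundary (lowerSet (eigenvalueInt k)
      (eigenvalueInt (k + 1))) → (b, a) ∈ upperBoundary (lowerSet (eigenvalueInt k)
      (eigenvalueInt (k + 1))) := fun a b => upperBoundary_lowerSet_swap
  rw [region_eq]
  refine ⟨upperBoundary (lowerSet (eigenvalueInt k) (eigenvalueInt (k + 1))),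
    fun x hx => lowerSet_subset hx.1, ?_, hdiag, hsymm, fun hk1 => ?_,
    fun a b hab => h.hasNontrivialWeakSolution hab, _,
    dividesWithSide_upperBoundary isOpen_side ordConnected_side lowerSet_subset h.lowerSet_lower
      h.isOpen_diff_lowerSet ⟨_, hdiag⟩ fun x hx => ?_,
    fun a b hab => h.not_hasNontrivialWeakSolution hab⟩
  · exact isContinuousCurve_upperBoundary isOpen_side ordConnected_side lowerSet_subset
      h.lowerSet_lower h.isOpen_diff_lowerSet ⟨_, hdiag⟩
  · refine isStrictlyDecreasingGraph_upperBoundary ordConnected_side lowerSet_subset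
      h.lowerSet_lower hsymm (h.not_lt_of_mem ?_)
    rcases lt_or_gt_of_ne h.ne_zero with hl | hl
    · exact Or.inl hl
    · exact Or.inr (one_lt_eigenvalueInt hk1 hl)
  · exact ⟨⟨h.Ico_subset_side ⟨hx.1.1.le, hx.1.2⟩, h.Ico_subset_side ⟨hx.2.1.le, hx.2.2⟩⟩,
      h.notMem_lowerSet hx.1.1 hx.2.1⟩
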